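/- **Setting.** Consider an episodic MDP with state space $\mathcal S$, action space $\mathcal A$, horizon $H\ge 1$, transitions $P_1,\dots,P_H$, fixed initial state $s_1$ and unknown true reward $r^{\rm true}=(r^{\rm true}_h)_{h\le H}$, $r^{\rm true}_h:\mathcal S\times\mathcal A\to[0,1]$. For a policy $\pi$ and a reward $r$ let $V^\pi_r=\mathbb E_\pi[\sum_h r_h(s_h,a_h)]$, $V^\pi=V^\pi_{r^{\rm true}}$, $Q^{\star,r}_h(s,a)=\sup_\pi \mathbb E_\pi[\sum_{\ell\ge h}r_\ell(s_\ell,a_\ell)\mid s_h=s,a_h=a]$ and $(\mathcal T^r_hQ_{h+1})(s,a)=r_h(s,a)+\mathbb E_{s'\sim P_h(\cdot|s,a)}[\max_{a'}Q_{h+1}(s',a')]$, with $Q_{H+1}\equiv0$ always. Let $\mathcal R=\mathcal R_1\times\dots\times\mathcal R_H$ with $\mathcal R_h\subseteq(\mathcal S\times\mathcal A\to[0,1])$ and $\mathcal Q=\mathcal Q_1\times\dots\times\mathcal Q_H$ with $\mathcal Q_h\subseteq(\mathcal S\times\mathcal A\to[0,H])$ be classes of measurable functions, where maxima over actions of elements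 of $\mathcal Q_h$ are attained by measurable selections. $\mathcal N_\rho(\mathcal F)$ is the smallest cardinality of a $\rho$-cover of $\mathcal F$ in sup-norm with centers in $\mathcal F$ (for $\mathcal Q$ and $\mathcal R$: as classes of functions of $(h,s,a)$). Assume $r^{\rm true}\in\mathcal R$; $Q^{\star,r}\in\mathcal Q$ for all $r\in\mathcal R$; and $\mathcal T^r_h\mathcal Q_{h+1}\subseteq\mathcal Q_h$ for all $r\in\mathcal R$, $h\le H$. For $\varepsilon'>0$ let $d_{\rm GEC}(\varepsilon')$ be the smallest $d\ge 0$ such that for all $r^1,\dots,r^K\in\mathcal R$, $Q^1,\dots,Q^K\in\mathcal Q$ and greedy policies $\pi^k$ of $Q^k$, $$\sum_{k=1}^K \big(Q^k_1(s_1,\pi^k_1(s_1))-V^{\pi^k}_{r^k}\big)\le\inf_{\mu>0}\Big\{\frac\mu2\sum_{k=1}^K\sum_{i=1}^{k-1}\mathbb E_{\pi^i}\Big[\sum_{h=1}^H\big(Q^k_h-\mathcal T^{r^k}_hQ^k_{h+1}\big)^2(s_h,a_h)\Big]+\frac d{2\mu}\Big\}+\sqrt{dHK}+\varepsilon'HK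 .$$ **Algorithm (OPT-AIL).** Given $N$ i.i.d. trajectories of an expert policy $\pi^E$ and an initial policy $\pi^0$, for $k=1,\dots,K$: (i) roll out a trajectory $\tau^{k-1}=(s^{k-1}_h,a^{k-1}_h)_{h\le H}$ of $\pi^{k-1}$; (ii) choose $r^k\in\mathcal R$ from the information available so far; (iii) choose $Q^k\in\mathcal Q$ as an approximate minimizer of $$\mathcal L^k(Q)=\sum_{h=1}^H\Big(\mathcal E^k_h(Q_h,Q_{h+1})-\inf_{Q'_h\in\mathcal Q_h}\mathcal E^k_h(Q'_h,Q_{h+1})\Big)-\lambda\max_aQ_1(s_1,a),$$ where $\mathcal E^k_h(q,Q_{h+1})=\sum_{i=0}^{k-1}\big(q(s^i_h,a^i_h)-r^k_h(s^i_h,a^i_h)-\max_{a'}Q_{h+1}(s^i_{h+1},a')\big)^2$; (iv) let $\pi^k$ be a greedy policy of $Q^k$. The output $\bar\pi$ is drawn uniformly from $\pi^1,\dots,\pi^K$ (and then followed for the whole episode), so $V^{\bar\pi}=\frac1K\sum_{k=1}^KV^{\pi^k}$. The choices in (ii) and (iii) may be randomized. Let $\widehat V^{\pi^k}_r=\sum_hr_h(s^k_h,a^k_h)$,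 where also $\tau^K$ is rolled out with $\pi^K$, let $\widehat V^{\pi^E}_r$ be the average reward of the expert trajectories, and put $$\varepsilon^r_{\rm opt}=\frac1K\sup_{r\in\mathcal R}\sum_{k=1}^K\Big(\widehat V^{\pi^k}_{r^k}-\widehat V^{\pi^E}_{r^k}-\big(\widehat V^{\pi^k}_r-\widehat V^{\pi^E}_r\big)\Big),\qquad \varepsilon^Q_{\rm opt}=\max_{1\le k\le K}\Big(\mathcal L^k(Q^k)-\inf_{Q\in\mathcal Q}\mathcal L^k(Q)\Big).$$ **Theorem 1.** There are absolute constants $c_1,c_2,c_N,c_K>0$ such that the following holds. Let $\varepsilon,\delta\in(0,1]$, let $d\ge1$ be any number with $d\ge d_{\rm GEC}(\varepsilon/(6H))$, let $\rho=c_2\varepsilon^2/(H^3d+H)$, let the covering numbers below be finite, and run OPT-AIL with $$\lambda=c_1\sqrt{\frac{KH^3\log\big(4KH\,\mathcal N_\rho(\mathcal Q)\mathcal N_\rho(\mathcal R)/\delta\big)+K^2H^3\rho}{d}} .$$ If $$N\ge c_N\frac{H^2\log(\max_h\mathcal N_\rho(\mathcal R_h)/\delta)}{\varepsilon^2},\qquad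 K\ge c_K\frac{H^4d\log\big(Hd\max_h\mathcal N_\rho(\mathcal Q_h)\mathcal N_\rho(\mathcal R_h)/(\delta\varepsilon)\big)+H^2\log(1/\delta)}{\varepsilon^2},$$ then with probability at least $1-\delta$, $$V^{\pi^E}-V^{\bar\pi}\le\varepsilon+\varepsilon^r_{\rm opt}+\varepsilon^Q_{\rm opt}/\lambda .$$ -/

import Mathlib

open MeasureTheory ProbabilityTheory

noncomputable section

namespace OptAil

variable {S A : Type*} [MeasurableSpace S] [MeasurableSpace A]

/-- An episodic MDP with horizon `H`, transition kernels `P_1, …, P_H`, (unknown) true reward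
functions with values in `[0, 1]` and a fixed initial state. Steps are indexed by `Fin H`, so the
step `h ∈ {1, …, H}` is the index `h - 1`. -/
structure MDP (S A : Type*) [MeasurableSpace S] [MeasurableSpace A] (H : ℕ) where
  P : Fin H → Kernel (S × A) S
  markov : ∀ h, IsMarkovKernel (P h)
  reward : Fin H → S × A → ℝ
  reward_measurable : ∀ h, Measurable (reward h)
  reward_mem : ∀ h x, reward h x ∈ Set.Icc (0 : ℝ) 1
  s₁ : S

/-- A non-stationary (stochastic) policy. -/
structure Policy (S A : Type*) [MeasurableSpace S] [MeasurableSpace A] (H : ℕ) where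
  kernel : Fin H → Kernel S A
  markov : ∀ h, IsMarkovKernel (kernel h)

/-- A deterministic non-stationary policy. -/
structure DetPolicy (S A : Type*) [MeasurableSpace S] [MeasurableSpace A] (H : ℕ) where
  act : Fin H → S → A
  measurable_act : ∀ h, Measurable (act h)

/-- A deterministic policy, regarded as a stochastic one. -/
def DetPolicy.toPolicy {H : ℕ} (π : DetPolicy S A H) : Policy S A H where
  kernel h := Kernel.deterministic (π.act h) (π.measurable_act h)
  markov _ := inferInstance

/-- The law of the `n`-step trajectory `(s_1, a_1, …, s_n, a_n)` started in a given state, where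
`a_h ∼ π_h(s_h)` and `s_{h+1} ∼ P_h(s_h, a_h)`. -/
def trajKernel : (n : ℕ) → (Fin n → Kernel (S × A) S) → (Fin n → Kernel S A) →
    Kernel S (Fin n → S × A)
  | 0, _, _ => Kernel.deterministic (fun _ => Fin.elim0) measurable_const
  | n + 1, P, π =>
      (Kernel.id ×ₖ ((π 0 ⊗ₖ P 0) ⊗ₖ
        (trajKernel n (fun j => P j.succ) (fun j => π j.succ)).comap
          (fun p : S × (A × S) => p.2.2) (measurable_snd.comp measurable_snd))).map
        (fun x : S × ((A × S) × (Fin n → S × A)) =>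
          (Fin.cons (x.1, x.2.1.1) x.2.2 : Fin (n + 1) → S × A))

/-- The entries of a family over the steps `h + 1, …, H`, those strictly after `h`. -/
def tailFrom {H : ℕ} {X : Type*} (h : Fin H) (f : Fin H → X) : Fin (H - (h.1 + 1)) → X :=
  fun j => f ⟨h.1 + 1 + j.1, by omega⟩

/-- The cumulative reward `∑_h r_h(s_h, a_h)` of a trajectory. -/
def pathReward {n : ℕ} (r : Fin n → S × A → ℝ) (τ : Fin n → S × A) : ℝ :=
  ∑ h, r h (τ h)

/-- The law of the trajectory that the policy `π` generates in the MDP. -/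
def MDP.trajLaw {H : ℕ} (M : MDP S A H) (π : Policy S A H) : Measure (Fin H → S × A) :=
  trajKernel H M.P π.kernel M.s₁

/-- The policy value `V^π_r`. -/
def MDP.value {H : ℕ} (M : MDP S A H) (π : Policy S A H) (r : Fin H → S × A → ℝ) : ℝ :=
  ∫ τ, pathReward r τ ∂(M.trajLaw π)

/-- The value under `r` of the mixture of `π^1, …, π^K`: one of these policies is drawn uniformly
at random and is then followed for the whole episode. -/
def MDP.mixValue {H : ℕ} (M : MDP S A H) (K : ℕ) (π : ℕ → Policy S A H)
    (r : Fin H → S × A → ℝ) : ℝ :=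
  ∫ τ, pathReward r τ ∂((K : ENNReal)⁻¹ • ∑ k ∈ Finset.Icc 1 K, M.trajLaw (π k))

/-- The Q-value function
`Q^{π,r}_h(s, a) = E_π[∑_{ℓ ≥ h} r_ℓ(s_ℓ, a_ℓ) | s_h = s, a_h = a]`. -/
def MDP.qValue {H : ℕ} (M : MDP S A H) (π : Policy S A H) (r : Fin H → S × A → ℝ)
    (h : Fin H) (x : S × A) : ℝ :=
  r h x + ∫ s', ∫ τ, pathReward (tailFrom h r) τ
    ∂(trajKernel (H - (h.1 + 1)) (tailFrom h M.P) (tailFrom h π.kernel) s') ∂(M.P h x)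

/-- The optimal Q-value function `Q^{⋆,r}_h(s, a) = sup_π Q^{π,r}_h(s, a)`. -/
def MDP.optQ {H : ℕ} (M : MDP S A H) (r : Fin H → S × A → ℝ) (h : Fin H) (x : S × A) : ℝ :=
  ⨆ π : Policy S A H, M.qValue π r h x

/-- `Q_{h+1}`, with the convention `Q_{H+1} = 0`. -/
def nextQ {H : ℕ} (Q : Fin H → S × A → ℝ) (h : Fin H) : S × A → ℝ :=
  if hh : h.1 + 1 < H then Q ⟨h.1 + 1, hh⟩ else fun _ => 0

/-- The Bellman operator
`(T^r_h Q_{h+1})(s, a) = r_h(s, a) + E_{s' ∼ P_h(s, a)}[max_{a'} Q_{h+1}(s', a')]`. -/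
def MDP.bellman {H : ℕ} (M : MDP S A H) (r : Fin H → S × A → ℝ) (Q : Fin H → S × A → ℝ)
    (h : Fin H) (x : S × A) : ℝ :=
  r h x + ∫ s', (⨆ a', nextQ Q h (s', a')) ∂(M.P h x)

/-- `π` is a greedy policy of `Q`: `π_h(s) ∈ argmax_a Q_h(s, a)`. -/
def IsGreedy {H : ℕ} (Q : Fin H → S × A → ℝ) (π : DetPolicy S A H) : Prop :=
  ∀ h s a, Q h (s, a) ≤ Q h (s, π.act h s)

/-- Each `R_h` consists of (measurable) functions `S × A → [0, 1]`. -/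
def IsRewardClass {H : ℕ} (R : Fin H → Set (S × A → ℝ)) : Prop :=
  ∀ h, ∀ r ∈ R h, Measurable r ∧ ∀ x, r x ∈ Set.Icc (0 : ℝ) 1

/-- Each `Q_h` consists of (measurable) functions `S × A → [0, H]` for which the maximum over
actions is attained, at an action that is a measurable function of the state, so that greedy
policies exist. -/
def IsQClass {H : ℕ} (𝒬 : Fin H → Set (S × A → ℝ)) : Prop :=
  ∀ h, ∀ q ∈ 𝒬 h, Measurable q ∧ (∀ x, q x ∈ Set.Icc (0 : ℝ) H) ∧
    ∃ g : S → A, Measurable g ∧ ∀ s a, q (s, a) ≤ q (s, g s)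

/-- Realizability of the reward class. -/
def RewardRealizable {H : ℕ} (M : MDP S A H) (R : Fin H → Set (S × A → ℝ)) : Prop :=
  ∀ h, M.reward h ∈ R h

/-- Realizability of the Q-value class. -/
def QRealizable {H : ℕ} (M : MDP S A H) (R 𝒬 : Fin H → Set (S × A → ℝ)) : Prop :=
  ∀ r : Fin H → S × A → ℝ, (∀ h, r h ∈ R h) → ∀ h, M.optQ r h ∈ 𝒬 h

/-- Bellman completeness of the Q-value class. -/
def BellmanComplete {H : ℕ} (M : MDP S A H) (R 𝒬 : Fin H → Set (S × A → ℝ)) : Prop :=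
  ∀ r : Fin H → S × A → ℝ, (∀ h, r h ∈ R h) →
    ∀ Q : Fin H → S × A → ℝ, (∀ h, Q h ∈ 𝒬 h) → ∀ h, M.bellman r Q h ∈ 𝒬 h

/-- The inequality defining the generalized eluder coefficient, for all sequences of `K` rewards
and Q-value functions and their greedy policies. The infimum over `μ` is written as a universal
quantifier. -/
def GECBound {H : ℕ} [NeZero H] (M : MDP S A H) (R 𝒬 : Fin H → Set (S × A → ℝ))
    (K : ℕ) (ε d : ℝ) : Prop :=
  ∀ (r Q : Fin K → Fin H → S × A → ℝ) (π : Fin K → DetPolicy S A H),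
    (∀ k h, r k h ∈ R h) → (∀ k h, Q k h ∈ 𝒬 h) → (∀ k, IsGreedy (Q k) (π k)) →
    ∀ μ : ℝ, 0 < μ →
      ∑ k, (Q k 0 (M.s₁, (π k).act 0 M.s₁) - M.value (π k).toPolicy (r k)) ≤
        μ / 2 * ∑ k, ∑ i ∈ Finset.univ.filter (fun i => i < k),
            (∫ τ, ∑ h, (Q k h (τ h) - M.bellman (r k) (Q k) h (τ h)) ^ 2
              ∂(M.trajLaw (π i).toPolicy))
          + d / (2 * μ) + Real.sqrt (d * H * K) + ε * H * K

/-- The generalized eluder coefficient: the smallest `d ≥ 0` for which the above inequality holds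
(for sequences of length `K`, `d = H K` always is admissible). -/
def dGEC {H : ℕ} [NeZero H] (M : MDP S A H) (R 𝒬 : Fin H → Set (S × A → ℝ))
    (K : ℕ) (ε : ℝ) : ℝ :=
  sInf {d : ℝ | 0 ≤ d ∧ GECBound M R 𝒬 K ε d}

/-- The `ε`-covering number of a function class, in the sup-distance and with centers in the
class; it is `⊤` if there is no finite cover. -/
def coveringNumber {X : Type*} (ε : ℝ) (F : Set (X → ℝ)) : ℕ∞ :=
  ⨅ (F' : Finset (X → ℝ)) (_ : (F' : Set (X → ℝ)) ⊆ F)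
    (_ : ∀ f ∈ F, ∃ f' ∈ F', ∀ x, |f x - f' x| ≤ ε), (F'.card : ℕ∞)

/-- The covering number as a real number (used only where it is finite). -/
def covNum {X : Type*} (ε : ℝ) (F : Set (X → ℝ)) : ℝ := ((coveringNumber ε F).toNat : ℝ)

/-- The product class `F_1 × ⋯ × F_H`, as a class of functions of `(h, s, a)`. -/
def prodClass {H : ℕ} (F : Fin H → Set (S × A → ℝ)) : Set (Fin H × (S × A) → ℝ) :=
  {f | ∀ h, (fun x => f (h, x)) ∈ F h}

/-- `max_{a'} Q_{h+1}(s_{h+1}, a')` along a trajectory, which is `0` in the last step. -/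
def nextMax {H : ℕ} (Q : Fin H → S × A → ℝ) (h : Fin H) (τ : Fin H → S × A) : ℝ :=
  if hh : h.1 + 1 < H then ⨆ a', Q ⟨h.1 + 1, hh⟩ ((τ ⟨h.1 + 1, hh⟩).1, a') else 0

/-- The squared loss `E_h(q, Q_{h+1}; D^k, r)` on the dataset `D^k = {τ^0, …, τ^{k-1}}`. -/
def sqLoss {H : ℕ} (D : ℕ → Fin H → S × A) (k : ℕ) (r : Fin H → S × A → ℝ) (h : Fin H)
    (q : S × A → ℝ) (Q : Fin H → S × A → ℝ) : ℝ :=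
  ∑ i ∈ Finset.range k, (q (D i h) - r h (D i h) - nextMax Q h (D i)) ^ 2

/-- The estimated squared Bellman error `BE^k(Q)`. -/
def bellmanError {H : ℕ} (𝒬 : Fin H → Set (S × A → ℝ)) (D : ℕ → Fin H → S × A) (k : ℕ)
    (r : Fin H → S × A → ℝ) (Q : Fin H → S × A → ℝ) : ℝ :=
  ∑ h, (sqLoss D k r h (Q h) Q - ⨅ q : 𝒬 h, sqLoss D k r h q.1 Q)

/-- The optimism-regularized objective `BE^k(Q) - lam * max_a Q_1(s_1, a)`. -/
def objective {H : ℕ} [NeZero H] (M : MDP S A H) (𝒬 : Fin H → Set (S × A → ℝ))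
    (D : ℕ → Fin H → S × A) (lam : ℝ) (k : ℕ) (r : Fin H → S × A → ℝ)
    (Q : Fin H → S × A → ℝ) : ℝ :=
  bellmanError 𝒬 D k r Q - lam * ⨆ a, Q 0 (M.s₁, a)

/-- An execution of OPT-AIL with `N` expert trajectories and `K` iterations on a probability space.
The `σ`-algebra `ℱ k` is the information that the learner has when it chooses `r^k, Q^k, π^k`: it
contains the expert data, the trajectories `τ^0, …, τ^{k-1}` and possibly internal randomness of
the two optimization procedures. How accurately these solve their problems is measured by
`rewardOptError` and `qOptError` below. -/
structure Run {Ω : Type*} [mΩ : MeasurableSpace Ω] (μ : Measure Ω) {H : ℕ} (M : MDP S A H)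
    (R 𝒬 : Fin H → Set (S × A → ℝ)) (πE π₀ : Policy S A H) (N K : ℕ) where
  ℱ : Filtration ℕ mΩ
  /-- the expert trajectories: i.i.d. samples from the expert policy -/
  expert : Fin N → Ω → Fin H → S × A
  expert_measurable : ∀ j, Measurable[ℱ 0] (expert j)
  expert_indep : iIndepFun expert μ
  expert_law : ∀ j, μ.map (expert j) = M.trajLaw πE
  /-- the rewards `r^1, …, r^K` -/
  r : ℕ → Ω → Fin H → S × A → ℝ
  r_mem : ∀ k ∈ Finset.Icc 1 K, ∀ ω h, r k ω h ∈ R h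
  r_measurable : ∀ k ∈ Finset.Icc 1 K, ∀ h,
    Measurable[(ℱ k).prod inferInstance] (fun p : Ω × (S × A) => r k p.1 h p.2)
  /-- the Q-value functions `Q^1, …, Q^K` -/
  Q : ℕ → Ω → Fin H → S × A → ℝ
  Q_mem : ∀ k ∈ Finset.Icc 1 K, ∀ ω h, Q k ω h ∈ 𝒬 h
  Q_measurable : ∀ k ∈ Finset.Icc 1 K, ∀ h,
    Measurable[(ℱ k).prod inferInstance] (fun p : Ω × (S × A) => Q k p.1 h p.2)
  /-- the greedy policies `π^1, …, π^K` -/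
  greedy : ℕ → Ω → DetPolicy S A H
  isGreedy : ∀ k ∈ Finset.Icc 1 K, ∀ ω, IsGreedy (Q k ω) (greedy k ω)
  greedy_measurable : ∀ k ∈ Finset.Icc 1 K, ∀ h,
    Measurable[(ℱ k).prod inferInstance] (fun p : Ω × S => (greedy k p.1).act h p.2)
  /-- the trajectories `τ^0, …, τ^K`: given the past, `τ^k` is generated by `π^k` -/
  τ : ℕ → Ω → Fin H → S × A
  τ_measurable : ∀ k ≤ K, Measurable[ℱ (k + 1)] (τ k)
  τ_law_zero : ∀ E : Set (Fin H → S × A), MeasurableSet E →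
    μ⟦τ 0 ⁻¹' E | ℱ 0⟧ =ᵐ[μ] fun _ => (M.trajLaw π₀).real E
  τ_law : ∀ k ∈ Finset.Icc 1 K, ∀ E : Set (Fin H → S × A), MeasurableSet E →
    μ⟦τ k ⁻¹' E | ℱ k⟧ =ᵐ[μ] fun ω => (M.trajLaw (greedy k ω).toPolicy).real E

section Run

variable {Ω : Type*} [mΩ : MeasurableSpace Ω] {μ : Measure Ω} {H : ℕ} {M : MDP S A H}
  {R 𝒬 : Fin H → Set (S × A → ℝ)} {πE π₀ : Policy S A H} {N K : ℕ}

/-- The empirical value of the expert policy under `r`. -/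
def Run.expertValue (run : Run μ M R 𝒬 πE π₀ N K) (ω : Ω) (r : Fin H → S × A → ℝ) : ℝ :=
  1 / (N : ℝ) * ∑ j, pathReward r (run.expert j ω)

/-- The estimated loss `L^k(r)`: the estimated value of `π^k` minus that of the expert policy. -/
def Run.loss (run : Run μ M R 𝒬 πE π₀ N K) (ω : Ω) (k : ℕ) (r : Fin H → S × A → ℝ) : ℝ :=
  pathReward r (run.τ k ω) - run.expertValue ω r

/-- The reward optimization error `ε^r_opt` (average regret) of the execution. -/
def Run.rewardOptError (run : Run μ M R 𝒬 πE π₀ N K) (ω : Ω) : ℝ :=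
  1 / (K : ℝ) * ⨆ r : {r : Fin H → S × A → ℝ // ∀ h, r h ∈ R h},
    ∑ k ∈ Finset.Icc 1 K, (run.loss ω k (run.r k ω) - run.loss ω k r.1)

/-- The Q-value optimization error `ε^Q_opt` of the execution: the largest optimality gap of
`Q^k` in the `k`-th optimization problem, over the iterations `k = 1, …, K`. -/
def Run.qOptError [NeZero H] (run : Run μ M R 𝒬 πE π₀ N K) (lam : ℝ) (ω : Ω) : ℝ :=
  ⨆ k : Finset.Icc 1 K,
    (objective M 𝒬 (fun i => run.τ i ω) lam k.1 (run.r k.1 ω) (run.Q k.1 ω) -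
      ⨅ Q : {Q : Fin H → S × A → ℝ // ∀ h, Q h ∈ 𝒬 h},
        objective M 𝒬 (fun i => run.τ i ω) lam k.1 (run.r k.1 ω) Q.1)

/-- The imitation gap of the output policy, the uniform mixture of `π^1, …, π^K`, with respect to
the true reward. -/
def Run.imitationGap (run : Run μ M R 𝒬 πE π₀ N K) (ω : Ω) : ℝ :=
  M.value πE M.reward - M.mixValue K (fun k => (run.greedy k ω).toPolicy) M.reward

end Run

end OptAil

end

/-!
The gap splits into three parts: the error of the empirical expert value, the regret of the rewards
`r^k`, which is `ε^r_opt` up to the deviation of sampled returns from their means, and the regret of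
the policies `π^k` against `πE`. For the last part, since `Q^{⋆,r^k}` competes in the objective
`L^k`, near-minimality of `Q^k` bounds the shortfall of `max_a Q^k_1(s₁, a)` by the Bellman error of
`Q^{⋆,r^k}`, minus that of `Q^k`, all divided by `lam`, and the definition of `d_GEC` converts
`Q^k_1 - V^{π^k}` into squared Bellman residuals of `Q^k` on the earlier policies. These residuals
are at most a multiple of the empirical Bellman error of `Q^k`, because the exponential of their
difference is a supermartingale, uniformly over a cover of the function classes; with the GEC
parameter `1 / lam` the empirical Bellman errors then cancel. If `H = 1` and every class has a cover
by one point, the logarithms may vanish, but then all policies involved are nearly optimal anyway.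
-/

namespace OptAil

variable {S A : Type*} [MeasurableSpace S] [MeasurableSpace A]

@[fun_prop]
theorem measurable_finCons {n : ℕ} {X Y : Type*} [MeasurableSpace X] [MeasurableSpace Y]
    {f : Y → X} {g : Y → Fin n → X} (hf : Measurable f) (hg : Measurable g) :
    Measurable fun y => (Fin.cons (f y) (g y) : Fin (n + 1) → X) :=
  measurable_pi_iff.2 <| Fin.cases (by simpa) fun j => by
    simpa using hg.eval

instance trajKernel.instIsMarkovKernel : ∀ (n : ℕ) (P : Fin n → Kernel (S × A) S)
    (π : Fin n → Kernel S A) [∀ h, IsMarkovKernel (P h)] [∀ h, IsMarkovKernel (π h)],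
    IsMarkovKernel (trajKernel n P π)
  | 0, _, _, _, _ => by unfold trajKernel; infer_instance
  | n + 1, P, π, _, _ => by
    have := trajKernel.instIsMarkovKernel n (fun j => P j.succ) (fun j => π j.succ)
    unfold trajKernel
    exact Kernel.IsMarkovKernel.map _ (measurable_finCons (by fun_prop) (by fun_prop))

instance (H : ℕ) (M : MDP S A H) (h : Fin H) : IsMarkovKernel (M.P h) := M.markov h

instance (H : ℕ) (π : Policy S A H) (h : Fin H) : IsMarkovKernel (π.kernel h) := π.markov h

instance (H : ℕ) (M : MDP S A H) (π : Policy S A H) : IsProbabilityMeasure (M.trajLaw π) := by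
  unfold MDP.trajLaw
  infer_instance

section Trajectory

variable {n : ℕ} (P : Fin (n + 1) → Kernel (S × A) S) (π : Fin (n + 1) → Kernel S A)

theorem trajKernel_succ_apply (s : S) :
    trajKernel (n + 1) P π s =
      (((π 0 ⊗ₖ P 0) ⊗ₖ (trajKernel n (fun j => P j.succ) (fun j => π j.succ)).comap
        (fun p : S × (A × S) => p.2.2) (by fun_prop)) s).map
        fun y => (Fin.cons (s, y.1.1) y.2 : Fin (n + 1) → S × A) := by
  rw [trajKernel, Kernel.map_apply _ (measurable_finCons (by fun_prop) (by fun_prop)),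
    Kernel.prod_apply, Kernel.id_apply, Measure.dirac_prod,
    Measure.map_map (by fun_prop) (by fun_prop)]
  rfl

variable [∀ h, IsMarkovKernel (P h)] [∀ h, IsMarkovKernel (π h)]

theorem lintegral_trajKernel_succ {F : (Fin (n + 1) → S × A) → ENNReal} (hF : Measurable F)
    (s : S) :
    ∫⁻ τ, F τ ∂(trajKernel (n + 1) P π s) =
      ∫⁻ a, ∫⁻ s', ∫⁻ τ, F (Fin.cons (s, a) τ)
        ∂(trajKernel n (fun j => P j.succ) (fun j => π j.succ) s') ∂(P 0 (s, a)) ∂(π 0 s) := by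
  have hcons : Measurable fun y : (A × S) × (Fin n → S × A) =>
      F (Fin.cons (s, y.1.1) y.2) := hF.comp (by fun_prop)
  rw [trajKernel_succ_apply, lintegral_map hF (by fun_prop), Kernel.lintegral_compProd _ _ _ hcons,
    Kernel.lintegral_compProd _ _ _ ?_]
  · rfl
  · exact hcons.lintegral_kernel_prod_right'
      (κ := (trajKernel n (fun j => P j.succ) (fun j => π j.succ)).comap
        (fun p : A × S => p.2) measurable_snd)

theorem integral_trajKernel_succ {F : (Fin (n + 1) → S × A) → ℝ} (s : S)
    (hF : Integrable F (trajKernel (n + 1) P π s)) :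
    ∫ τ, F τ ∂(trajKernel (n + 1) P π s) =
      ∫ a, ∫ s', ∫ τ, F (Fin.cons (s, a) τ)
        ∂(trajKernel n (fun j => P j.succ) (fun j => π j.succ) s') ∂(P 0 (s, a)) ∂(π 0 s) := by
  have hcons : Measurable fun y : (A × S) × (Fin n → S × A) =>
      (Fin.cons (s, y.1.1) y.2 : Fin (n + 1) → S × A) := by fun_prop
  rw [trajKernel_succ_apply] at hF ⊢
  have hF' : Integrable (fun y : (A × S) × (Fin n → S × A) => F (Fin.cons (s, y.1.1) y.2)) _ :=
    (integrable_map_measure hF.aestronglyMeasurable hcons.aemeasurable).1 hF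
  rw [integral_map hcons.aemeasurable hF.aestronglyMeasurable, integral_compProd hF',
    integral_compProd hF'.integral_compProd]
  rfl

theorem lintegral_trajKernel_initial {F : S → ENNReal} (hF : Measurable F) (s : S) :
    ∫⁻ τ, F (τ 0).1 ∂(trajKernel (n + 1) P π s) = F s := by
  rw [lintegral_trajKernel_succ P π (by fun_prop)]
  simp

end Trajectory

theorem measurable_trajKernel_sectR {Θ : Type*} [MeasurableSpace Θ] :
    ∀ (n : ℕ) (P : Fin n → Kernel (S × A) S) (κ : Fin n → Kernel (Θ × S) A)
      [∀ h, IsMarkovKernel (P h)] [∀ h, IsMarkovKernel (κ h)],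
      Measurable fun p : Θ × S => trajKernel n P (fun h => (κ h).sectR p.1) p.2
  | 0, _, _, _, _ => by
    simp only [trajKernel]
    exact (Kernel.measurable _).comp measurable_snd
  | n + 1, P, κ, _, _ => by
    let tail : Kernel (Θ × S) (Fin n → S × A) :=
      ⟨_, measurable_trajKernel_sectR n (fun j => P j.succ) (fun j => κ j.succ)⟩
    have : IsMarkovKernel tail := ⟨fun p => inferInstanceAs (IsProbabilityMeasure
      (trajKernel n (fun j => P j.succ) (fun j => (κ j.succ).sectR p.1) p.2))⟩
    refine Measure.measurable_of_measurable_coe _ fun E hE => ?_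
    have hF : Measurable (E.indicator (1 : (Fin (n + 1) → S × A) → ENNReal)) :=
      measurable_one.indicator hE
    simp_rw [← lintegral_indicator_one hE, lintegral_trajKernel_succ _ _ hF]
    have hcons : Measurable fun z : (((Θ × S) × A) × S) × (Fin n → S × A) =>
        E.indicator (1 : (Fin (n + 1) → S × A) → ENNReal)
          (Fin.cons (z.1.1.1.2, z.1.1.2) z.2) := hF.comp (by fun_prop)
    have htail : Measurable fun q : ((Θ × S) × A) × S =>
        ∫⁻ τ, E.indicator 1 (Fin.cons (q.1.1.2, q.1.2) τ) ∂(tail (q.1.1.1, q.2)) :=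
      hcons.lintegral_kernel_prod_right'
        (κ := tail.comap (fun q : ((Θ × S) × A) × S => (q.1.1.1, q.2)) (by fun_prop))
    have hnext : Measurable fun q : (Θ × S) × A =>
        ∫⁻ s', ∫⁻ τ, E.indicator 1 (Fin.cons (q.1.2, q.2) τ) ∂(tail (q.1.1, s'))
          ∂(P 0 (q.1.2, q.2)) :=
      htail.lintegral_kernel_prod_right'
        (κ := (P 0).comap (fun q : (Θ × S) × A => (q.1.2, q.2)) (by fun_prop))
    exact hnext.lintegral_kernel_prod_right' (κ := κ 0)

theorem lintegral_trajKernel_next : ∀ (n : ℕ) (P : Fin n → Kernel (S × A) S)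
    (π : Fin n → Kernel S A) [∀ h, IsMarkovKernel (P h)] [∀ h, IsMarkovKernel (π h)]
    (h : Fin n) (hh : h.1 + 1 < n) {Φ : (S × A) × S → ENNReal} (_ : Measurable Φ) (s : S),
    ∫⁻ τ, Φ (τ h, (τ ⟨h.1 + 1, hh⟩).1) ∂(trajKernel n P π s) =
      ∫⁻ τ, ∫⁻ s', Φ (τ h, s') ∂(P h (τ h)) ∂(trajKernel n P π s)
  | n + 1, P, π, _, _, h, hh, Φ, hΦ, s => by
    have hmean : Measurable fun τ : Fin (n + 1) → S × A => ∫⁻ s', Φ (τ h, s') ∂(P h (τ h)) :=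
      (hΦ.lintegral_kernel_prod_right' (κ := P h)).comp (measurable_pi_apply h)
    rw [lintegral_trajKernel_succ P π (by fun_prop), lintegral_trajKernel_succ P π hmean]
    cases h using Fin.cases with
    | succ j =>
      refine lintegral_congr fun a => lintegral_congr fun s' => ?_
      exact lintegral_trajKernel_next n (fun j => P j.succ) (fun j => π j.succ) j
        (by simpa using hh) hΦ s'
    | zero =>
      obtain _ | m := n
      · simp at hh
      have hstart (a : A) (s' : S) :
          ∫⁻ τ, Φ ((s, a), (τ 0).1)
            ∂(trajKernel (m + 1) (fun j => P j.succ) (fun j => π j.succ) s') = Φ ((s, a), s') :=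
        lintegral_trajKernel_initial _ _ (F := fun t => Φ ((s, a), t)) (by fun_prop) s'
      refine lintegral_congr fun a => (lintegral_congr (hstart a)).trans ?_
      simp

theorem map_trajLaw_next {H : ℕ} (M : MDP S A H) (π : Policy S A H) (h : Fin H)
    (hh : h.1 + 1 < H) :
    (M.trajLaw π).map (fun τ => (τ h, (τ ⟨h.1 + 1, hh⟩).1)) =
      ((M.trajLaw π).map (fun τ => τ h)) ⊗ₘ (M.P h) := by
  have : IsProbabilityMeasure ((M.trajLaw π).map (fun τ => τ h)) :=
    Measure.isProbabilityMeasure_map (measurable_pi_apply h).aemeasurable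
  refine Measure.ext_of_lintegral _ fun Φ hΦ => ?_
  rw [lintegral_map hΦ (by fun_prop), Measure.lintegral_compProd hΦ,
    lintegral_map (hΦ.lintegral_kernel_prod_right' (κ := M.P h)) (by fun_prop)]
  exact lintegral_trajKernel_next H M.P π.kernel h hh hΦ M.s₁

theorem integral_mul_next_sub {H : ℕ} (M : MDP S A H) (π : Policy S A H) (h : Fin H)
    (hh : h.1 + 1 < H) {g : S × A → ℝ} {V : S → ℝ} (hg : Measurable g) (hV : Measurable V)
    {C D : ℝ} (hgC : ∀ x, |g x| ≤ C) (hVD : ∀ s, |V s| ≤ D) :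
    ∫ τ, g (τ h) * (V (τ ⟨h.1 + 1, hh⟩).1 - ∫ s', V s' ∂(M.P h (τ h))) ∂(M.trajLaw π) = 0 := by
  have : IsProbabilityMeasure ((M.trajLaw π).map (fun τ => τ h)) :=
    Measure.isProbabilityMeasure_map (measurable_pi_apply h).aemeasurable
  have hmean : Measurable fun x => ∫ s', V s' ∂(M.P h x) :=
    (StronglyMeasurable.integral_kernel_prod_right' (κ := M.P h)
      (f := fun p : (S × A) × S => V p.2) (by fun_prop)).measurable
  have hmean_le (x : S × A) : |∫ s', V s' ∂(M.P h x)| ≤ D := by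
    simpa using norm_integral_le_of_norm_le_const (μ := M.P h x) (f := V) (C := D)
      (Filter.Eventually.of_forall hVD)
  have hmeas : Measurable fun p : (S × A) × S => g p.1 * (V p.2 - ∫ s', V s' ∂(M.P h p.1)) :=
    (hg.comp measurable_fst).mul ((hV.comp measurable_snd).sub (hmean.comp measurable_fst))
  have hint : Integrable (fun p : (S × A) × S => g p.1 * (V p.2 - ∫ s', V s' ∂(M.P h p.1)))
      (((M.trajLaw π).map (fun τ => τ h)) ⊗ₘ (M.P h)) := by
    refine .of_bound hmeas.aestronglyMeasurable (C * (D + D)) (.of_forall fun p => ?_)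
    rw [Real.norm_eq_abs, abs_mul]
    exact mul_le_mul (hgC _) ((abs_sub _ _).trans (add_le_add (hVD _) (hmean_le _)))
      (abs_nonneg _) ((abs_nonneg _).trans (hgC p.1))
  have hV_int (x : S × A) : Integrable V (M.P h x) :=
    .of_bound hV.aestronglyMeasurable D (.of_forall hVD)
  calc ∫ τ, g (τ h) * (V (τ ⟨h.1 + 1, hh⟩).1 - ∫ s', V s' ∂(M.P h (τ h))) ∂(M.trajLaw π)
      = ∫ p, g p.1 * (V p.2 - ∫ s', V s' ∂(M.P h p.1))
          ∂((M.trajLaw π).map (fun τ => (τ h, (τ ⟨h.1 + 1, hh⟩).1))) := by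
        rw [integral_map (by fun_prop) hmeas.aestronglyMeasurable]
    _ = ∫ x, ∫ s, g x * (V s - ∫ s', V s' ∂(M.P h x)) ∂(M.P h x)
          ∂((M.trajLaw π).map (fun τ => τ h)) := by
        rw [map_trajLaw_next, Measure.integral_compProd hint]
    _ = 0 := by simp [integral_const_mul, integral_sub (hV_int _) (integrable_const _)]

/-- A family of measurable functions with values in `[0, 1]`, one for each step: the rewards whose
expected sums are genuine integrals. -/
def IsUnitReward {n : ℕ} (r : Fin n → S × A → ℝ) : Prop :=
  ∀ h, Measurable (r h) ∧ ∀ x, r h x ∈ Set.Icc (0 : ℝ) 1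

theorem MDP.isUnitReward_reward {H : ℕ} (M : MDP S A H) : IsUnitReward M.reward :=
  fun h => ⟨M.reward_measurable h, M.reward_mem h⟩

theorem IsRewardClass.isUnitReward {H : ℕ} {R : Fin H → Set (S × A → ℝ)} (hR : IsRewardClass R)
    {r : Fin H → S × A → ℝ} (hr : ∀ h, r h ∈ R h) : IsUnitReward r := fun h => hR h _ (hr h)

theorem IsUnitReward.tailFrom {H : ℕ} {r : Fin H → S × A → ℝ} (hr : IsUnitReward r) (h : Fin H) :
    IsUnitReward (tailFrom h r) := fun _ => hr _

section PathReward

variable {n : ℕ} {r r' : Fin n → S × A → ℝ}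

theorem measurable_pathReward (hr : IsUnitReward r) : Measurable (pathReward r) :=
  Finset.measurable_sum _ fun h _ => (hr h).1.comp (measurable_pi_apply h)

omit [MeasurableSpace S] [MeasurableSpace A] in
theorem pathReward_cons {r : Fin (n + 1) → S × A → ℝ} (x : S × A) (τ : Fin n → S × A) :
    pathReward r (Fin.cons x τ) = r 0 x + pathReward (fun j => r j.succ) τ := by
  simp only [pathReward, Fin.sum_univ_succ, Fin.cons_zero, Fin.cons_succ]

theorem pathReward_nonneg (hr : IsUnitReward r) (τ : Fin n → S × A) : 0 ≤ pathReward r τ :=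
  Finset.sum_nonneg fun h _ => ((hr h).2 _).1

theorem pathReward_le (hr : IsUnitReward r) (τ : Fin n → S × A) : pathReward r τ ≤ n := by
  simpa [pathReward] using Finset.sum_le_card_nsmul Finset.univ (fun h => r h (τ h)) 1
    fun h _ => ((hr h).2 (τ h)).2

theorem abs_pathReward_le (hr : IsUnitReward r) (τ : Fin n → S × A) : |pathReward r τ| ≤ n :=
  (abs_of_nonneg (pathReward_nonneg hr τ)).trans_le (pathReward_le hr τ)

omit [MeasurableSpace S] [MeasurableSpace A] in
theorem abs_pathReward_sub_le {ρ : ℝ} (hρ : ∀ h x, |r h x - r' h x| ≤ ρ) (τ : Fin n → S × A) :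
    |pathReward r τ - pathReward r' τ| ≤ n * ρ := by
  calc |pathReward r τ - pathReward r' τ| = |∑ h, (r h (τ h) - r' h (τ h))| := by
        rw [Finset.sum_sub_distrib, pathReward, pathReward]
    _ ≤ ∑ h, |r h (τ h) - r' h (τ h)| := Finset.abs_sum_le_sum_abs _ _
    _ ≤ n * ρ := by
        simpa using Finset.sum_le_card_nsmul Finset.univ _ ρ fun h _ => hρ h (τ h)

theorem integrable_pathReward (hr : IsUnitReward r) (ν : Measure (Fin n → S × A))
    [IsFiniteMeasure ν] : Integrable (pathReward r) ν :=
  .of_bound (measurable_pathReward hr).aestronglyMeasurable n (.of_forall (abs_pathReward_le hr))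

end PathReward

section TrajValue

variable {n : ℕ} {P : Fin n → Kernel (S × A) S} {π : Fin n → Kernel S A} {r : Fin n → S × A → ℝ}

/-- The expected cumulative reward over `n` steps from a given state. It is the value of a policy
on any final segment of an episode. -/
noncomputable def trajValue (n : ℕ) (P : Fin n → Kernel (S × A) S) (π : Fin n → Kernel S A)
    (r : Fin n → S × A → ℝ) (s : S) : ℝ :=
  ∫ τ, pathReward r τ ∂(trajKernel n P π s)

theorem trajValue_nonneg (hr : IsUnitReward r) (s : S) : 0 ≤ trajValue n P π r s :=
  integral_nonneg (pathReward_nonneg hr)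

variable [∀ h, IsMarkovKernel (P h)] [∀ h, IsMarkovKernel (π h)]

theorem trajValue_le (hr : IsUnitReward r) (s : S) : trajValue n P π r s ≤ n := by
  simpa [trajValue] using integral_mono (integrable_pathReward hr (trajKernel n P π s))
    (integrable_const (n : ℝ)) (pathReward_le hr)

theorem integrable_trajValue (hr : IsUnitReward r) (ν : Measure S) [IsFiniteMeasure ν] :
    Integrable (trajValue n P π r) ν := by
  refine .of_bound (C := n) ?_ (.of_forall fun s => ?_)
  · exact (StronglyMeasurable.integral_kernel_prod_right' (κ := trajKernel n P π)
      (f := fun p : S × (Fin n → S × A) => pathReward r p.2)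
      ((measurable_pathReward hr).comp measurable_snd).stronglyMeasurable).aestronglyMeasurable
  · exact (abs_of_nonneg (trajValue_nonneg hr s)).trans_le (trajValue_le hr s)

-- Stated with an equation `m = n + 1` because it is applied with `m = H - (h + 1)`.
omit [∀ h, IsMarkovKernel (P h)] [∀ h, IsMarkovKernel (π h)] in
theorem trajValue_succ {m : ℕ} (hmn : m = n + 1) {P : Fin m → Kernel (S × A) S}
    {π : Fin m → Kernel S A} [∀ h, IsMarkovKernel (P h)] [∀ h, IsMarkovKernel (π h)]
    {r : Fin m → S × A → ℝ} (hr : IsUnitReward r) (s : S) :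
    trajValue m P π r s = ∫ a, (r ⟨0, by omega⟩ (s, a) +
      ∫ s', trajValue n (fun j => P ⟨j + 1, by omega⟩) (fun j => π ⟨j + 1, by omega⟩)
        (fun j => r ⟨j + 1, by omega⟩) s' ∂(P ⟨0, by omega⟩ (s, a))) ∂(π ⟨0, by omega⟩ s) := by
  subst hmn
  have hr' : IsUnitReward (fun j : Fin n => r j.succ) := fun j => hr j.succ
  have htail (a : A) (s' : S) :
      ∫ τ, pathReward r (Fin.cons (s, a) τ)
          ∂(trajKernel n (fun j => P j.succ) (fun j => π j.succ) s') =
        r 0 (s, a) +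
          trajValue n (fun j => P j.succ) (fun j => π j.succ) (fun j => r j.succ) s' := by
    simp only [pathReward_cons]
    rw [integral_add (integrable_const _) (integrable_pathReward hr' _)]
    simp [trajValue]
  rw [trajValue, integral_trajKernel_succ P π s (integrable_pathReward hr _)]
  refine integral_congr_ae (.of_forall fun a => ?_)
  simp only [htail]
  rw [integral_add (integrable_const _) (integrable_trajValue hr' _)]
  simp [Fin.succ]

end TrajValue

section TailFrom

variable {H : ℕ} {X : Type*} (f : Fin H → X)

theorem tailFrom_succ (h : Fin H) (hh : h.1 + 1 < H) :
    (fun j : Fin (H - (h.1 + 1 + 1)) => tailFrom h f ⟨j.1 + 1, by omega⟩) =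
      tailFrom (⟨h.1 + 1, hh⟩ : Fin H) f := by
  funext j
  exact congrArg f (Fin.ext (by simp only []; omega))

theorem tailFrom_zero [NeZero H] :
    (fun j : Fin (H - ((0 : Fin H).1 + 1)) => f ⟨j.1 + 1, by have := j.2; simp at this; omega⟩) =
      tailFrom 0 f := by
  funext j
  exact congrArg f (Fin.ext (by simp [add_comm]))

end TailFrom

section Value

variable {H : ℕ} (M : MDP S A H) (π : Policy S A H) {r r' : Fin H → S × A → ℝ}

instance (h : Fin H) (j : Fin (H - (h.1 + 1))) : IsMarkovKernel (tailFrom h M.P j) := M.markov _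

instance (h : Fin H) (j : Fin (H - (h.1 + 1))) : IsMarkovKernel (tailFrom h π.kernel j) :=
  π.markov _

theorem MDP.value_nonneg (hr : IsUnitReward r) : 0 ≤ M.value π r :=
  integral_nonneg (pathReward_nonneg hr)

theorem MDP.abs_value_sub_le (hr : IsUnitReward r) (hr' : IsUnitReward r') {ρ : ℝ}
    (hρ : ∀ h x, |r h x - r' h x| ≤ ρ) : |M.value π r - M.value π r'| ≤ H * ρ := by
  rw [MDP.value, MDP.value,
    ← integral_sub (integrable_pathReward hr _) (integrable_pathReward hr' _)]
  simpa using norm_integral_le_of_norm_le_const (μ := M.trajLaw π) (C := H * ρ)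
    (f := fun τ => pathReward r τ - pathReward r' τ) (.of_forall (abs_pathReward_sub_le hρ))

/-- `V^{π,r}_{h+1}(s)`: the expected reward of `π` after step `h`, from the state `s` of
step `h + 1`. -/
noncomputable def MDP.nextValue (M : MDP S A H) (π : Policy S A H) (r : Fin H → S × A → ℝ)
    (h : Fin H) (s : S) : ℝ :=
  trajValue _ (tailFrom h M.P) (tailFrom h π.kernel) (tailFrom h r) s

theorem MDP.qValue_eq (h : Fin H) (x : S × A) :
    M.qValue π r h x = r h x + ∫ s', M.nextValue π r h s' ∂(M.P h x) := rfl

theorem MDP.nextValue_of_lt (hr : IsUnitReward r) (h : Fin H) (hh : h.1 + 1 < H) (s : S) :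
    M.nextValue π r h s =
      ∫ a, M.qValue π r ⟨h.1 + 1, hh⟩ (s, a) ∂(π.kernel ⟨h.1 + 1, hh⟩ s) := by
  rw [nextValue, trajValue_succ (n := H - (h.1 + 1 + 1)) (by omega) (hr.tailFrom h),
    tailFrom_succ M.P h hh, tailFrom_succ π.kernel h hh, tailFrom_succ r h hh]
  rfl

variable (r) in
theorem MDP.nextValue_of_not_lt (h : Fin H) (hh : ¬ h.1 + 1 < H) (s : S) :
    M.nextValue π r h s = 0 := by
  have : IsEmpty (Fin (H - (h.1 + 1))) := ⟨fun j => absurd j.2 (by omega)⟩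
  simp [nextValue, trajValue, pathReward]

theorem MDP.value_eq_integral_qValue [NeZero H] (hr : IsUnitReward r) :
    M.value π r = ∫ a, M.qValue π r 0 (M.s₁, a) ∂(π.kernel 0 M.s₁) := by
  have hH : H = H - ((0 : Fin H).1 + 1) + 1 := by
    have := NeZero.pos H
    simp only [Fin.val_zero]; omega
  refine (trajValue_succ hH hr M.s₁).trans ?_
  rw [tailFrom_zero M.P, tailFrom_zero π.kernel, tailFrom_zero r]
  rfl

theorem MDP.nextValue_nonneg (hr : IsUnitReward r) (h : Fin H) (s : S) :
    0 ≤ M.nextValue π r h s := trajValue_nonneg (hr.tailFrom h) s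

theorem MDP.nextValue_le (hr : IsUnitReward r) (h : Fin H) (s : S) : M.nextValue π r h s ≤ H :=
  (trajValue_le (hr.tailFrom h) s).trans (Nat.cast_le.2 (Nat.sub_le _ _))

theorem MDP.integrable_nextValue (hr : IsUnitReward r) (h : Fin H) (ν : Measure S)
    [IsFiniteMeasure ν] : Integrable (M.nextValue π r h) ν :=
  integrable_trajValue (hr.tailFrom h) ν

theorem MDP.qValue_nonneg (hr : IsUnitReward r) (h : Fin H) (x : S × A) :
    0 ≤ M.qValue π r h x :=
  add_nonneg ((hr h).2 x).1 (integral_nonneg (M.nextValue_nonneg π hr h))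

theorem MDP.qValue_le (hr : IsUnitReward r) (h : Fin H) (x : S × A) :
    M.qValue π r h x ≤ 1 + H := by
  rw [M.qValue_eq]
  refine add_le_add ((hr h).2 x).2 ?_
  simpa using integral_mono (M.integrable_nextValue π hr h (M.P h x))
    (integrable_const (H : ℝ)) (M.nextValue_le π hr h)

theorem MDP.qValue_le_optQ (hr : IsUnitReward r) (h : Fin H) (x : S × A) :
    M.qValue π r h x ≤ M.optQ r h x :=
  le_ciSup (f := fun π => M.qValue π r h x)
    ⟨1 + H, Set.forall_mem_range.2 fun π => M.qValue_le π hr h x⟩ π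

end Value

section QClass

variable {H : ℕ} {𝒬 : Fin H → Set (S × A → ℝ)} {h : Fin H} {q q' : S × A → ℝ}
  {Q Q' : Fin H → S × A → ℝ}

theorem iSup_eq_of_forall_le {α : Type*} {f : α → ℝ} {a : α} (h : ∀ b, f b ≤ f a) :
    ⨆ b, f b = f a :=
  IsGreatest.csSup_eq ⟨Set.mem_range_self a, Set.forall_mem_range.2 h⟩

theorem IsQClass.le_iSup (h𝒬 : IsQClass 𝒬) (hq : q ∈ 𝒬 h) (s : S) (a : A) :
    q (s, a) ≤ ⨆ a', q (s, a') := by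
  obtain ⟨g, -, hg⟩ := (h𝒬 h q hq).2.2
  exact (hg s a).trans (iSup_eq_of_forall_le (hg s)).ge

theorem IsQClass.measurable_iSup (h𝒬 : IsQClass 𝒬) (hq : q ∈ 𝒬 h) :
    Measurable fun s => ⨆ a, q (s, a) := by
  obtain ⟨hqm, -, g, hgm, hg⟩ := h𝒬 h q hq
  simp only [fun s => iSup_eq_of_forall_le (hg s)]
  fun_prop

theorem IsQClass.iSup_mem (h𝒬 : IsQClass 𝒬) (hq : q ∈ 𝒬 h) (s : S) :
    ⨆ a, q (s, a) ∈ Set.Icc (0 : ℝ) H := by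
  obtain ⟨-, hq_mem, g, -, hg⟩ := h𝒬 h q hq
  rw [iSup_eq_of_forall_le (hg s)]
  exact hq_mem _

theorem IsQClass.abs_iSup_sub_le (h𝒬 : IsQClass 𝒬) (hq : q ∈ 𝒬 h) (hq' : q' ∈ 𝒬 h) {ρ : ℝ}
    (hρ : ∀ x, |q x - q' x| ≤ ρ) (s : S) : |(⨆ a, q (s, a)) - ⨆ a, q' (s, a)| ≤ ρ := by
  obtain ⟨g, -, hg⟩ := (h𝒬 h q hq).2.2
  obtain ⟨g', -, hg'⟩ := (h𝒬 h q' hq').2.2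
  rw [iSup_eq_of_forall_le (hg s), iSup_eq_of_forall_le (hg' s), abs_le]
  constructor
  · linarith [hg s (g' s), (abs_le.1 (hρ (s, g' s))).1]
  · linarith [hg' s (g s), (abs_le.1 (hρ (s, g s))).2]

/-- `max_a Q_{h+1}(s, a)`, with the convention `Q_{H+1} = 0`. -/
noncomputable def nextV (Q : Fin H → S × A → ℝ) (h : Fin H) (s : S) : ℝ :=
  ⨆ a, nextQ Q h (s, a)

omit [MeasurableSpace S] [MeasurableSpace A] in
theorem nextV_of_lt (Q : Fin H → S × A → ℝ) (h : Fin H) (hh : h.1 + 1 < H) :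
    nextV Q h = fun s => ⨆ a, Q ⟨h.1 + 1, hh⟩ (s, a) := by
  funext s
  simp [nextV, nextQ, hh]

omit [MeasurableSpace S] [MeasurableSpace A] in
theorem nextV_of_not_lt (Q : Fin H → S × A → ℝ) (h : Fin H) (hh : ¬ h.1 + 1 < H) :
    nextV Q h = fun _ => 0 := by
  funext s
  simp [nextV, nextQ, hh]

theorem IsQClass.measurable_nextV (h𝒬 : IsQClass 𝒬) (hQ : ∀ h, Q h ∈ 𝒬 h) (h : Fin H) :
    Measurable (nextV Q h) := by
  by_cases hh : h.1 + 1 < H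
  · rw [nextV_of_lt Q h hh]
    exact h𝒬.measurable_iSup (hQ _)
  · rw [nextV_of_not_lt Q h hh]
    exact measurable_const

theorem IsQClass.nextV_mem (h𝒬 : IsQClass 𝒬) (hQ : ∀ h, Q h ∈ 𝒬 h) (h : Fin H) (s : S) :
    nextV Q h s ∈ Set.Icc (0 : ℝ) H := by
  by_cases hh : h.1 + 1 < H
  · rw [nextV_of_lt Q h hh]
    exact h𝒬.iSup_mem (hQ _) s
  · simp [nextV_of_not_lt Q h hh]

theorem IsQClass.abs_nextV_sub_le (h𝒬 : IsQClass 𝒬) (hQ : ∀ h, Q h ∈ 𝒬 h)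
    (hQ' : ∀ h, Q' h ∈ 𝒬 h) {ρ : ℝ} (hρ : ∀ h x, |Q h x - Q' h x| ≤ ρ) (h : Fin H)
    (s : S) : |nextV Q h s - nextV Q' h s| ≤ ρ := by
  by_cases hh : h.1 + 1 < H
  · rw [nextV_of_lt Q h hh, nextV_of_lt Q' h hh]
    exact h𝒬.abs_iSup_sub_le (hQ _) (hQ' _) (hρ _) s
  · obtain ⟨g, -, -⟩ := (h𝒬 h _ (hQ h)).2.2
    simpa [nextV_of_not_lt _ h hh] using (abs_nonneg _).trans (hρ h (s, g s))

theorem IsQClass.integrable_nextV (h𝒬 : IsQClass 𝒬) (hQ : ∀ h, Q h ∈ 𝒬 h) (h : Fin H)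
    (ν : Measure S) [IsFiniteMeasure ν] : Integrable (nextV Q h) ν :=
  .of_bound (h𝒬.measurable_nextV hQ h).aestronglyMeasurable H (.of_forall fun s => by
    obtain ⟨hnonneg, hle⟩ := h𝒬.nextV_mem hQ h s
    rwa [Real.norm_eq_abs, abs_of_nonneg hnonneg])

end QClass

section Optimality

variable {H : ℕ} {𝒬 : Fin H → Set (S × A → ℝ)} (M : MDP S A H) {r : Fin H → S × A → ℝ}

theorem MDP.bellman_eq (r Q : Fin H → S × A → ℝ) (h : Fin H) (x : S × A) :
    M.bellman r Q h x = r h x + ∫ s, nextV Q h s ∂(M.P h x) := rfl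

theorem IsQClass.integral_qValue_le_iSup_optQ (h𝒬 : IsQClass 𝒬) (hr : IsUnitReward r)
    (hopt : ∀ h, M.optQ r h ∈ 𝒬 h) (π : Policy S A H) (h : Fin H) (s : S) :
    ∫ a, M.qValue π r h (s, a) ∂(π.kernel h s) ≤ ⨆ a, M.optQ r h (s, a) := by
  simpa using integral_mono_of_nonneg (.of_forall fun a => M.qValue_nonneg π hr h (s, a))
    (integrable_const (μ := π.kernel h s) (⨆ a, M.optQ r h (s, a)))
    (.of_forall fun a => (M.qValue_le_optQ π hr h _).trans (h𝒬.le_iSup (hopt h) s a))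

theorem IsQClass.value_le_iSup_optQ [NeZero H] (h𝒬 : IsQClass 𝒬) (hr : IsUnitReward r)
    (hopt : ∀ h, M.optQ r h ∈ 𝒬 h) (π : Policy S A H) :
    M.value π r ≤ ⨆ a, M.optQ r 0 (M.s₁, a) := by
  rw [M.value_eq_integral_qValue π hr]
  exact h𝒬.integral_qValue_le_iSup_optQ M hr hopt π 0 M.s₁

theorem IsQClass.optQ_le_bellman (h𝒬 : IsQClass 𝒬) (hr : IsUnitReward r)
    (hopt : ∀ h, M.optQ r h ∈ 𝒬 h) (h : Fin H) (x : S × A) :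
    M.optQ r h x ≤ M.bellman r (M.optQ r) h x := by
  choose g hgm _ using fun h => (h𝒬 h _ (hopt h)).2.2
  have : Nonempty (Policy S A H) := ⟨(DetPolicy.mk g hgm).toPolicy⟩
  refine ciSup_le fun π => ?_
  rw [M.qValue_eq, M.bellman_eq]
  refine add_le_add le_rfl (integral_mono (M.integrable_nextValue π hr h _)
    (h𝒬.integrable_nextV hopt h _) fun s => ?_)
  by_cases hh : h.1 + 1 < H
  · rw [M.nextValue_of_lt π hr h hh, nextV_of_lt _ h hh]
    exact h𝒬.integral_qValue_le_iSup_optQ M hr hopt π _ s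
  · rw [M.nextValue_of_not_lt π r h hh, nextV_of_not_lt _ h hh]

theorem IsQClass.qValue_eq_bellman_optQ (h𝒬 : IsQClass 𝒬) (hr : IsUnitReward r)
    (hopt : ∀ h, M.optQ r h ∈ 𝒬 h) {π : DetPolicy S A H} (hπ : IsGreedy (M.optQ r) π)
    (h : Fin H) (x : S × A) :
    M.qValue π.toPolicy r h x = M.bellman r (M.optQ r) h x := by
  rw [M.qValue_eq, M.bellman_eq]
  congr 2 with s
  by_cases hh : h.1 + 1 < H
  · have hnext (a : A) : M.qValue π.toPolicy r ⟨h.1 + 1, hh⟩ (s, a) =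
        M.optQ r ⟨h.1 + 1, hh⟩ (s, a) :=
      le_antisymm (M.qValue_le_optQ _ hr _ _) <| (h𝒬.optQ_le_bellman M hr hopt _ _).trans
        (h𝒬.qValue_eq_bellman_optQ hr hopt hπ ⟨h.1 + 1, hh⟩ (s, a)).ge
    have hmeas : Measurable fun a => M.optQ r ⟨h.1 + 1, hh⟩ (s, a) :=
      (h𝒬 _ _ (hopt _)).1.comp measurable_prodMk_left
    rw [M.nextValue_of_lt _ hr h hh, nextV_of_lt _ h hh]
    simp only [hnext]
    rw [iSup_eq_of_forall_le (hπ _ s)]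
    exact integral_dirac' (fun a => M.optQ r ⟨h.1 + 1, hh⟩ (s, a)) _ hmeas.stronglyMeasurable
  · rw [M.nextValue_of_not_lt _ r h hh, nextV_of_not_lt _ h hh]
termination_by H - h.1

theorem IsQClass.optQ_eq_bellman (h𝒬 : IsQClass 𝒬) (hr : IsUnitReward r)
    (hopt : ∀ h, M.optQ r h ∈ 𝒬 h) (h : Fin H) : M.optQ r h = M.bellman r (M.optQ r) h := by
  choose g hgm hg using fun h => (h𝒬 h _ (hopt h)).2.2
  funext x
  refine le_antisymm (h𝒬.optQ_le_bellman M hr hopt h x) ?_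
  rw [← h𝒬.qValue_eq_bellman_optQ M hr hopt (π := ⟨g, hgm⟩) hg]
  exact M.qValue_le_optQ _ hr h x

end Optimality

section ExponentialMoments

variable {Ω ι : Type*} [MeasurableSpace Ω] {μ : Measure Ω}

theorem lintegral_exp_sub_le_one [IsProbabilityMeasure μ] {f : Ω → ℝ} (hf : Measurable f)
    (hf1 : ∀ ω, |f ω| ≤ 1) {c : ℝ} (hc : ∫ ω, f ω ∂μ + ∫ ω, f ω ^ 2 ∂μ ≤ c) :
    ∫⁻ ω, ENNReal.ofReal (Real.exp (f ω - c)) ∂μ ≤ 1 := by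
  have hi : Integrable f μ := .of_bound hf.aestronglyMeasurable 1 (.of_forall hf1)
  have hi2 : Integrable (fun ω => f ω ^ 2) μ :=
    .of_bound (hf.pow_const 2).aestronglyMeasurable 1 (.of_forall fun ω => by
      simpa only [Real.norm_eq_abs, abs_pow] using pow_le_one₀ (abs_nonneg _) (hf1 ω))
  have hexp : ∀ ω, Real.exp (f ω) ≤ 1 + f ω + f ω ^ 2 := fun ω => by
    linarith [(abs_le.1 (Real.abs_exp_sub_one_sub_id_le (hf1 ω))).2]
  have hint : Integrable (fun ω => Real.exp (f ω)) μ :=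
    .of_bound (by fun_prop) (Real.exp 1) (.of_forall fun ω => by
      simpa only [Real.norm_eq_abs, Real.abs_exp, Real.exp_le_exp] using (abs_le.1 (hf1 ω)).2)
  have hmean : ∫ ω, Real.exp (f ω) ∂μ ≤ Real.exp c :=
    calc ∫ ω, Real.exp (f ω) ∂μ ≤ ∫ ω, (1 + f ω + f ω ^ 2) ∂μ :=
          integral_mono hint (((integrable_const 1).add hi).add hi2) hexp
      _ = 1 + ∫ ω, f ω ∂μ + ∫ ω, f ω ^ 2 ∂μ := by
          rw [integral_add (f := fun ω => 1 + f ω) ((integrable_const 1).add hi) hi2,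
            integral_add (integrable_const 1) hi]
          simp only [integral_const, probReal_univ, smul_eq_mul, one_mul]
      _ ≤ Real.exp c := by linarith [Real.add_one_le_exp c]
  simp only [Real.exp_sub]
  rw [← ofReal_integral_eq_lintegral_ofReal (hint.div_const _)
    (.of_forall fun ω => by positivity), integral_div]
  exact ENNReal.ofReal_le_one.2 (div_le_one_of_le₀ hmean (Real.exp_pos c).le)

theorem measure_log_inv_le_le {Z : Ω → ℝ} (hZ : Measurable Z)
    (hZ1 : ∫⁻ ω, ENNReal.ofReal (Real.exp (Z ω)) ∂μ ≤ 1) {δ : ℝ} (hδ : 0 < δ) :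
    μ {ω | Real.log δ⁻¹ ≤ Z ω} ≤ ENNReal.ofReal δ := by
  have hδ' : ENNReal.ofReal δ⁻¹ ≠ 0 := (ENNReal.ofReal_pos.2 (inv_pos.2 hδ)).ne'
  calc μ {ω | Real.log δ⁻¹ ≤ Z ω}
      ≤ μ {ω | ENNReal.ofReal δ⁻¹ ≤ ENNReal.ofReal (Real.exp (Z ω))} :=
        measure_mono fun ω hω => ENNReal.ofReal_le_ofReal
          ((Real.log_le_iff_le_exp (inv_pos.2 hδ)).1 hω)
    _ ≤ (∫⁻ ω, ENNReal.ofReal (Real.exp (Z ω)) ∂μ) / ENNReal.ofReal δ⁻¹ :=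
        meas_ge_le_lintegral_div (by fun_prop) hδ' ENNReal.ofReal_ne_top
    _ ≤ 1 / ENNReal.ofReal δ⁻¹ := by gcongr
    _ = ENNReal.ofReal δ := by rw [one_div, ENNReal.ofReal_inv_of_pos hδ, inv_inv]

theorem measure_exists_log_le_le (J : Finset ι) {Z : ι → Ω → ℝ} (hZ : ∀ j ∈ J, Measurable (Z j))
    (hZ1 : ∀ j ∈ J, ∫⁻ ω, ENNReal.ofReal (Real.exp (Z j ω)) ∂μ ≤ 1) {δ : ℝ} (hδ : 0 < δ) :
    μ {ω | ∃ j ∈ J, Real.log (J.card / δ) ≤ Z j ω} ≤ ENNReal.ofReal δ := by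
  obtain rfl | hJ := J.eq_empty_or_nonempty
  · simp
  have hcard : (0 : ℝ) < J.card := mod_cast hJ.card_pos
  calc μ {ω | ∃ j ∈ J, Real.log (J.card / δ) ≤ Z j ω}
      = μ (⋃ j ∈ J, {ω | Real.log (δ / J.card)⁻¹ ≤ Z j ω}) := by
        congr 1; ext ω; simp [inv_div]
    _ ≤ ∑ j ∈ J, μ {ω | Real.log (δ / J.card)⁻¹ ≤ Z j ω} := measure_biUnion_finset_le _ _
    _ ≤ ∑ _j ∈ J, ENNReal.ofReal (δ / J.card) := Finset.sum_le_sum fun j hj =>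
        measure_log_inv_le_le (hZ j hj) (hZ1 j hj) (by positivity)
    _ = ENNReal.ofReal δ := by
        rw [Finset.sum_const, nsmul_eq_mul, ← ENNReal.ofReal_natCast,
          ← ENNReal.ofReal_mul hcard.le, mul_div_cancel₀ _ hcard.ne']

end ExponentialMoments

section CondLaw

variable {Ω T : Type*} {mT : MeasurableSpace T}

/-- `ν ω` is a regular version of the conditional law of `τ` given the `σ`-algebra `m`. It is kept
as an `m`-measurable family of probability measures rather than as a kernel, because `m` is one
of many `σ`-algebras on the type `Ω`. -/
structure IsCondLaw (m : MeasurableSpace Ω) {mΩ : MeasurableSpace Ω} (τ : Ω → T)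
    (ν : Ω → Measure T) (μ : Measure Ω) : Prop where
  isProbabilityMeasure : ∀ ω, IsProbabilityMeasure (ν ω)
  measurable_law : Measurable[m] ν
  condExp_eq : ∀ E, MeasurableSet E → μ⟦τ ⁻¹' E | m⟧ =ᵐ[μ] fun ω => (ν ω).real E

variable {m mΩ : MeasurableSpace Ω} {μ : Measure Ω} {τ : Ω → T} {ν : Ω → Measure T}

theorem map_prodMk_eq_compProd {Ω' : Type*} [MeasurableSpace Ω'] [IsFiniteMeasure μ] {p : Ω → Ω'}
    (hp : Measurable p) (hτ : Measurable τ) (κ : Kernel Ω' T) [IsMarkovKernel κ]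
    (h : ∀ B E, MeasurableSet B → MeasurableSet E →
      μ (p ⁻¹' B ∩ τ ⁻¹' E) = ∫⁻ ω in p ⁻¹' B, κ (p ω) E ∂μ) :
    μ.map (fun ω => (p ω, τ ω)) = (μ.map p) ⊗ₘ κ := by
  refine Measure.ext_prod fun {B E} hB hE => ?_
  rw [Measure.map_apply (hp.prodMk hτ) (hB.prod hE), Measure.compProd_apply_prod hB hE,
    setLIntegral_map hB (κ.measurable_coe hE) hp, ← h B E hB hE]
  rfl

theorem IsCondLaw.measurable_integral (h : IsCondLaw m τ ν μ) {f : Ω × T → ℝ}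
    (hf : Measurable[m.prod mT] f) : Measurable[m] fun ω => ∫ t, f (ω, t) ∂(ν ω) := by
  let κ : @Kernel Ω T m mT := @Kernel.mk Ω T m mT ν h.measurable_law
  have : @IsMarkovKernel Ω T m mT κ := ⟨h.isProbabilityMeasure⟩
  exact (StronglyMeasurable.integral_kernel_prod_right' (κ := κ)
    hf.stronglyMeasurable).measurable

variable [IsFiniteMeasure μ]

theorem IsCondLaw.measure_inter_preimage (h : IsCondLaw m τ ν μ) (hm : m ≤ mΩ) (hτ : Measurable τ)
    {B : Set Ω} (hB : MeasurableSet[m] B) {E : Set T} (hE : MeasurableSet E) :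
    μ (B ∩ τ ⁻¹' E) = ∫⁻ ω in B, ν ω E ∂μ := by
  have := h.isProbabilityMeasure
  have hmeas : Measurable fun ω => ν ω E :=
    (Measure.measurable_coe hE).comp (h.measurable_law.mono hm le_rfl)
  have hfin : ∫⁻ ω in B, ν ω E ∂μ ≠ ⊤ :=
    ((setLIntegral_mono (g := fun _ => 1) measurable_const fun ω _ => prob_le_one).trans_lt
      (by simp)).ne
  refine (ENNReal.toReal_eq_toReal_iff' (measure_ne_top _ _) hfin).1 ?_
  calc μ.real (B ∩ τ ⁻¹' E) = ∫ ω in B, (τ ⁻¹' E).indicator (fun _ => (1 : ℝ)) ω ∂μ := by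
        rw [setIntegral_indicator (hτ hE)]; simp [Measure.real]
    _ = ∫ ω in B, (μ⟦τ ⁻¹' E | m⟧) ω ∂μ :=
        (setIntegral_condExp hm ((integrable_const _).indicator (hτ hE)) hB).symm
    _ = ∫ ω in B, (ν ω).real E ∂μ :=
        setIntegral_congr_ae (hm B hB) ((h.condExp_eq E hE).mono fun ω hω _ => hω)
    _ = (∫⁻ ω in B, ν ω E ∂μ).toReal :=
        integral_toReal hmeas.aemeasurable (.of_forall fun ω => measure_lt_top _ _)

theorem IsCondLaw.lintegral_eq (h : IsCondLaw m τ ν μ) (hm : m ≤ mΩ) (hτ : Measurable τ)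
    {F : Ω × T → ENNReal} (hF : Measurable[m.prod mT] F) :
    ∫⁻ ω, F (ω, τ ω) ∂μ = ∫⁻ ω, ∫⁻ t, F (ω, t) ∂(ν ω) ∂μ := by
  let κ : @Kernel Ω T m mT := @Kernel.mk Ω T m mT ν h.measurable_law
  have hκ : @IsMarkovKernel Ω T m mT κ := ⟨h.isProbabilityMeasure⟩
  have hid : @Measurable Ω Ω mΩ m id := fun s hs => hm s hs
  have hjoint := @map_prodMk_eq_compProd Ω T mT mΩ μ τ Ω m _ id hid hτ κ hκ
    fun B E hB hE => h.measure_inter_preimage hm hτ hB hE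
  calc ∫⁻ ω, F (ω, τ ω) ∂μ
      = @lintegral _ (m.prod mT) (@Measure.map _ _ mΩ (m.prod mT) (fun ω => (id ω, τ ω)) μ) F :=
        (@lintegral_map _ _ mΩ (m.prod mT) μ F _ hF (Measurable.prodMk hid hτ)).symm
    _ = @lintegral _ m (@Measure.map _ _ mΩ m id μ) fun ω => ∫⁻ t, F (ω, t) ∂(ν ω) := by
        rw [hjoint]; exact @Measure.lintegral_compProd _ _ m mT _ κ _ _ F hF
    _ = ∫⁻ ω, ∫⁻ t, F (ω, t) ∂(ν ω) ∂μ := @lintegral_map _ _ mΩ m μ _ id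
        (@Measurable.lintegral_kernel_prod_right' _ _ m mT κ _ F hF) hid

theorem IsCondLaw.lintegral_mul_le (h : IsCondLaw m τ ν μ) (hm : m ≤ mΩ) (hτ : Measurable τ)
    {W : Ω → ENNReal} (hW : Measurable[m] W) {G : Ω × T → ENNReal}
    (hG : Measurable[m.prod mT] G) (hG1 : ∀ ω, ∫⁻ t, G (ω, t) ∂(ν ω) ≤ 1) :
    ∫⁻ ω, W ω * G (ω, τ ω) ∂μ ≤ ∫⁻ ω, W ω ∂μ := by
  have hWG : Measurable[m.prod mT] fun p : Ω × T => W p.1 * G p :=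
    Measurable.fun_mul (hW.comp (@measurable_fst Ω T m mT)) hG
  rw [h.lintegral_eq hm hτ hWG]
  refine lintegral_mono fun ω => ?_
  change ∫⁻ t, W ω * G (ω, t) ∂(ν ω) ≤ W ω
  rw [lintegral_const_mul (f := fun t => G (ω, t)) _ (hG.comp (@measurable_prodMk_left Ω T m mT ω))]
  exact mul_le_of_le_one_right' (hG1 ω)

end CondLaw

section AdaptedSequence

variable {Ω T : Type*} {mΩ : MeasurableSpace Ω} {mT : MeasurableSpace T} {μ : Measure Ω}
  {ℱ : Filtration ℕ mΩ} {τ : ℕ → Ω → T} {ν : ℕ → Ω → Measure T} {s : Finset ℕ}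

theorem measurable_sum_of_adapted (hτ : ∀ i ∈ s, Measurable[ℱ (i + 1)] (τ i)) {Y : ℕ → Ω × T → ℝ}
    (hY : ∀ i ∈ s, Measurable[(ℱ i).prod mT] (Y i)) {n : ℕ} (hn : ∀ i ∈ s, i < n) :
    Measurable[ℱ n] fun ω => ∑ i ∈ s, Y i (ω, τ i ω) := by
  refine Finset.measurable_sum _ fun i hi => ?_
  have hid : @Measurable Ω Ω (ℱ n) (ℱ i) id := fun B hB => ℱ.mono (hn i hi).le B hB
  exact (hY i hi).comp (hid.prodMk ((hτ i hi).mono (ℱ.mono (hn i hi)) le_rfl))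

theorem measurable_sum_sub_of_adapted (hτ : ∀ i ∈ s, Measurable[ℱ (i + 1)] (τ i))
    {f : ℕ → Ω × T → ℝ} {c : ℕ → Ω → ℝ} (hf : ∀ i ∈ s, Measurable[(ℱ i).prod mT] (f i))
    (hc : ∀ i ∈ s, Measurable[ℱ i] (c i)) :
    Measurable fun ω => ∑ i ∈ s, (f i (ω, τ i ω) - c i ω) := by
  refine (measurable_sum_of_adapted hτ (Y := fun i p => f i p - c i p.1) (n := s.sup id + 1)
    (fun i hi => (hf i hi).sub ((hc i hi).comp (@measurable_fst Ω T (ℱ i) mT)))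
    fun i hi => Nat.lt_succ_of_le (s.le_sup (f := id) hi)).mono (ℱ.le _) le_rfl

variable [IsProbabilityMeasure μ]

theorem lintegral_exp_sum_le_one (hτ : ∀ i ∈ s, Measurable[ℱ (i + 1)] (τ i))
    (hν : ∀ i ∈ s, IsCondLaw (ℱ i) (τ i) (ν i) μ) {Y : ℕ → Ω × T → ℝ}
    (hY : ∀ i ∈ s, Measurable[(ℱ i).prod mT] (Y i))
    (hY1 : ∀ i ∈ s, ∀ ω, ∫⁻ t, ENNReal.ofReal (Real.exp (Y i (ω, t))) ∂(ν i ω) ≤ 1) :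
    ∫⁻ ω, ENNReal.ofReal (Real.exp (∑ i ∈ s, Y i (ω, τ i ω))) ∂μ ≤ 1 := by
  induction s using Finset.induction_on_max with
  | empty => simp
  | insert n s hlt ih =>
    rw [Finset.forall_mem_insert] at hτ hν hY hY1
    have hsum := measurable_sum_of_adapted hτ.2 hY.2 hlt
    calc ∫⁻ ω, ENNReal.ofReal (Real.exp (∑ i ∈ insert n s, Y i (ω, τ i ω))) ∂μ
        = ∫⁻ ω, ENNReal.ofReal (Real.exp (∑ i ∈ s, Y i (ω, τ i ω))) *
            ENNReal.ofReal (Real.exp (Y n (ω, τ n ω))) ∂μ := by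
          simp only [Finset.sum_insert fun h => lt_irrefl n (hlt n h), add_comm (Y n _),
            Real.exp_add, ENNReal.ofReal_mul (Real.exp_pos _).le]
      _ ≤ ∫⁻ ω, ENNReal.ofReal (Real.exp (∑ i ∈ s, Y i (ω, τ i ω))) ∂μ :=
          hν.1.lintegral_mul_le (ℱ.le n) (hτ.1.mono (ℱ.le _) le_rfl) hsum.exp.ennreal_ofReal
            hY.1.exp.ennreal_ofReal hY1.1
      _ ≤ 1 := ih hτ.2 hν.2 hY.2 hY1.2

theorem lintegral_exp_sum_sub_le_one (hτ : ∀ i ∈ s, Measurable[ℱ (i + 1)] (τ i))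
    (hν : ∀ i ∈ s, IsCondLaw (ℱ i) (τ i) (ν i) μ) {f : ℕ → Ω × T → ℝ} {c : ℕ → Ω → ℝ}
    (hf : ∀ i ∈ s, Measurable[(ℱ i).prod mT] (f i)) (hf1 : ∀ i ∈ s, ∀ p, |f i p| ≤ 1)
    (hc : ∀ i ∈ s, Measurable[ℱ i] (c i))
    (hfc : ∀ i ∈ s, ∀ ω, ∫ t, f i (ω, t) ∂(ν i ω) + ∫ t, f i (ω, t) ^ 2 ∂(ν i ω) ≤ c i ω) :
    ∫⁻ ω, ENNReal.ofReal (Real.exp (∑ i ∈ s, (f i (ω, τ i ω) - c i ω))) ∂μ ≤ 1 := by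
  refine lintegral_exp_sum_le_one hτ hν (Y := fun i p => f i p - c i p.1)
    (fun i hi => (hf i hi).sub ((hc i hi).comp (@measurable_fst Ω T (ℱ i) mT))) fun i hi ω => ?_
  have := (hν i hi).isProbabilityMeasure ω
  exact lintegral_exp_sub_le_one ((hf i hi).comp (@measurable_prodMk_left Ω T (ℱ i) mT ω))
    (fun t => hf1 i hi _) (hfc i hi ω)

theorem integral_const_mul_add_integral_sq_le {T : Type*} [MeasurableSpace T] {ν : Measure T}
    [IsProbabilityMeasure ν] {g : T → ℝ} {b : ℝ} (η : ℝ) (hg : ∀ t, |g t| ≤ b) :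
    ∫ t, η * g t ∂ν + ∫ t, (η * g t) ^ 2 ∂ν ≤ η * ∫ t, g t ∂ν + (η * b) ^ 2 := by
  have hsq : ∀ t, (η * g t) ^ 2 ≤ (η * b) ^ 2 := fun t => by
    rw [mul_pow, mul_pow, ← sq_abs (g t)]
    have := hg t
    gcongr
  rw [integral_const_mul]
  refine add_le_add le_rfl ?_
  simpa using integral_mono_of_nonneg (μ := ν) (.of_forall fun t => sq_nonneg _)
    (integrable_const _) (.of_forall hsq)

theorem measure_sum_sub_integral_deviation_le (hτ : ∀ i ∈ s, Measurable[ℱ (i + 1)] (τ i))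
    (hν : ∀ i ∈ s, IsCondLaw (ℱ i) (τ i) (ν i) μ) {f : ℕ → Ω × T → ℝ} {b η δ : ℝ}
    (hf : ∀ i ∈ s, Measurable[(ℱ i).prod mT] (f i)) (hfb : ∀ i ∈ s, ∀ p, |f i p| ≤ b)
    (hη : 0 < η) (hηb : η * b ≤ 1) (hδ : 0 < δ) :
    μ {ω | s.card * η * b ^ 2 + Real.log (1 / δ) / η ≤
      ∑ i ∈ s, (f i (ω, τ i ω) - ∫ t, f i (ω, t) ∂(ν i ω))} ≤ ENNReal.ofReal δ := by
  set c : ℕ → Ω → ℝ := fun i ω => η * ∫ t, f i (ω, t) ∂(ν i ω) + (η * b) ^ 2 with hc_def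
  have hηf : ∀ i ∈ s, Measurable[(ℱ i).prod mT] fun p => η * f i p := fun i hi =>
    (hf i hi).const_mul η
  have hηf1 : ∀ i ∈ s, ∀ p, |η * f i p| ≤ 1 := fun i hi p => by
    rw [abs_mul, abs_of_pos hη]
    exact (mul_le_mul_of_nonneg_left (hfb i hi p) hη.le).trans hηb
  have hc : ∀ i ∈ s, Measurable[ℱ i] (c i) := fun i hi =>
    (((hν i hi).measurable_integral (hf i hi)).const_mul η).add_const _
  have hexp := lintegral_exp_sum_sub_le_one hτ hν hηf hηf1 hc fun i hi ω => by
    have := (hν i hi).isProbabilityMeasure ω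
    exact integral_const_mul_add_integral_sq_le η fun t => hfb i hi (ω, t)
  refine (measure_mono fun ω hω => ?_).trans (measure_log_inv_le_le
    (measurable_sum_sub_of_adapted hτ hηf hc) hexp hδ)
  have hsum : ∑ i ∈ s, (η * f i (ω, τ i ω) - c i ω) =
      η * ∑ i ∈ s, (f i (ω, τ i ω) - ∫ t, f i (ω, t) ∂(ν i ω)) - s.card * (η * b) ^ 2 := by
    simp [hc_def, ← sub_sub, ← mul_sub, Finset.sum_sub_distrib _ _, ← Finset.mul_sum]
  have hlog : η * (s.card * η * b ^ 2 + Real.log (1 / δ) / η) =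
      s.card * (η * b) ^ 2 + Real.log δ⁻¹ := by
    rw [one_div]; field_simp
  rw [Set.mem_ofPred_eq, hsum]
  linarith [mul_le_mul_of_nonneg_left hω hη.le]

end AdaptedSequence

section RunLaw

variable {Ω : Type*} [mΩ : MeasurableSpace Ω] {μ : Measure Ω} {H : ℕ} {M : MDP S A H}
  {R 𝒬 : Fin H → Set (S × A → ℝ)} {πE π₀ : Policy S A H} {N K : ℕ}

/-- The policy that generates the trajectory `τ^i`: the initial policy for `i = 0`, and the greedy
policy `π^i` afterwards. -/
noncomputable def Run.rollout (run : Run μ M R 𝒬 πE π₀ N K) (i : ℕ) (ω : Ω) : Policy S A H :=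
  if i = 0 then π₀ else (run.greedy i ω).toPolicy

/-- The conditional law of the trajectory `τ^i`, given the information `ℱ i`. -/
noncomputable def Run.law (run : Run μ M R 𝒬 πE π₀ N K) (i : ℕ) (ω : Ω) : Measure (Fin H → S × A) :=
  M.trajLaw (run.rollout i ω)

instance (run : Run μ M R 𝒬 πE π₀ N K) (i : ℕ) (ω : Ω) : IsProbabilityMeasure (run.law i ω) :=
  inferInstanceAs (IsProbabilityMeasure (M.trajLaw _))

theorem Run.law_zero (run : Run μ M R 𝒬 πE π₀ N K) : run.law 0 = fun _ => M.trajLaw π₀ := by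
  funext ω; simp only [Run.law, Run.rollout, if_true]

theorem Run.law_of_mem_Icc (run : Run μ M R 𝒬 πE π₀ N K) {k : ℕ} (hk : k ∈ Finset.Icc 1 K) :
    run.law k = fun ω => M.trajLaw (run.greedy k ω).toPolicy := by
  funext ω
  simp only [Run.law, Run.rollout, if_neg (Nat.one_le_iff_ne_zero.1 (Finset.mem_Icc.1 hk).1)]

theorem eq_zero_or_mem_Icc {i : ℕ} (hi : i ≤ K) : i = 0 ∨ i ∈ Finset.Icc 1 K := by
  simp only [Finset.mem_Icc]; omega

theorem measurable_trajLaw_toPolicy {Θ : Type*} {mΘ : MeasurableSpace Θ} (M : MDP S A H)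
    (π : Θ → DetPolicy S A H) (hπ : ∀ h, Measurable fun p : Θ × S => (π p.1).act h p.2) :
    Measurable fun θ => M.trajLaw (π θ).toPolicy := by
  have hker : ∀ θ, (fun h => (Kernel.deterministic _ (hπ h)).sectR θ) = (π θ).toPolicy.kernel :=
    fun θ => funext fun h => Kernel.ext fun s => by
      simp only [Kernel.sectR_apply, Kernel.deterministic_apply, DetPolicy.toPolicy]
  have hmeas := (measurable_trajKernel_sectR H M.P fun h => Kernel.deterministic _ (hπ h)).comp
    (measurable_prodMk_right (y := M.s₁))
  simpa only [MDP.trajLaw, Function.comp_def, hker] using hmeas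

theorem Run.measurable_law (run : Run μ M R 𝒬 πE π₀ N K) {i : ℕ} (hi : i ≤ K) :
    Measurable[run.ℱ i] (run.law i) := by
  obtain rfl | hi := eq_zero_or_mem_Icc hi
  · rw [run.law_zero]
    exact @measurable_const _ _ _ (run.ℱ 0) _
  · rw [run.law_of_mem_Icc hi]
    exact measurable_trajLaw_toPolicy M (run.greedy i) (run.greedy_measurable i hi)

theorem Run.isCondLaw (run : Run μ M R 𝒬 πE π₀ N K) {i : ℕ} (hi : i ≤ K) :
    IsCondLaw (run.ℱ i) (run.τ i) (run.law i) μ where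
  isProbabilityMeasure _ := inferInstance
  measurable_law := run.measurable_law hi
  condExp_eq := by
    obtain rfl | hi := eq_zero_or_mem_Icc hi
    · simpa only [run.law_zero] using run.τ_law_zero
    · simpa only [run.law_of_mem_Icc hi] using run.τ_law i hi

/-- The return of a trajectory under the true reward minus its return under the reward `r^k`. -/
noncomputable def Run.rewardGap (run : Run μ M R 𝒬 πE π₀ N K) (k : ℕ)
    (p : Ω × (Fin H → S × A)) : ℝ :=
  pathReward M.reward p.2 - pathReward (run.r k p.1) p.2

theorem Run.isUnitReward_r (run : Run μ M R 𝒬 πE π₀ N K) (hR : IsRewardClass R) {k : ℕ}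
    (hk : k ∈ Finset.Icc 1 K) (ω : Ω) : IsUnitReward (run.r k ω) :=
  hR.isUnitReward (run.r_mem k hk ω)

theorem Run.measurable_rewardGap (run : Run μ M R 𝒬 πE π₀ N K) {k : ℕ}
    (hk : k ∈ Finset.Icc 1 K) :
    Measurable[(run.ℱ k).prod MeasurableSpace.pi] (run.rewardGap k) := by
  have hsnd := @measurable_snd Ω (Fin H → S × A) (run.ℱ k) MeasurableSpace.pi
  refine Measurable.sub ((measurable_pathReward M.isUnitReward_reward).comp hsnd)
    (Finset.measurable_sum _ fun h _ => ?_)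
  exact (run.r_measurable k hk h).comp
    (Measurable.prodMk (@measurable_fst Ω (Fin H → S × A) (run.ℱ k) _)
      ((measurable_pi_apply h).comp hsnd))

theorem Run.abs_rewardGap_le (run : Run μ M R 𝒬 πE π₀ N K) (hR : IsRewardClass R) {k : ℕ}
    (hk : k ∈ Finset.Icc 1 K) (p : Ω × (Fin H → S × A)) : |run.rewardGap k p| ≤ H := by
  have hrk := run.isUnitReward_r hR hk p.1
  exact abs_sub_le_of_nonneg_of_le (pathReward_nonneg M.isUnitReward_reward _)
    (pathReward_le M.isUnitReward_reward _) (pathReward_nonneg hrk _) (pathReward_le hrk _)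

theorem Run.integral_rewardGap (run : Run μ M R 𝒬 πE π₀ N K) (hR : IsRewardClass R) {k : ℕ}
    (hk : k ∈ Finset.Icc 1 K) (ω : Ω) :
    ∫ t, run.rewardGap k (ω, t) ∂(run.law k ω) =
      M.value (run.greedy k ω).toPolicy M.reward -
        M.value (run.greedy k ω).toPolicy (run.r k ω) := by
  rw [run.law_of_mem_Icc hk]
  exact integral_sub (integrable_pathReward M.isUnitReward_reward _)
    (integrable_pathReward (run.isUnitReward_r hR hk ω) _)

theorem Run.measure_rewardGap_deviation_le [IsProbabilityMeasure μ] (hR : IsRewardClass R)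
    (run : Run μ M R 𝒬 πE π₀ N K) {s δ : ℝ} (hs : 0 < s) (hsH : s * H ≤ 1) (hδ : 0 < δ) :
    μ {ω | K * s * H ^ 2 + Real.log (1 / δ) / s ≤ ∑ k ∈ Finset.Icc 1 K,
      (run.rewardGap k (ω, run.τ k ω) - ∫ t, run.rewardGap k (ω, t) ∂(run.law k ω))} ≤
      ENNReal.ofReal δ := by
  have hle : ∀ k ∈ Finset.Icc 1 K, k ≤ K := fun k hk => (Finset.mem_Icc.1 hk).2
  simpa only [Nat.card_Icc, Nat.add_sub_cancel] using measure_sum_sub_integral_deviation_le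
    (fun k hk => run.τ_measurable k (hle k hk)) (fun k hk => run.isCondLaw (hle k hk))
    (fun k hk => run.measurable_rewardGap hk) (fun k hk => run.abs_rewardGap_le hR hk) hs hsH hδ

end RunLaw

section NextMax

variable {H : ℕ} {𝒬 : Fin H → Set (S × A → ℝ)} {Q Q' : Fin H → S × A → ℝ}

omit [MeasurableSpace S] [MeasurableSpace A] in
theorem nextMax_of_lt (Q : Fin H → S × A → ℝ) (h : Fin H) (hh : h.1 + 1 < H) :
    nextMax Q h = fun τ => nextV Q h (τ ⟨h.1 + 1, hh⟩).1 := by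
  funext τ
  rw [nextMax, dif_pos hh, nextV_of_lt Q h hh]

omit [MeasurableSpace S] [MeasurableSpace A] in
theorem nextMax_of_not_lt (Q : Fin H → S × A → ℝ) (h : Fin H) (hh : ¬ h.1 + 1 < H) :
    nextMax Q h = fun _ => 0 := by
  funext τ
  rw [nextMax, dif_neg hh]

theorem IsQClass.nextMax_mem (h𝒬 : IsQClass 𝒬) (hQ : ∀ h, Q h ∈ 𝒬 h) (h : Fin H)
    (τ : Fin H → S × A) : nextMax Q h τ ∈ Set.Icc (0 : ℝ) H := by
  by_cases hh : h.1 + 1 < H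
  · rw [nextMax_of_lt Q h hh]
    exact h𝒬.nextV_mem hQ h _
  · simp [nextMax_of_not_lt Q h hh]

theorem IsQClass.abs_nextMax_sub_le (h𝒬 : IsQClass 𝒬) (hQ : ∀ h, Q h ∈ 𝒬 h)
    (hQ' : ∀ h, Q' h ∈ 𝒬 h) {ρ : ℝ} (hρ : ∀ h x, |Q h x - Q' h x| ≤ ρ) (h : Fin H)
    (τ : Fin H → S × A) : |nextMax Q h τ - nextMax Q' h τ| ≤ ρ := by
  by_cases hh : h.1 + 1 < H
  · rw [nextMax_of_lt Q h hh, nextMax_of_lt Q' h hh]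
    exact h𝒬.abs_nextV_sub_le hQ hQ' hρ h _
  · simpa [nextMax_of_not_lt _ h hh] using (abs_nonneg _).trans (hρ h (τ h))

theorem IsQClass.measurable_nextMax (h𝒬 : IsQClass 𝒬) (hQ : ∀ h, Q h ∈ 𝒬 h) (h : Fin H) :
    Measurable (nextMax Q h) := by
  by_cases hh : h.1 + 1 < H
  · rw [nextMax_of_lt Q h hh]
    exact (h𝒬.measurable_nextV hQ h).comp (measurable_fst.comp (measurable_pi_apply _))
  · rw [nextMax_of_not_lt Q h hh]
    exact measurable_const

/-- The conditional mean `E[max_a Q_{h+1}(s_{h+1}, a) | (s_h, a_h) = x]`. -/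
noncomputable def MDP.nextMean (M : MDP S A H) (Q : Fin H → S × A → ℝ) (h : Fin H)
    (x : S × A) : ℝ :=
  ∫ s, nextV Q h s ∂(M.P h x)

variable (M : MDP S A H)

theorem MDP.bellman_eq_add_nextMean (r Q : Fin H → S × A → ℝ) (h : Fin H) (x : S × A) :
    M.bellman r Q h x = r h x + M.nextMean Q h x := rfl

theorem IsQClass.nextMean_mem (h𝒬 : IsQClass 𝒬) (hQ : ∀ h, Q h ∈ 𝒬 h) (h : Fin H) (x : S × A) :
    M.nextMean Q h x ∈ Set.Icc (0 : ℝ) H := by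
  refine ⟨integral_nonneg fun s => (h𝒬.nextV_mem hQ h s).1, ?_⟩
  simpa [MDP.nextMean] using integral_mono (h𝒬.integrable_nextV hQ h (M.P h x))
    (integrable_const (H : ℝ)) fun s => (h𝒬.nextV_mem hQ h s).2

theorem IsQClass.abs_nextMean_sub_le (h𝒬 : IsQClass 𝒬) (hQ : ∀ h, Q h ∈ 𝒬 h)
    (hQ' : ∀ h, Q' h ∈ 𝒬 h) {ρ : ℝ} (hρ : ∀ h x, |Q h x - Q' h x| ≤ ρ) (h : Fin H)
    (x : S × A) : |M.nextMean Q h x - M.nextMean Q' h x| ≤ ρ := by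
  rw [MDP.nextMean, MDP.nextMean, ← integral_sub (h𝒬.integrable_nextV hQ h _)
    (h𝒬.integrable_nextV hQ' h _)]
  simpa using norm_integral_le_of_norm_le_const (μ := M.P h x) (C := ρ)
    (f := fun s => nextV Q h s - nextV Q' h s)
    (.of_forall (h𝒬.abs_nextV_sub_le hQ hQ' hρ h))

theorem IsQClass.measurable_nextMean (h𝒬 : IsQClass 𝒬) (hQ : ∀ h, Q h ∈ 𝒬 h) (h : Fin H) :
    Measurable (M.nextMean Q h) :=
  (StronglyMeasurable.integral_kernel_prod_right' (κ := M.P h)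
    (f := fun p : (S × A) × S => nextV Q h p.2)
    ((h𝒬.measurable_nextV hQ h).comp measurable_snd).stronglyMeasurable).measurable

/-- The Bellman noise `max_a Q_{h+1}(s_{h+1}, a) - E[max_a Q_{h+1}(s_{h+1}, a) | s_h, a_h]`. -/
noncomputable def MDP.noise (Q : Fin H → S × A → ℝ) (h : Fin H) (τ : Fin H → S × A) : ℝ :=
  nextMax Q h τ - M.nextMean Q h (τ h)

theorem IsQClass.abs_noise_le (h𝒬 : IsQClass 𝒬) (hQ : ∀ h, Q h ∈ 𝒬 h) (h : Fin H)
    (τ : Fin H → S × A) : |M.noise Q h τ| ≤ H := by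
  have hmax := h𝒬.nextMax_mem hQ h τ
  have hmean := h𝒬.nextMean_mem M hQ h (τ h)
  exact abs_sub_le_of_nonneg_of_le hmax.1 hmax.2 hmean.1 hmean.2

theorem IsQClass.measurable_noise (h𝒬 : IsQClass 𝒬) (hQ : ∀ h, Q h ∈ 𝒬 h) (h : Fin H) :
    Measurable (M.noise Q h) :=
  (h𝒬.measurable_nextMax hQ h).sub ((h𝒬.measurable_nextMean M hQ h).comp (measurable_pi_apply h))

theorem IsQClass.integral_mul_noise (h𝒬 : IsQClass 𝒬) (hQ : ∀ h, Q h ∈ 𝒬 h) (π : Policy S A H)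
    (h : Fin H) {g : S × A → ℝ} (hg : Measurable g) {C : ℝ} (hgC : ∀ x, |g x| ≤ C) :
    ∫ τ, g (τ h) * M.noise Q h τ ∂(M.trajLaw π) = 0 := by
  by_cases hh : h.1 + 1 < H
  · simp only [MDP.noise, nextMax_of_lt Q h hh]
    refine integral_mul_next_sub M π h hh hg (h𝒬.measurable_nextV hQ h) hgC (D := H) fun s => ?_
    obtain ⟨hnonneg, hle⟩ := h𝒬.nextV_mem hQ h s
    rwa [abs_of_nonneg hnonneg]
  · simp [MDP.noise, nextMax_of_not_lt Q h hh, MDP.nextMean, nextV_of_not_lt Q h hh]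

end NextMax

section Excess

variable {H : ℕ} {𝒬 : Fin H → Set (S × A → ℝ)} (M : MDP S A H) {r Q : Fin H → S × A → ℝ}
  {h : Fin H} {q : S × A → ℝ}

/-- The Bellman residual of `q` against `Q`. -/
noncomputable def MDP.resid (q : S × A → ℝ) (r Q : Fin H → S × A → ℝ) (h : Fin H)
    (x : S × A) : ℝ :=
  q x - M.bellman r Q h x

/-- The excess of the squared loss of `q` over that of the Bellman backup of `Q`, on one
trajectory. -/
noncomputable def MDP.excess (q : S × A → ℝ) (r Q : Fin H → S × A → ℝ) (h : Fin H)
    (τ : Fin H → S × A) : ℝ :=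
  (q (τ h) - r h (τ h) - nextMax Q h τ) ^ 2 -
    (M.bellman r Q h (τ h) - r h (τ h) - nextMax Q h τ) ^ 2

theorem MDP.excess_eq (q : S × A → ℝ) (r Q : Fin H → S × A → ℝ) (h : Fin H)
    (τ : Fin H → S × A) : M.excess q r Q h τ =
      M.resid q r Q h (τ h) ^ 2 - 2 * (M.resid q r Q h (τ h) * M.noise Q h τ) := by
  simp only [MDP.excess, MDP.resid, MDP.noise, M.bellman_eq_add_nextMean]
  ring

theorem MDP.excess_eq_mul (q : S × A → ℝ) (r Q : Fin H → S × A → ℝ) (h : Fin H)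
    (τ : Fin H → S × A) : M.excess q r Q h τ =
      M.resid q r Q h (τ h) * (M.resid q r Q h (τ h) - 2 * M.noise Q h τ) := by
  rw [M.excess_eq]
  ring

theorem IsQClass.abs_resid_le (h𝒬 : IsQClass 𝒬) (hq : q ∈ 𝒬 h) (hB : M.bellman r Q h ∈ 𝒬 h)
    (x : S × A) : |M.resid q r Q h x| ≤ H := by
  have hqx := (h𝒬 h q hq).2.1 x
  have hBx := (h𝒬 h _ hB).2.1 x
  exact abs_sub_le_of_nonneg_of_le hqx.1 hqx.2 hBx.1 hBx.2

theorem IsQClass.measurable_resid (h𝒬 : IsQClass 𝒬) (hq : q ∈ 𝒬 h)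
    (hB : M.bellman r Q h ∈ 𝒬 h) : Measurable (M.resid q r Q h) :=
  (h𝒬 h q hq).1.sub (h𝒬 h _ hB).1

theorem IsQClass.integrable_sq_resid (h𝒬 : IsQClass 𝒬) (hq : q ∈ 𝒬 h)
    (hB : M.bellman r Q h ∈ 𝒬 h) (π : Policy S A H) :
    Integrable (fun τ => M.resid q r Q h (τ h) ^ 2) (M.trajLaw π) := by
  have hmeas : Measurable fun τ : Fin H → S × A => M.resid q r Q h (τ h) :=
    (h𝒬.measurable_resid M hq hB).comp (measurable_pi_apply h)
  refine .of_bound (hmeas.pow_const 2).aestronglyMeasurable ((H : ℝ) ^ 2) (.of_forall fun τ => ?_)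
  rw [norm_pow]
  exact pow_le_pow_left₀ (norm_nonneg _) (h𝒬.abs_resid_le M hq hB _) 2

variable (h𝒬 : IsQClass 𝒬) (hQ : ∀ h, Q h ∈ 𝒬 h) (hq : q ∈ 𝒬 h) (hB : M.bellman r Q h ∈ 𝒬 h)
include h𝒬 hQ hq hB

theorem IsQClass.measurable_excess : Measurable (M.excess q r Q h) := by
  have hresid : Measurable fun τ : Fin H → S × A => M.resid q r Q h (τ h) :=
    (h𝒬.measurable_resid M hq hB).comp (measurable_pi_apply h)
  have hnoise := h𝒬.measurable_noise M hQ h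
  rw [funext (M.excess_eq q r Q h)]
  fun_prop

theorem IsQClass.abs_resid_sub_two_mul_noise_le (τ : Fin H → S × A) :
    |M.resid q r Q h (τ h) - 2 * M.noise Q h τ| ≤ 3 * H := by
  have hresid := abs_le.1 (h𝒬.abs_resid_le M hq hB (τ h))
  have hnoise := abs_le.1 (h𝒬.abs_noise_le M hQ h τ)
  rw [abs_le]
  constructor <;> linarith [hresid.1, hresid.2, hnoise.1, hnoise.2]

theorem IsQClass.abs_excess_le (τ : Fin H → S × A) : |M.excess q r Q h τ| ≤ 3 * (H : ℝ) ^ 2 := by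
  rw [M.excess_eq_mul, abs_mul]
  calc |M.resid q r Q h (τ h)| * |M.resid q r Q h (τ h) - 2 * M.noise Q h τ|
      ≤ H * (3 * H) := mul_le_mul (h𝒬.abs_resid_le M hq hB _)
        (h𝒬.abs_resid_sub_two_mul_noise_le M hQ hq hB τ) (abs_nonneg _) (Nat.cast_nonneg H)
    _ = 3 * (H : ℝ) ^ 2 := by ring

theorem IsQClass.sq_excess_le (τ : Fin H → S × A) :
    M.excess q r Q h τ ^ 2 ≤ 9 * (H : ℝ) ^ 2 * M.resid q r Q h (τ h) ^ 2 := by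
  have hsq : (M.resid q r Q h (τ h) - 2 * M.noise Q h τ) ^ 2 ≤ (3 * (H : ℝ)) ^ 2 :=
    sq_le_sq.2 ((h𝒬.abs_resid_sub_two_mul_noise_le M hQ hq hB τ).trans (le_abs_self _))
  rw [M.excess_eq_mul, mul_pow]
  calc M.resid q r Q h (τ h) ^ 2 * (M.resid q r Q h (τ h) - 2 * M.noise Q h τ) ^ 2
      ≤ M.resid q r Q h (τ h) ^ 2 * (3 * (H : ℝ)) ^ 2 := by gcongr
    _ = 9 * (H : ℝ) ^ 2 * M.resid q r Q h (τ h) ^ 2 := by ring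

theorem IsQClass.integral_excess (π : Policy S A H) :
    ∫ τ, M.excess q r Q h τ ∂(M.trajLaw π) =
      ∫ τ, M.resid q r Q h (τ h) ^ 2 ∂(M.trajLaw π) := by
  have hresid := h𝒬.measurable_resid M hq hB
  have hcross : Integrable (fun τ => M.resid q r Q h (τ h) * M.noise Q h τ) (M.trajLaw π) := by
    refine .of_bound ((hresid.comp (measurable_pi_apply h)).mul
      (h𝒬.measurable_noise M hQ h)).aestronglyMeasurable ((H : ℝ) * H) (.of_forall fun τ => ?_)
    rw [norm_mul]
    exact mul_le_mul (h𝒬.abs_resid_le M hq hB _) (h𝒬.abs_noise_le M hQ h τ) (norm_nonneg _)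
      (Nat.cast_nonneg H)
  simp only [M.excess_eq]
  rw [integral_sub (h𝒬.integrable_sq_resid M hq hB π) (hcross.const_mul 2), integral_const_mul,
    h𝒬.integral_mul_noise M hQ π h hresid (h𝒬.abs_resid_le M hq hB), mul_zero, sub_zero]

theorem IsQClass.integral_sq_excess_le (π : Policy S A H) :
    ∫ τ, M.excess q r Q h τ ^ 2 ∂(M.trajLaw π) ≤
      9 * (H : ℝ) ^ 2 * ∫ τ, M.resid q r Q h (τ h) ^ 2 ∂(M.trajLaw π) := by
  rw [← integral_const_mul]
  exact integral_mono_of_nonneg (.of_forall fun _ => sq_nonneg _)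
    ((h𝒬.integrable_sq_resid M hq hB π).const_mul _)
    (.of_forall (h𝒬.sq_excess_le M hQ hq hB))

end Excess

section ExcessDeviation

variable {Ω : Type*} [mΩ : MeasurableSpace Ω] {μ : Measure Ω} {H : ℕ} {M : MDP S A H}
  {R 𝒬 : Fin H → Set (S × A → ℝ)} {πE π₀ : Policy S A H} {N K : ℕ}

/-- The squared Bellman residual, in expectation over the conditional law of the trajectory
`τ^i`. -/
noncomputable def Run.residMean (run : Run μ M R 𝒬 πE π₀ N K) (q : S × A → ℝ)
    (r Q : Fin H → S × A → ℝ) (h : Fin H) (i : ℕ) (ω : Ω) : ℝ :=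
  ∫ t, M.resid q r Q h (t h) ^ 2 ∂(run.law i ω)

variable (run : Run μ M R 𝒬 πE π₀ N K) {r Q : Fin H → S × A → ℝ} {h : Fin H} {q : S × A → ℝ}

theorem Run.measurable_residMean (h𝒬 : IsQClass 𝒬) (hq : q ∈ 𝒬 h)
    (hB : M.bellman r Q h ∈ 𝒬 h) {i : ℕ} (hi : i ≤ K) :
    Measurable[run.ℱ i] (run.residMean q r Q h i) :=
  (run.isCondLaw hi).measurable_integral (f := fun p => M.resid q r Q h (p.2 h) ^ 2)
    (((h𝒬.measurable_resid M hq hB).comp ((measurable_pi_apply h).comp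
      (@measurable_snd Ω _ (run.ℱ i) _))).pow_const 2)

/-- The exponent `∑ i < k, (c / 36 H² - excess / 18 H²)`, with `c` the conditional mean of the
squared residual, whose exponential is a supermartingale: the conditional variance of the excess is
at most `9 H²` times its conditional mean. -/
noncomputable def Run.excessExponent (k : ℕ) (q : S × A → ℝ) (r Q : Fin H → S × A → ℝ)
    (h : Fin H) (ω : Ω) : ℝ :=
  ∑ i ∈ Finset.range k, (-(1 / (18 * (H : ℝ) ^ 2)) * M.excess q r Q h (run.τ i ω) -
    -(1 / (36 * (H : ℝ) ^ 2)) * run.residMean q r Q h i ω)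

theorem Run.excessExponent_eq (k : ℕ) (q : S × A → ℝ) (r Q : Fin H → S × A → ℝ) (h : Fin H)
    (ω : Ω) : run.excessExponent k q r Q h ω = 1 / (18 * (H : ℝ) ^ 2) *
      (1 / 2 * ∑ i ∈ Finset.range k, run.residMean q r Q h i ω -
        ∑ i ∈ Finset.range k, M.excess q r Q h (run.τ i ω)) := by
  rw [Run.excessExponent, Finset.sum_sub_distrib, ← Finset.mul_sum, ← Finset.mul_sum]
  ring

variable {k : ℕ} (h𝒬 : IsQClass 𝒬) (hQ : ∀ h, Q h ∈ 𝒬 h) (hq : q ∈ 𝒬 h)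
  (hB : M.bellman r Q h ∈ 𝒬 h) (hk : k ≤ K + 1)
include h𝒬 hQ hq hB hk

theorem Run.measurable_excessExponent : Measurable (run.excessExponent k q r Q h) := by
  have hle : ∀ i ∈ Finset.range k, i ≤ K := fun i hi => by grind
  exact measurable_sum_sub_of_adapted (fun i hi => run.τ_measurable i (hle i hi))
    (f := fun _ p => -(1 / (18 * (H : ℝ) ^ 2)) * M.excess q r Q h p.2)
    (fun i _ => ((h𝒬.measurable_excess M hQ hq hB).comp
      (@measurable_snd Ω _ (run.ℱ i) _)).const_mul _)
    fun i hi => (run.measurable_residMean h𝒬 hq hB (hle i hi)).const_mul _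

theorem Run.lintegral_exp_excessExponent_le_one [IsProbabilityMeasure μ] :
    ∫⁻ ω, ENNReal.ofReal (Real.exp (run.excessExponent k q r Q h ω)) ∂μ ≤ 1 := by
  have hH : (0 : ℝ) < H := by exact_mod_cast h.pos
  have hle : ∀ i ∈ Finset.range k, i ≤ K := fun i hi => by grind
  refine lintegral_exp_sum_sub_le_one (fun i hi => run.τ_measurable i (hle i hi))
    (fun i hi => run.isCondLaw (hle i hi))
    (f := fun _ p => -(1 / (18 * (H : ℝ) ^ 2)) * M.excess q r Q h p.2)
    (fun i _ => ((h𝒬.measurable_excess M hQ hq hB).comp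
      (@measurable_snd Ω _ (run.ℱ i) _)).const_mul _)
    (fun i _ p => ?_) (fun i hi => (run.measurable_residMean h𝒬 hq hB (hle i hi)).const_mul _)
    fun i _ ω => ?_
  · rw [abs_mul, abs_neg, abs_of_pos (by positivity), one_div_mul_eq_div,
      div_le_one (by positivity)]
    linarith [h𝒬.abs_excess_le M hQ hq hB p.2, sq_nonneg (H : ℝ)]
  · have hsq := h𝒬.integral_sq_excess_le M hQ hq hB (run.rollout i ω)
    simp only [mul_pow, integral_const_mul, Run.law]
    rw [h𝒬.integral_excess M hQ hq hB]
    calc _ ≤ -(1 / (18 * (H : ℝ) ^ 2)) *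
              ∫ τ, M.resid q r Q h (τ h) ^ 2 ∂(M.trajLaw (run.rollout i ω)) +
            (-(1 / (18 * (H : ℝ) ^ 2))) ^ 2 * (9 * (H : ℝ) ^ 2 *
              ∫ τ, M.resid q r Q h (τ h) ^ 2 ∂(M.trajLaw (run.rollout i ω))) := by gcongr
      _ = -(1 / (36 * (H : ℝ) ^ 2)) * run.residMean q r Q h i ω := by
          rw [Run.residMean, Run.law]; field_simp; ring

omit hQ hq hB hk in
theorem Run.measure_excess_deviation_le [IsProbabilityMeasure μ] {ι : Type*} (C : Finset ι)
    {f r Q : ι → Fin H → S × A → ℝ} (hf : ∀ c ∈ C, ∀ h, f c h ∈ 𝒬 h)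
    (hQ : ∀ c ∈ C, ∀ h, Q c h ∈ 𝒬 h) (hB : ∀ c ∈ C, ∀ h, M.bellman (r c) (Q c) h ∈ 𝒬 h)
    {δ : ℝ} (hδ : 0 < δ) :
    μ {ω | ∃ k ∈ Finset.Icc 1 K, ∃ h, ∃ c ∈ C,
      ∑ i ∈ Finset.range k, M.excess (f c h) (r c) (Q c) h (run.τ i ω) ≤
        1 / 2 * ∑ i ∈ Finset.range k, run.residMean (f c h) (r c) (Q c) h i ω -
          18 * H ^ 2 * Real.log (K * H * C.card / δ)} ≤ ENNReal.ofReal δ := by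
  let J := Finset.Icc 1 K ×ˢ (Finset.univ : Finset (Fin H)) ×ˢ C
  have hcard : (J.card : ℝ) = K * H * C.card := by simp [J, mul_assoc]
  have hmem : ∀ j ∈ J, j.2.2 ∈ C ∧ j.1 ≤ K + 1 := fun j hj => by
    simp only [J, Finset.mem_product, Finset.mem_Icc] at hj; exact ⟨hj.2.2, by omega⟩
  refine (measure_mono ?_).trans (measure_exists_log_le_le J
    (Z := fun j => run.excessExponent j.1 (f j.2.2 j.2.1) (r j.2.2) (Q j.2.2) j.2.1)
    (fun ⟨k, h, c⟩ hj => run.measurable_excessExponent h𝒬 (hQ c (hmem _ hj).1)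
      (hf c (hmem _ hj).1 h) (hB c (hmem _ hj).1 h) (hmem _ hj).2)
    (fun ⟨k, h, c⟩ hj => run.lintegral_exp_excessExponent_le_one h𝒬 (hQ c (hmem _ hj).1)
      (hf c (hmem _ hj).1 h) (hB c (hmem _ hj).1 h) (hmem _ hj).2) hδ)
  rintro ω ⟨k, hk, h, c, hc, hω⟩
  have hH : (0 : ℝ) < H := by exact_mod_cast h.pos
  refine ⟨(k, h, c), by simp [J, hc, Finset.mem_Icc.1 hk], ?_⟩
  rw [hcard, run.excessExponent_eq, one_div_mul_eq_div, le_div_iff₀ (by positivity)]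
  linarith

end ExcessDeviation

section Covering

variable {X : Type*} {ρ : ℝ} {F : Set (X → ℝ)} {F' : Finset (X → ℝ)}

/-- `F'` is a `ρ`-cover of `F` in the sup-distance, with centers in `F`: the covers over which
`coveringNumber` minimizes. -/
def IsCover (ρ : ℝ) (F : Set (X → ℝ)) (F' : Finset (X → ℝ)) : Prop :=
  (F' : Set (X → ℝ)) ⊆ F ∧ ∀ f ∈ F, ∃ f' ∈ F', ∀ x, |f x - f' x| ≤ ρ

theorem IsCover.coveringNumber_le (h : IsCover ρ F F') : coveringNumber ρ F ≤ F'.card :=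
  iInf_le_of_le F' (iInf_le_of_le h.1 (iInf_le_of_le h.2 le_rfl))

theorem IsCover.coveringNumber_ne_top (h : IsCover ρ F F') : coveringNumber ρ F ≠ ⊤ :=
  ne_top_of_le_ne_top (ENat.natCast_ne_top _) h.coveringNumber_le

theorem IsCover.covNum_le (h : IsCover ρ F F') : covNum ρ F ≤ F'.card := by
  rw [covNum, Nat.cast_le]
  exact ENat.toNat_le_of_le_natCast h.coveringNumber_le

theorem exists_isCover_card_eq (h : coveringNumber ρ F ≠ ⊤) :
    ∃ F', IsCover ρ F F' ∧ (F'.card : ℝ) = covNum ρ F := by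
  have hlt : coveringNumber ρ F < coveringNumber ρ F + 1 := (ENat.lt_add_one_iff h).2 le_rfl
  conv at hlt => lhs; unfold coveringNumber
  simp only [iInf_lt_iff] at hlt
  obtain ⟨F', hsub, hcover, hcard⟩ := hlt
  have hF' : IsCover ρ F F' := ⟨hsub, hcover⟩
  have heq : coveringNumber ρ F = F'.card :=
    le_antisymm hF'.coveringNumber_le ((ENat.lt_add_one_iff h).1 hcard)
  exact ⟨F', hF', by simp [covNum, heq]⟩

theorem covNum_nonneg (ρ : ℝ) (F : Set (X → ℝ)) : 0 ≤ covNum ρ F := Nat.cast_nonneg _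

theorem one_le_covNum (h : coveringNumber ρ F ≠ ⊤) (hF : F.Nonempty) : 1 ≤ covNum ρ F := by
  obtain ⟨F', hF', hcard⟩ := exists_isCover_card_eq h
  obtain ⟨f, hf⟩ := hF
  obtain ⟨f', hf', -⟩ := hF'.2 f hf
  rw [← hcard]
  exact_mod_cast Finset.card_pos.2 ⟨f', hf'⟩

theorem abs_sub_le_of_covNum_lt_two (h : coveringNumber ρ F ≠ ⊤) (h2 : covNum ρ F < 2)
    {f g : X → ℝ} (hf : f ∈ F) (hg : g ∈ F) (x : X) : |f x - g x| ≤ 2 * ρ := by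
  obtain ⟨F', hF', hcard⟩ := exists_isCover_card_eq h
  have hcard_le : F'.card ≤ 1 := by
    rw [← hcard] at h2
    exact Nat.lt_succ_iff.1 (by exact_mod_cast h2)
  obtain ⟨f', hf', hff'⟩ := hF'.2 f hf
  obtain ⟨g', hg', hgg'⟩ := hF'.2 g hg
  obtain rfl := Finset.card_le_one.1 hcard_le f' hf' g' hg'
  calc |f x - g x| ≤ |f x - f' x| + |f' x - g x| := abs_sub_le _ _ _
    _ ≤ ρ + ρ := add_le_add (hff' x) (by rw [abs_sub_comm]; exact hgg' x)
    _ = 2 * ρ := by ring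

variable {Y : Type*} {H : ℕ} {F G : Fin H → Set (X × Y → ℝ)}

theorem exists_isCover_prodClass (h : ∀ i, coveringNumber ρ (G i) ≠ ⊤) :
    ∃ G', IsCover ρ (prodClass G) G' ∧ (G'.card : ℝ) ≤ ∏ i, covNum ρ (G i) := by
  classical
  choose C hC hcard using fun i => exists_isCover_card_eq (h i)
  refine ⟨(Fintype.piFinset C).image fun c p => c p.1 p.2, ⟨?_, ?_⟩, ?_⟩
  · intro f hf
    simp only [Finset.coe_image, Set.mem_image, Finset.mem_coe, Fintype.mem_piFinset] at hf
    obtain ⟨c, hc, rfl⟩ := hf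
    exact fun i => (hC i).1 (hc i)
  · intro f hf
    choose c hc hcf using fun i => (hC i).2 _ (hf i)
    exact ⟨fun p => c p.1 p.2, Finset.mem_image.2 ⟨c, Fintype.mem_piFinset.2 hc, rfl⟩,
      fun p => hcf p.1 p.2⟩
  · simp only [← hcard]
    exact_mod_cast Finset.card_image_le.trans (Fintype.card_piFinset C).le

theorem coveringNumber_prodClass_ne_top (h : ∀ i, coveringNumber ρ (G i) ≠ ⊤) :
    coveringNumber ρ (prodClass G) ≠ ⊤ :=
  (exists_isCover_prodClass h).choose_spec.1.coveringNumber_ne_top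

theorem covNum_prodClass_le (h : ∀ i, coveringNumber ρ (G i) ≠ ⊤) :
    covNum ρ (prodClass G) ≤ ∏ i, covNum ρ (G i) := by
  obtain ⟨G', hG', hcard⟩ := exists_isCover_prodClass h
  exact hG'.covNum_le.trans hcard

theorem covNum_prodClass_mul_le_pow {n : ℝ} (hF : ∀ h, coveringNumber ρ (F h) ≠ ⊤)
    (hG : ∀ h, coveringNumber ρ (G h) ≠ ⊤) (hn : ∀ h, covNum ρ (F h) * covNum ρ (G h) ≤ n) :
    covNum ρ (prodClass F) * covNum ρ (prodClass G) ≤ n ^ H :=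
  calc covNum ρ (prodClass F) * covNum ρ (prodClass G)
      ≤ (∏ h, covNum ρ (F h)) * ∏ h, covNum ρ (G h) :=
        mul_le_mul (covNum_prodClass_le hF) (covNum_prodClass_le hG) (covNum_nonneg _ _)
          (Finset.prod_nonneg fun h _ => covNum_nonneg _ _)
    _ = ∏ h, covNum ρ (F h) * covNum ρ (G h) := Finset.prod_mul_distrib.symm
    _ ≤ ∏ _h : Fin H, n := Finset.prod_le_prod
        (fun h _ => mul_nonneg (covNum_nonneg _ _) (covNum_nonneg _ _)) fun h _ => hn h
    _ = n ^ H := by simp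

theorem IsCover.exists_mem_of_prodClass {G' : Finset (Fin H × (X × Y) → ℝ)}
    (hG' : IsCover ρ (prodClass G) G') {g : Fin H → X × Y → ℝ} (hg : ∀ h, g h ∈ G h) :
    ∃ g' ∈ G', ∀ h x, |g h x - g' (h, x)| ≤ ρ := by
  obtain ⟨g', hmem, hdist⟩ := hG'.2 (fun p => g p.1 p.2) hg
  exact ⟨g', hmem, fun h x => hdist (h, x)⟩

theorem IsCover.exists_mem_of_mem {G' : Finset (Fin H × (X × Y) → ℝ)}
    (hG' : IsCover ρ (prodClass G) G') (hG : ∀ h, (G h).Nonempty) {h : Fin H} {q : X × Y → ℝ}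
    (hq : q ∈ G h) : ∃ g' ∈ G', ∀ x, |q x - g' (h, x)| ≤ ρ := by
  choose g hg using hG
  have hupdate : ∀ i, Function.update g h q i ∈ G i := fun i => by
    rcases eq_or_ne i h with rfl | hi
    · simpa using hq
    · simpa [hi] using hg i
  obtain ⟨g', hmem, hdist⟩ := hG'.exists_mem_of_prodClass hupdate
  exact ⟨g', hmem, fun x => by simpa using hdist h x⟩

end Covering

section Discretization

theorem abs_sq_sub_sq_le {x y b η : ℝ} (hx : |x| ≤ b) (hy : |y| ≤ b) (h : |x - y| ≤ η) :
    |x ^ 2 - y ^ 2| ≤ 2 * b * η := by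
  rw [sq_sub_sq, abs_mul]
  have hadd : |x + y| ≤ 2 * b := (abs_add_le _ _).trans (by linarith)
  exact mul_le_mul hadd h (abs_nonneg _) ((abs_nonneg _).trans hadd)

theorem abs_mul_sub_mul_le {x x' y y' b η θ : ℝ} (hx' : |x'| ≤ b) (hy : |y| ≤ b)
    (hx : |x - x'| ≤ η) (hyy' : |y - y'| ≤ θ) : |x * y - x' * y'| ≤ b * (η + θ) := by
  have hb : 0 ≤ b := (abs_nonneg _).trans hy
  calc |x * y - x' * y'| = |y * (x - x') + x' * (y - y')| := by ring_nf
    _ ≤ |y| * |x - x'| + |x'| * |y - y'| := by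
        simpa only [abs_mul] using abs_add_le (y * (x - x')) (x' * (y - y'))
    _ ≤ b * η + b * θ := by gcongr
    _ = b * (η + θ) := by ring

variable {H : ℕ} {𝒬 : Fin H → Set (S × A → ℝ)} (h𝒬 : IsQClass 𝒬) (M : MDP S A H)
  {r r' Q Q' : Fin H → S × A → ℝ}
  (hQ : ∀ h, Q h ∈ 𝒬 h) (hQ' : ∀ h, Q' h ∈ 𝒬 h) {ρ : ℝ}
  (hQρ : ∀ h x, |Q h x - Q' h x| ≤ ρ) (hrρ : ∀ h x, |r h x - r' h x| ≤ ρ)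
  {h : Fin H} {q q' : S × A → ℝ} (hq : q ∈ 𝒬 h) (hq' : q' ∈ 𝒬 h) (hqρ : ∀ x, |q x - q' x| ≤ ρ)
  (hB : M.bellman r Q h ∈ 𝒬 h) (hB' : M.bellman r' Q' h ∈ 𝒬 h)
include h𝒬 hQ hQ' hQρ

theorem IsQClass.abs_noise_sub_le (τ : Fin H → S × A) :
    |M.noise Q h τ - M.noise Q' h τ| ≤ 2 * ρ := by
  have hmean := abs_le.1 (h𝒬.abs_nextMean_sub_le M hQ hQ' hQρ h (τ h))
  have hmax := abs_le.1 (h𝒬.abs_nextMax_sub_le hQ hQ' hQρ h τ)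
  rw [MDP.noise, MDP.noise, abs_le]
  constructor <;> linarith [hmean.1, hmean.2, hmax.1, hmax.2]

include hrρ hqρ

theorem IsQClass.abs_resid_sub_le (x : S × A) :
    |M.resid q r Q h x - M.resid q' r' Q' h x| ≤ 3 * ρ := by
  have hmean := abs_le.1 (h𝒬.abs_nextMean_sub_le M hQ hQ' hQρ h x)
  have hreward := abs_le.1 (hrρ h x)
  have hvalue := abs_le.1 (hqρ x)
  simp only [MDP.resid, MDP.bellman_eq_add_nextMean]
  rw [abs_le]
  constructor <;> linarith [hmean.1, hmean.2, hreward.1, hreward.2, hvalue.1, hvalue.2]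

include hq hq' hB hB'

theorem IsQClass.abs_sq_resid_sub_le (x : S × A) :
    |M.resid q r Q h x ^ 2 - M.resid q' r' Q' h x ^ 2| ≤ 2 * H * (3 * ρ) :=
  abs_sq_sub_sq_le (h𝒬.abs_resid_le M hq hB x) (h𝒬.abs_resid_le M hq' hB' x)
    (h𝒬.abs_resid_sub_le M hQ hQ' hQρ hrρ hqρ x)

theorem IsQClass.abs_excess_sub_le (τ : Fin H → S × A) :
    |M.excess q r Q h τ - M.excess q' r' Q' h τ| ≤ 16 * H * ρ := by
  have hsq := abs_le.1 (h𝒬.abs_sq_resid_sub_le M hQ hQ' hQρ hrρ hq hq' hqρ hB hB' (τ h))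
  have hcross := abs_le.1 (abs_mul_sub_mul_le (h𝒬.abs_resid_le M hq' hB' (τ h))
    (h𝒬.abs_noise_le M hQ h τ) (h𝒬.abs_resid_sub_le M hQ hQ' hQρ hrρ hqρ (τ h))
    (h𝒬.abs_noise_sub_le M hQ hQ' hQρ τ))
  rw [M.excess_eq, M.excess_eq, abs_le]
  constructor <;> linarith [hsq.1, hsq.2, hcross.1, hcross.2]

theorem IsQClass.integral_sq_resid_sub_le (π : Policy S A H) :
    ∫ τ, M.resid q r Q h (τ h) ^ 2 ∂(M.trajLaw π) -
      ∫ τ, M.resid q' r' Q' h (τ h) ^ 2 ∂(M.trajLaw π) ≤ 6 * H * ρ := by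
  have hint := h𝒬.integrable_sq_resid M hq hB π
  have hint' := h𝒬.integrable_sq_resid M hq' hB' π
  rw [← integral_sub hint hint']
  calc _ ≤ ∫ _, 2 * H * (3 * ρ) ∂(M.trajLaw π) :=
        integral_mono (hint.sub hint') (integrable_const _) fun τ => (abs_le.1
          (h𝒬.abs_sq_resid_sub_le M hQ hQ' hQρ hrρ hq hq' hqρ hB hB' (τ h))).2
    _ = 6 * H * ρ := by rw [integral_const, probReal_univ, one_smul]; ring

end Discretization

section UniformExcess

variable {H : ℕ} {R 𝒬 : Fin H → Set (S × A → ℝ)}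
variable {Ω : Type*} [mΩ : MeasurableSpace Ω] {μ : Measure Ω} {M : MDP S A H}
  {πE π₀ : Policy S A H} {N K : ℕ} (run : Run μ M R 𝒬 πE π₀ N K)

/-- The event that, in every iteration and simultaneously for all `q`, `Q` and `r` in the function
classes, the excess squared losses on the data collected so far sum to at least half of the
expected squared Bellman residuals, up to `β`. -/
def Run.IsExcessRadius (β : ℝ) (ω : Ω) : Prop :=
  ∀ k ∈ Finset.Icc 1 K, ∀ r : Fin H → S × A → ℝ, (∀ h, r h ∈ R h) →
    ∀ Q : Fin H → S × A → ℝ, (∀ h, Q h ∈ 𝒬 h) → ∀ h, ∀ q ∈ 𝒬 h,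
      1 / 2 * ∑ i ∈ Finset.range k, run.residMean q r Q h i ω - β ≤
        ∑ i ∈ Finset.range k, M.excess q r Q h (run.τ i ω)

theorem Run.sum_excess_sub_le (h𝒬 : IsQClass 𝒬) {k : ℕ} (hk : k ≤ K)
    {r r' Q Q' : Fin H → S × A → ℝ} (hQ : ∀ h, Q h ∈ 𝒬 h) (hQ' : ∀ h, Q' h ∈ 𝒬 h) {ρ : ℝ}
    (hρ : 0 ≤ ρ) (hQρ : ∀ h x, |Q h x - Q' h x| ≤ ρ) (hrρ : ∀ h x, |r h x - r' h x| ≤ ρ)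
    {h : Fin H} {q q' : S × A → ℝ} (hq : q ∈ 𝒬 h) (hq' : q' ∈ 𝒬 h)
    (hqρ : ∀ x, |q x - q' x| ≤ ρ) (hB : M.bellman r Q h ∈ 𝒬 h)
    (hB' : M.bellman r' Q' h ∈ 𝒬 h) (ω : Ω) :
    ∑ i ∈ Finset.range k, M.excess q' r' Q' h (run.τ i ω) -
        1 / 2 * ∑ i ∈ Finset.range k, run.residMean q' r' Q' h i ω ≤
      ∑ i ∈ Finset.range k, M.excess q r Q h (run.τ i ω) -
        1 / 2 * ∑ i ∈ Finset.range k, run.residMean q r Q h i ω + 19 * K * H * ρ := by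
  have hexcess : ∑ i ∈ Finset.range k, M.excess q' r' Q' h (run.τ i ω) ≤
      ∑ i ∈ Finset.range k, (M.excess q r Q h (run.τ i ω) + 16 * H * ρ) :=
    Finset.sum_le_sum fun i _ => by
      linarith [(abs_le.1 (h𝒬.abs_excess_sub_le M hQ hQ' hQρ hrρ hq hq' hqρ hB hB'
        (run.τ i ω))).1]
  have hresid : ∑ i ∈ Finset.range k, run.residMean q r Q h i ω ≤
      ∑ i ∈ Finset.range k, (run.residMean q' r' Q' h i ω + 6 * H * ρ) :=
    Finset.sum_le_sum fun i _ => sub_le_iff_le_add'.1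
      (h𝒬.integral_sq_resid_sub_le M hQ hQ' hQρ hrρ hq hq' hqρ hB hB' (run.rollout i ω))
  simp only [Finset.sum_add_distrib, Finset.sum_const, Finset.card_range, nsmul_eq_mul]
    at hexcess hresid
  have hkK : (k : ℝ) * (19 * H * ρ) ≤ K * (19 * H * ρ) := by gcongr
  linarith

theorem Run.measure_not_isExcessRadius_le [IsProbabilityMeasure μ] (h𝒬 : IsQClass 𝒬)
    (hcomp : BellmanComplete M R 𝒬) {ρ δ : ℝ} (hρ : 0 ≤ ρ) (hδ : 0 < δ)
    (hR : ∀ h, coveringNumber ρ (R h) ≠ ⊤) (hcov : ∀ h, coveringNumber ρ (𝒬 h) ≠ ⊤) :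
    μ {ω | ¬ run.IsExcessRadius (18 * H ^ 2 * Real.log (K * H * (covNum ρ (prodClass 𝒬) *
      covNum ρ (prodClass 𝒬) * covNum ρ (prodClass R)) / δ) + 19 * K * H * ρ) ω} ≤
      ENNReal.ofReal δ := by
  obtain ⟨CQ, hCQ, hcardQ⟩ := exists_isCover_card_eq (coveringNumber_prodClass_ne_top hcov)
  obtain ⟨CR, hCR, hcardR⟩ := exists_isCover_card_eq (coveringNumber_prodClass_ne_top hR)
  let C := (CQ ×ˢ CQ) ×ˢ CR
  have hcard : (C.card : ℝ) = CQ.card * CQ.card * CR.card := by simp [C]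
  have hmem : ∀ c ∈ C, (c.1.1 ∈ CQ ∧ c.1.2 ∈ CQ) ∧ c.2 ∈ CR := fun c hc => by
    simpa only [C, Finset.mem_product] using hc
  have hbound := run.measure_excess_deviation_le h𝒬 C (f := fun c h x => c.1.1 (h, x))
    (Q := fun c h x => c.1.2 (h, x)) (r := fun c h x => c.2 (h, x))
    (fun c hc => hCQ.1 (hmem c hc).1.1) (fun c hc => hCQ.1 (hmem c hc).1.2)
    (fun c hc => hcomp _ (hCR.1 (hmem c hc).2) _ (hCQ.1 (hmem c hc).1.2)) hδ
  rw [← hcardQ, ← hcardR, ← hcard]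
  refine (measure_mono fun ω hω => ?_).trans hbound
  simp only [Set.mem_ofPred_eq, Run.IsExcessRadius, not_forall, not_le] at hω
  obtain ⟨k, hk, r, hr, Q, hQ, h, q, hq, hω⟩ := hω
  obtain ⟨cq, hcq, hqρ⟩ := hCQ.exists_mem_of_mem (fun i => ⟨Q i, hQ i⟩) hq
  obtain ⟨cQ, hcQ, hQρ⟩ := hCQ.exists_mem_of_prodClass hQ
  obtain ⟨cr, hcr, hrρ⟩ := hCR.exists_mem_of_prodClass hr
  refine ⟨k, hk, h, ((cq, cQ), cr), by simp [C, hcq, hcQ, hcr], ?_⟩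
  linarith [run.sum_excess_sub_le h𝒬 (Finset.mem_Icc.1 hk).2 hQ (hCQ.1 hcQ) hρ hQρ hrρ hq
    (hCQ.1 hcq h) hqρ (hcomp r hr Q hQ h) (hcomp _ (hCR.1 hcr) _ (hCQ.1 hcQ) h) ω]

end UniformExcess

section BellmanError

variable {H : ℕ} {R 𝒬 : Fin H → Set (S × A → ℝ)}

theorem sqLoss_sub_sqLoss_bellman (M : MDP S A H) (D : ℕ → Fin H → S × A) (k : ℕ)
    (r : Fin H → S × A → ℝ) (h : Fin H) (q : S × A → ℝ) (Q : Fin H → S × A → ℝ) :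
    sqLoss D k r h q Q - sqLoss D k r h (M.bellman r Q h) Q =
      ∑ i ∈ Finset.range k, M.excess q r Q h (D i) := by
  simp only [sqLoss, MDP.excess, Finset.sum_sub_distrib]

omit [MeasurableSpace S] [MeasurableSpace A] in
theorem iInf_sqLoss_le (D : ℕ → Fin H → S × A) (k : ℕ) (r : Fin H → S × A → ℝ) (h : Fin H)
    {q : S × A → ℝ} (hq : q ∈ 𝒬 h) (Q : Fin H → S × A → ℝ) :
    ⨅ q : 𝒬 h, sqLoss D k r h q.1 Q ≤ sqLoss D k r h q Q :=
  ciInf_le (f := fun q : 𝒬 h => sqLoss D k r h q.1 Q)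
    ⟨0, Set.forall_mem_range.2 fun _ => Finset.sum_nonneg fun _ _ => sq_nonneg _⟩ ⟨q, hq⟩

omit [MeasurableSpace S] [MeasurableSpace A] in
theorem bellmanError_nonneg (D : ℕ → Fin H → S × A) (k : ℕ) (r : Fin H → S × A → ℝ)
    {Q : Fin H → S × A → ℝ} (hQ : ∀ h, Q h ∈ 𝒬 h) : 0 ≤ bellmanError 𝒬 D k r Q :=
  Finset.sum_nonneg fun h _ => sub_nonneg.2 (iInf_sqLoss_le D k r h (hQ h) Q)

variable {Ω : Type*} [mΩ : MeasurableSpace Ω] {μ : Measure Ω} {M : MDP S A H}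
  {πE π₀ : Policy S A H} {N K : ℕ} {run : Run μ M R 𝒬 πE π₀ N K} {k : ℕ} {ω : Ω} {β : ℝ}
  {r Q : Fin H → S × A → ℝ}

theorem Run.IsExcessRadius.sum_residMean_le (hβ : run.IsExcessRadius β ω)
    (hcomp : BellmanComplete M R 𝒬) (hk : k ∈ Finset.Icc 1 K) (hr : ∀ h, r h ∈ R h)
    (hQ : ∀ h, Q h ∈ 𝒬 h) :
    ∑ h, ∑ i ∈ Finset.range k, run.residMean (Q h) r Q h i ω ≤
      2 * bellmanError 𝒬 (fun i => run.τ i ω) k r Q + 2 * (H * β) := by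
  have hsum : ∑ h : Fin H, (1 / 2 * ∑ i ∈ Finset.range k, run.residMean (Q h) r Q h i ω - β) ≤
      bellmanError 𝒬 (fun i => run.τ i ω) k r Q := by
    refine Finset.sum_le_sum fun h _ => (hβ k hk r hr Q hQ h _ (hQ h)).trans ?_
    rw [← sqLoss_sub_sqLoss_bellman M (fun i => run.τ i ω)]
    exact sub_le_sub_left (iInf_sqLoss_le _ _ _ _ (hcomp r hr Q hQ h) _) _
  rw [Finset.sum_sub_distrib, ← Finset.mul_sum] at hsum
  simp only [Finset.sum_const, Finset.card_univ, Fintype.card_fin, nsmul_eq_mul] at hsum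
  linarith

theorem Run.IsExcessRadius.bellmanError_le (hβ : run.IsExcessRadius β ω)
    (hk : k ∈ Finset.Icc 1 K) (hr : ∀ h, r h ∈ R h) (hQ : ∀ h, Q h ∈ 𝒬 h)
    (hfix : ∀ h, Q h = M.bellman r Q h) :
    bellmanError 𝒬 (fun i => run.τ i ω) k r Q ≤ H * β := by
  have hstep : ∀ h ∈ (Finset.univ : Finset (Fin H)), sqLoss (fun i => run.τ i ω) k r h (Q h) Q -
      ⨅ q : 𝒬 h, sqLoss (fun i => run.τ i ω) k r h q.1 Q ≤ β := fun h _ => by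
    have : Nonempty (𝒬 h) := ⟨⟨Q h, hQ h⟩⟩
    rw [sub_le_comm]
    refine le_ciInf fun q => ?_
    have hexcess := hβ k hk r hr Q hQ h q.1 q.2
    rw [← sqLoss_sub_sqLoss_bellman M (fun i => run.τ i ω), ← hfix h] at hexcess
    have hresid : 0 ≤ ∑ i ∈ Finset.range k, run.residMean q.1 r Q h i ω :=
      Finset.sum_nonneg fun i _ => integral_nonneg fun _ => sq_nonneg _
    linarith
  simpa [bellmanError] using Finset.sum_le_sum hstep

end BellmanError

section AveragedExponential

theorem card_mul_exp_le_sum_exp {ι : Type*} [Fintype ι] {x : ι → ℝ} {a : ℝ}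
    (h : Fintype.card ι * a ≤ ∑ i, x i) :
    Fintype.card ι * Real.exp a ≤ ∑ i, Real.exp (x i) := by
  have htangent : ∀ i, Real.exp a * (x i - a + 1) ≤ Real.exp (x i) := fun i => by
    calc Real.exp a * (x i - a + 1) ≤ Real.exp a * Real.exp (x i - a) := by
          gcongr; exact Real.add_one_le_exp _
      _ = Real.exp (x i) := by rw [← Real.exp_add]; ring_nf
  refine le_trans ?_ (Finset.sum_le_sum fun i _ => htangent i)
  rw [← Finset.mul_sum, Finset.sum_add_distrib, Finset.sum_sub_distrib]
  simp only [Finset.sum_const, Finset.card_univ, nsmul_eq_mul, mul_one]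
  nlinarith [Real.exp_pos a]

theorem lintegral_sum_sum_le {Ω ι κ : Type*} [MeasurableSpace Ω] {μ : Measure Ω} [Fintype ι]
    {J : ι → Finset κ} {n : ℝ} (hJ : ∀ i, (J i).card ≤ n) {f : ι → κ → Ω → ENNReal}
    (hf : ∀ i, ∀ j ∈ J i, Measurable (f i j)) (hf1 : ∀ i, ∀ j ∈ J i, ∫⁻ ω, f i j ω ∂μ ≤ 1) :
    ∫⁻ ω, ∑ i, ∑ j ∈ J i, f i j ω ∂μ ≤ ENNReal.ofReal (Fintype.card ι * n) := by
  rw [lintegral_finsetSum _ fun i _ => Finset.measurable_sum _ (hf i)]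
  calc ∑ i, ∫⁻ ω, ∑ j ∈ J i, f i j ω ∂μ ≤ ∑ _i : ι, ENNReal.ofReal n :=
        Finset.sum_le_sum fun i _ => by
          rw [lintegral_finsetSum _ (hf i)]
          refine (Finset.sum_le_sum (hf1 i)).trans ?_
          simpa using ENNReal.ofReal_le_ofReal (hJ i)
    _ = ENNReal.ofReal (Fintype.card ι * n) := by simp [ENNReal.ofReal_mul]

-- Jensen's inequality for the average of the exponentials over `ι`, in place of a union bound,
-- keeps the cardinality of `ι` out of the logarithm.
theorem measure_exists_card_mul_log_le_sum_le {Ω ι κ : Type*} [MeasurableSpace Ω] {μ : Measure Ω}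
    [Fintype ι] [Nonempty ι] (J : ι → Finset κ) {n : ℝ} (hn : 0 < n) (hJ : ∀ i, (J i).card ≤ n)
    {Z : ι → κ → Ω → ℝ} (hZ : ∀ i, ∀ j ∈ J i, Measurable (Z i j))
    (hZ1 : ∀ i, ∀ j ∈ J i, ∫⁻ ω, ENNReal.ofReal (Real.exp (Z i j ω)) ∂μ ≤ 1) {δ : ℝ}
    (hδ : 0 < δ) :
    μ {ω | ∃ c : ι → κ, (∀ i, c i ∈ J i) ∧
      Fintype.card ι * Real.log (n / δ) ≤ ∑ i, Z i (c i) ω} ≤ ENNReal.ofReal δ := by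
  have hE : ∀ i, ∀ j ∈ J i, Measurable fun ω => ENNReal.ofReal (Real.exp (Z i j ω)) :=
    fun i j hj => (hZ i j hj).exp.ennreal_ofReal
  have hpos : 0 < Fintype.card ι * (n / δ) :=
    mul_pos (by exact_mod_cast Fintype.card_pos) (by positivity)
  calc _ ≤ μ {ω | ENNReal.ofReal (Fintype.card ι * (n / δ)) ≤ 
          ∑ i, ∑ j ∈ J i, ENNReal.ofReal (Real.exp (Z i j ω))} := by
        refine measure_mono fun ω ⟨c, hc, hω⟩ => ?_
        have hexp := card_mul_exp_le_sum_exp hω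
        rw [Real.exp_log (by positivity)] at hexp
        refine (ENNReal.ofReal_le_ofReal hexp).trans ?_
        rw [ENNReal.ofReal_sum_of_nonneg fun _ _ => (Real.exp_pos _).le]
        exact Finset.sum_le_sum fun i _ => Finset.single_le_sum
          (f := fun j => ENNReal.ofReal (Real.exp (Z i j ω))) (fun _ _ => zero_le) (hc i)
    _ ≤ (∫⁻ ω, ∑ i, ∑ j ∈ J i, ENNReal.ofReal (Real.exp (Z i j ω)) ∂μ) /
        ENNReal.ofReal (Fintype.card ι * (n / δ)) :=
        meas_ge_le_lintegral_div (Finset.measurable_sum _ fun i _ =>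
          Finset.measurable_sum _ (hE i)).aemeasurable
          (ENNReal.ofReal_pos.2 hpos).ne' ENNReal.ofReal_ne_top
    _ ≤ ENNReal.ofReal (Fintype.card ι * n) / ENNReal.ofReal (Fintype.card ι * (n / δ)) :=
        ENNReal.div_le_div_right (lintegral_sum_sum_le hJ hE hZ1) _
    _ = ENNReal.ofReal δ := by rw [← ENNReal.ofReal_div_of_pos hpos]; congr 1; field_simp

end AveragedExponential

section Expert

variable {H : ℕ} {R 𝒬 : Fin H → Set (S × A → ℝ)}
variable {Ω : Type*} [mΩ : MeasurableSpace Ω] {μ : Measure Ω} {M : MDP S A H}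
  {πE π₀ : Policy S A H} {N K : ℕ} (run : Run μ M R 𝒬 πE π₀ N K)

/-- The estimation error of the empirical expert value under the reward `r`. -/
noncomputable def Run.expertError (ω : Ω) (r : Fin H → S × A → ℝ) : ℝ :=
  run.expertValue ω r - M.value πE r

theorem Run.expertValue_sub (ω : Ω) (r r' : Fin H → S × A → ℝ) :
    run.expertValue ω r - run.expertValue ω r' =
      1 / N * ∑ j, (pathReward r (run.expert j ω) - pathReward r' (run.expert j ω)) := by
  rw [Run.expertValue, Run.expertValue, ← mul_sub, Finset.sum_sub_distrib]

theorem Run.abs_expertValue_sub_le (ω : Ω) {r r' : Fin H → S × A → ℝ} {ρ : ℝ} (hρ0 : 0 ≤ ρ)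
    (hρ : ∀ h x, |r h x - r' h x| ≤ ρ) :
    |run.expertValue ω r - run.expertValue ω r'| ≤ H * ρ := by
  rw [run.expertValue_sub, abs_mul, abs_of_nonneg (by positivity)]
  calc 1 / (N : ℝ) * |∑ j, (pathReward r (run.expert j ω) - pathReward r' (run.expert j ω))|
      ≤ 1 / (N : ℝ) * (N * (H * ρ)) := by
        gcongr
        refine (Finset.abs_sum_le_sum_abs _ _).trans
          ((Finset.sum_le_sum fun j _ => abs_pathReward_sub_le hρ _).trans ?_)
        simp
    _ = (1 / (N : ℝ) * N) * (H * ρ) := by ring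
    _ ≤ 1 * (H * ρ) := by gcongr; rw [one_div]; exact inv_mul_le_one
    _ = H * ρ := one_mul _

/-- The sum over the expert trajectories of `s f - (s E[f] + s²)`, for `f` evaluated in step `h`:
an exponent whose exponential has mean at most `1` if `|f| ≤ 1`. -/
noncomputable def Run.expertExponent (s : ℝ) (h : Fin H) (f : S × A → ℝ) (ω : Ω) : ℝ :=
  ∑ j, (s * f (run.expert j ω h) - (s * ∫ t, f (t h) ∂(M.trajLaw πE) + s ^ 2))

theorem Run.measurable_expert (j : Fin N) : Measurable (run.expert j) :=
  (run.expert_measurable j).mono (run.ℱ.le 0) le_rfl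

variable {s : ℝ} {h : Fin H} {f : S × A → ℝ}

theorem Run.measurable_expertExponent (hf : Measurable f) :
    Measurable (run.expertExponent s h f) :=
  Finset.measurable_sum _ fun j _ => ((hf.comp ((measurable_pi_apply h).comp
    (run.measurable_expert j))).const_mul s).sub_const _

theorem Run.lintegral_exp_expertExponent_le_one (hf : Measurable f)
    (hf1 : ∀ x, |f x| ≤ 1) (hs : |s| ≤ 1) :
    ∫⁻ ω, ENNReal.ofReal (Real.exp (run.expertExponent s h f ω)) ∂μ ≤ 1 := by
  let G : (Fin H → S × A) → ENNReal := fun t => ENNReal.ofReal (Real.exp (s * f (t h) -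
      (s * ∫ t, f (t h) ∂(M.trajLaw πE) + s ^ 2)))
  have hfm : Measurable fun t : Fin H → S × A => f (t h) := hf.comp (measurable_pi_apply h)
  have hG : Measurable G := by fun_prop
  have hprod : ∀ ω, ENNReal.ofReal (Real.exp (run.expertExponent s h f ω)) =
      ∏ j, G (run.expert j ω) := fun ω => by
    rw [Run.expertExponent, Real.exp_sum, ENNReal.ofReal_prod_of_nonneg fun _ _ =>
      (Real.exp_pos _).le]
  have hindep : iIndepFun (fun j ω => G (run.expert j ω)) μ :=
    run.expert_indep.comp (fun _ => G) fun _ => hG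
  simp only [hprod]
  rw [lintegral_prod_eq_prod_lintegral_of_indepFun Finset.univ _ hindep
    fun j => hG.comp (run.measurable_expert j)]
  refine Finset.prod_le_one' fun j _ => ?_
  rw [← lintegral_map hG (run.measurable_expert j), run.expert_law j]
  have hbound : ∀ x, |s * f x| ≤ 1 := fun x => by
    rw [abs_mul]
    exact mul_le_one₀ hs (abs_nonneg _) (hf1 _)
  refine lintegral_exp_sub_le_one (hfm.const_mul s) (fun t => hbound (t h)) ?_
  rw [integral_const_mul]
  gcongr
  calc ∫ t, (s * f (t h)) ^ 2 ∂(M.trajLaw πE) ≤ ∫ _, s ^ 2 ∂(M.trajLaw πE) :=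
        integral_mono_of_nonneg (.of_forall fun _ => sq_nonneg _) (integrable_const _)
          (.of_forall fun t => by
            simpa only [mul_pow, mul_one] using mul_le_mul_of_nonneg_left
              ((sq_le_one_iff_abs_le_one _).2 (hf1 (t h))) (sq_nonneg s))
    _ = s ^ 2 := by simp

theorem IsUnitReward.integrable_apply {r : Fin H → S × A → ℝ} (hr : IsUnitReward r) (h : Fin H)
    (ν : Measure (Fin H → S × A)) [IsFiniteMeasure ν] : Integrable (fun τ => r h (τ h)) ν :=
  .of_bound ((hr h).1.comp (measurable_pi_apply h)).aestronglyMeasurable 1 (.of_forall fun τ => by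
    rw [Real.norm_eq_abs, abs_of_nonneg ((hr h).2 _).1]
    exact ((hr h).2 _).2)

theorem MDP.sum_integral_sub (π : Policy S A H) {r r' : Fin H → S × A → ℝ} (hr : IsUnitReward r)
    (hr' : IsUnitReward r') :
    ∑ h, ∫ τ, (r h (τ h) - r' h (τ h)) ∂(M.trajLaw π) = M.value π r - M.value π r' := by
  simp only [MDP.value, pathReward]
  rw [integral_finsetSum _ fun h _ => hr.integrable_apply h _,
    integral_finsetSum _ fun h _ => hr'.integrable_apply h _, ← Finset.sum_sub_distrib]
  exact Finset.sum_congr rfl fun h _ =>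
    integral_sub (hr.integrable_apply h _) (hr'.integrable_apply h _)

theorem Run.sum_expertExponent (hN : 0 < N) (s : ℝ) {r r' : Fin H → S × A → ℝ}
    (hr : IsUnitReward r) (hr' : IsUnitReward r') (ω : Ω) :
    ∑ h, run.expertExponent s h (fun x => r h x - r' h x) ω =
      s * N * (run.expertError ω r - run.expertError ω r') - H * N * s ^ 2 := by
  have hN' : (N : ℝ) ≠ 0 := by positivity
  have hsample : ∑ h, ∑ j, (r h (run.expert j ω h) - r' h (run.expert j ω h)) =
      N * (run.expertValue ω r - run.expertValue ω r') := by
    rw [Finset.sum_comm, run.expertValue_sub]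
    simp only [pathReward, Finset.sum_sub_distrib]
    field_simp
  have hexponent : ∀ h, run.expertExponent s h (fun x => r h x - r' h x) ω =
      s * ∑ j, (r h (run.expert j ω h) - r' h (run.expert j ω h)) -
        N * (s * ∫ t, (r h (t h) - r' h (t h)) ∂(M.trajLaw πE) + s ^ 2) := fun _ => by
    simp only [Run.expertExponent, Finset.sum_sub_distrib, Finset.sum_const, Finset.card_univ,
      Fintype.card_fin, nsmul_eq_mul, ← Finset.mul_sum]
  simp only [hexponent, Run.expertError, Finset.sum_sub_distrib (f := fun _ => s * _),
    ← Finset.mul_sum, Finset.sum_add_distrib, hsample, M.sum_integral_sub πE hr hr',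
    Finset.sum_const, Finset.card_univ, Fintype.card_fin, nsmul_eq_mul]
  ring

theorem Run.measure_expertError_deviation_le [NeZero H] [IsProbabilityMeasure μ]
    (hR : IsRewardClass R) (hreal : RewardRealizable M R) (hN : 0 < N) {ρ : ℝ} (hρ : 0 ≤ ρ)
    (hcov : ∀ h, coveringNumber ρ (R h) ≠ ⊤) {n : ℝ} (hn : ∀ h, covNum ρ (R h) ≤ n) {s δ : ℝ}
    (hs : 0 < s) (hs1 : s ≤ 1) (hδ : 0 < δ) :
    μ {ω | ∃ r : Fin H → S × A → ℝ, (∀ h, r h ∈ R h) ∧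
      H * s + H * Real.log (n / δ) / (s * N) + 2 * H * ρ ≤
        run.expertError ω r - run.expertError ω M.reward} ≤ ENNReal.ofReal δ := by
  have hn0 : 0 < n := zero_lt_one.trans_le ((one_le_covNum (hcov 0) ⟨_, hreal 0⟩).trans (hn 0))
  choose C hC hcard using fun h => exists_isCover_card_eq (hcov h)
  have hreward := M.isUnitReward_reward
  have hmeas : ∀ h, ∀ c ∈ C h, Measurable fun x => c x - M.reward h x := fun h c hc =>
    (hR h c ((hC h).1 hc)).1.sub (hreward h).1
  have hbound : ∀ h, ∀ c ∈ C h, ∀ x, |c x - M.reward h x| ≤ 1 := fun h c hc x => by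
    have hcx := (hR h c ((hC h).1 hc)).2 x
    have hrx := (hreward h).2 x
    exact abs_sub_le_of_nonneg_of_le hcx.1 hcx.2 hrx.1 hrx.2
  refine (measure_mono ?_).trans (measure_exists_card_mul_log_le_sum_le C hn0
    (fun h => (hcard h).trans_le (hn h))
    (Z := fun h c => run.expertExponent s h fun x => c x - M.reward h x)
    (fun h c hc => run.measurable_expertExponent (hmeas h c hc))
    (fun h c hc => run.lintegral_exp_expertExponent_le_one (hmeas h c hc) (hbound h c hc)
      (by rwa [abs_of_pos hs])) hδ)
  rintro ω ⟨r, hr, hω⟩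
  choose c hc hcρ using fun h => (hC h).2 _ (hr h)
  have hcunit : IsUnitReward c := hR.isUnitReward fun h => (hC h).1 (hc h)
  refine ⟨c, hc, ?_⟩
  have hsample := (abs_le.1 (run.abs_expertValue_sub_le ω hρ hcρ)).2
  have hvalue := (abs_le.1 (M.abs_value_sub_le πE (hR.isUnitReward hr) hcunit hcρ)).1
  have hdev : H * s + H * Real.log (n / δ) / (s * N) ≤
      run.expertError ω c - run.expertError ω M.reward := by
    simp only [Run.expertError] at hω ⊢
    linarith
  have hsN : 0 < s * N := mul_pos hs (Nat.cast_pos.2 hN)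
  rw [Fintype.card_fin, run.sum_expertExponent hN s hcunit hreward, le_sub_iff_add_le]
  calc H * Real.log (n / δ) + H * N * s ^ 2
      = s * N * (H * s + H * Real.log (n / δ) / (s * N)) := by
        rw [mul_add, mul_div_cancel₀ _ hsN.ne']; ring
    _ ≤ s * N * (run.expertError ω c - run.expertError ω M.reward) :=
        mul_le_mul_of_nonneg_left hdev hsN.le

end Expert

theorem sum_Icc_one_eq_sum_fin (K : ℕ) (f : ℕ → ℝ) :
    ∑ k ∈ Finset.Icc 1 K, f k = ∑ k : Fin K, f (k.1 + 1) := by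
  rw [Fin.sum_univ_eq_sum_range (fun k => f (k + 1)) K, Finset.range_eq_Ico,
    Finset.sum_Ico_add' f 0 K 1]
  rfl

theorem sum_filter_lt_le {K : ℕ} (k : Fin K) {a : ℕ → ℝ} (ha : ∀ i, 0 ≤ a i) :
    ∑ i ∈ Finset.univ.filter (fun i : Fin K => i < k), a (i.1 + 1) ≤
      ∑ i ∈ Finset.range (k.1 + 1), a i := by
  have hinj : Set.InjOn (fun i : Fin K => i.1 + 1)
      (Finset.univ.filter (fun i : Fin K => i < k) : Finset (Fin K)) :=
    fun i _ j _ hij => Fin.ext (Nat.succ_injective hij)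
  rw [← Finset.sum_image (f := a) hinj]
  refine Finset.sum_le_sum_of_subset_of_nonneg (Finset.image_subset_iff.2 fun i hi => ?_)
    fun i _ _ => ha i
  have hik : i.1 < k.1 := (Finset.mem_filter.1 hi).2
  exact Finset.mem_range.2 (Nat.succ_lt_succ hik)

section Optimism

variable {H : ℕ} {R 𝒬 : Fin H → Set (S × A → ℝ)}

theorem gecBound_horizon_mul [NeZero H] (hR : IsRewardClass R) (h𝒬 : IsQClass 𝒬) (M : MDP S A H)
    (K : ℕ) {ε : ℝ} (hε : 0 ≤ ε) : GECBound M R 𝒬 K ε (H * K) := by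
  intro r Q π hr hQ _ m hm
  have hregret : ∑ k, (Q k 0 (M.s₁, (π k).act 0 M.s₁) - M.value (π k).toPolicy (r k)) ≤ H * K := by
    refine (Finset.sum_le_sum (g := fun _ => (H : ℝ)) fun k _ => ?_).trans (by simp [mul_comm])
    have hQk := ((h𝒬 0 _ (hQ k 0)).2.1 (M.s₁, (π k).act 0 M.s₁)).2
    have hvalue := M.value_nonneg (π k).toPolicy (hR.isUnitReward (hr k))
    linarith
  have hsqrt : Real.sqrt ((H * K : ℝ) * H * K) = H * K := by
    rw [mul_assoc, ← sq, Real.sqrt_sq (by positivity)]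
  have hresid : 0 ≤ m / 2 * ∑ k, ∑ i ∈ Finset.univ.filter (fun i => i < k),
      (∫ τ, ∑ h, (Q k h (τ h) - M.bellman (r k) (Q k) h (τ h)) ^ 2
        ∂(M.trajLaw (π i).toPolicy)) :=
    mul_nonneg (by positivity) (Finset.sum_nonneg fun _ _ => Finset.sum_nonneg fun _ _ =>
      integral_nonneg fun _ => Finset.sum_nonneg fun _ _ => sq_nonneg _)
  have hdm : 0 ≤ (H * K : ℝ) / (2 * m) := by positivity
  have hεHK : 0 ≤ ε * H * K := by positivity
  rw [hsqrt]
  linarith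

theorem exists_gecBound [NeZero H] (hR : IsRewardClass R) (h𝒬 : IsQClass 𝒬) {M : MDP S A H} {K : ℕ}
    {ε d : ℝ} (hε : 0 ≤ ε) (hd : dGEC M R 𝒬 K ε < d) : ∃ d' ≤ d, GECBound M R 𝒬 K ε d' := by
  have hne : {d : ℝ | 0 ≤ d ∧ GECBound M R 𝒬 K ε d}.Nonempty :=
    ⟨H * K, by positivity, gecBound_horizon_mul hR h𝒬 M K hε⟩
  obtain ⟨d', hd', hlt⟩ := exists_lt_of_csInf_lt hne hd
  exact ⟨d', hlt.le, hd'.2⟩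

variable {Ω : Type*} [mΩ : MeasurableSpace Ω] {μ : Measure Ω} {M : MDP S A H}
  {πE π₀ : Policy S A H} {N K : ℕ} {run : Run μ M R 𝒬 πE π₀ N K}

theorem bddBelow_range_objective [NeZero H] (h𝒬 : IsQClass 𝒬) {lam : ℝ} (hlam : 0 ≤ lam)
    (M : MDP S A H) (D : ℕ → Fin H → S × A) (k : ℕ) (r : Fin H → S × A → ℝ) :
    BddBelow (Set.range fun Q : {Q : Fin H → S × A → ℝ // ∀ h, Q h ∈ 𝒬 h} =>
      objective M 𝒬 D lam k r Q.1) := by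
  refine ⟨-(lam * H), Set.forall_mem_range.2 fun Q => ?_⟩
  have herror := bellmanError_nonneg D k r Q.2
  have hmax := mul_le_mul_of_nonneg_left (h𝒬.iSup_mem (Q.2 0) M.s₁).2 hlam
  rw [objective]
  linarith

theorem Run.objective_le [NeZero H] (h𝒬 : IsQClass 𝒬) {lam : ℝ} (hlam : 0 ≤ lam) (ω : Ω) {k : ℕ}
    (hk : k ∈ Finset.Icc 1 K) {Q : Fin H → S × A → ℝ} (hQ : ∀ h, Q h ∈ 𝒬 h) :
    objective M 𝒬 (fun i => run.τ i ω) lam k (run.r k ω) (run.Q k ω) ≤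
      objective M 𝒬 (fun i => run.τ i ω) lam k (run.r k ω) Q + run.qOptError lam ω := by
  have hinf := ciInf_le (bddBelow_range_objective h𝒬 hlam M (fun i => run.τ i ω) k (run.r k ω))
    ⟨Q, hQ⟩
  have hgap : objective M 𝒬 (fun i => run.τ i ω) lam k (run.r k ω) (run.Q k ω) -
      ⨅ Q : {Q : Fin H → S × A → ℝ // ∀ h, Q h ∈ 𝒬 h},
        objective M 𝒬 (fun i => run.τ i ω) lam k (run.r k ω) Q.1 ≤ run.qOptError lam ω :=
    le_ciSup (f := fun k : Finset.Icc 1 K =>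
      objective M 𝒬 (fun i => run.τ i ω) lam k.1 (run.r k.1 ω) (run.Q k.1 ω) -
        ⨅ Q : {Q : Fin H → S × A → ℝ // ∀ h, Q h ∈ 𝒬 h},
          objective M 𝒬 (fun i => run.τ i ω) lam k.1 (run.r k.1 ω) Q.1)
      (Set.finite_range _).bddAbove ⟨k, hk⟩
  linarith

theorem Run.qOptError_nonneg [NeZero H] (h𝒬 : IsQClass 𝒬) (hK : 0 < K) {lam : ℝ}
    (hlam : 0 ≤ lam) (ω : Ω) : 0 ≤ run.qOptError lam ω := by
  have hmem : 1 ∈ Finset.Icc 1 K := Finset.mem_Icc.2 ⟨le_rfl, hK⟩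
  have hle := run.objective_le h𝒬 hlam ω hmem (run.Q_mem 1 hmem ω)
  linarith

variable {β : ℝ} {ω : Ω}

theorem Run.IsExcessRadius.value_le [NeZero H] (hβ : run.IsExcessRadius β ω)
    (hR : IsRewardClass R) (h𝒬 : IsQClass 𝒬) (hopt : QRealizable M R 𝒬) {lam : ℝ}
    (hlam : 0 < lam) (π : Policy S A H) {k : ℕ} (hk : k ∈ Finset.Icc 1 K) :
    M.value π (run.r k ω) ≤ run.Q k ω 0 (M.s₁, (run.greedy k ω).act 0 M.s₁) +
      (H * β + run.qOptError lam ω -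
        bellmanError 𝒬 (fun i => run.τ i ω) k (run.r k ω) (run.Q k ω)) / lam := by
  have hr := run.isUnitReward_r hR hk ω
  have hoptk := hopt _ (run.r_mem k hk ω)
  have hvalue := h𝒬.value_le_iSup_optQ M hr hoptk π
  have hobj := run.objective_le h𝒬 hlam.le ω hk hoptk
  have herror := hβ.bellmanError_le hk (run.r_mem k hk ω) hoptk (h𝒬.optQ_eq_bellman M hr hoptk)
  simp only [objective, iSup_eq_of_forall_le fun a => run.isGreedy k hk ω 0 M.s₁ a] at hobj
  rw [← sub_le_iff_le_add', le_div_iff₀ hlam]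
  have hmul := mul_le_mul_of_nonneg_left hvalue hlam.le
  linarith

theorem Run.IsExcessRadius.sum_integral_sq_bellman_le (hβ : run.IsExcessRadius β ω)
    (h𝒬 : IsQClass 𝒬) (hcomp : BellmanComplete M R 𝒬) {r Q : Fin H → S × A → ℝ}
    (hr : ∀ h, r h ∈ R h) (hQ : ∀ h, Q h ∈ 𝒬 h) (k : Fin K) :
    ∑ i ∈ Finset.univ.filter (fun i => i < k), (∫ τ, ∑ h, (Q h (τ h) - M.bellman r Q h (τ h)) ^ 2
        ∂(M.trajLaw (run.greedy (i.1 + 1) ω).toPolicy)) ≤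
      2 * bellmanError 𝒬 (fun i => run.τ i ω) (k.1 + 1) r Q + 2 * (H * β) := by
  refine le_trans ?_ (hβ.sum_residMean_le hcomp (k := k.1 + 1) (by simp) hr hQ)
  rw [Finset.sum_comm]
  refine le_trans (le_of_eq (Finset.sum_congr rfl fun i _ => ?_))
    (sum_filter_lt_le k (a := fun i => ∑ h, run.residMean (Q h) r Q h i ω)
      fun i => Finset.sum_nonneg fun h _ => integral_nonneg fun _ => sq_nonneg _)
  simp only [Run.residMean, run.law_of_mem_Icc (show i.1 + 1 ∈ Finset.Icc 1 K by simp)]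
  exact integral_finsetSum _ fun h _ =>
    h𝒬.integrable_sq_resid M (hQ h) (hcomp r hr Q hQ h) _

theorem Run.IsExcessRadius.sum_greedy_sub_value_le [NeZero H] (hβ : run.IsExcessRadius β ω)
    (h𝒬 : IsQClass 𝒬) (hcomp : BellmanComplete M R 𝒬) {ε d : ℝ} (hgec : GECBound M R 𝒬 K ε d)
    {lam : ℝ} (hlam : 0 < lam) :
    ∑ k ∈ Finset.Icc 1 K, (run.Q k ω 0 (M.s₁, (run.greedy k ω).act 0 M.s₁) -
        M.value (run.greedy k ω).toPolicy (run.r k ω)) ≤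
      ((∑ k ∈ Finset.Icc 1 K, bellmanError 𝒬 (fun i => run.τ i ω) k (run.r k ω) (run.Q k ω)) +
        K * (H * β)) / lam + d * lam / 2 + Real.sqrt (d * H * K) + ε * H * K := by
  have hmem : ∀ k : Fin K, k.1 + 1 ∈ Finset.Icc 1 K := fun k => by simp
  simp only [sum_Icc_one_eq_sum_fin]
  have hresid := Finset.sum_le_sum fun k (_ : k ∈ Finset.univ) =>
    hβ.sum_integral_sq_bellman_le h𝒬 hcomp (run.r_mem _ (hmem k) ω) (run.Q_mem _ (hmem k) ω) k
  -- The quadratic term of the GEC inequality cancels the Bellman errors of the optimism step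
  -- exactly when its free parameter is `1 / lam`.
  refine (hgec (fun k => run.r (k.1 + 1) ω) (fun k => run.Q (k.1 + 1) ω)
    (fun k => run.greedy (k.1 + 1) ω) (fun k => run.r_mem _ (hmem k) ω)
    (fun k => run.Q_mem _ (hmem k) ω) (fun k => run.isGreedy _ (hmem k) ω) (1 / lam)
    (by positivity)).trans ?_
  gcongr ?_ + ?_ + _ + _
  · refine (mul_le_mul_of_nonneg_left hresid (by positivity)).trans_eq ?_
    simp only [Finset.sum_add_distrib, ← Finset.mul_sum, Finset.sum_const, Finset.card_univ,
      Fintype.card_fin, nsmul_eq_mul]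
    field_simp
  · exact le_of_eq (by field_simp)

theorem Run.IsExcessRadius.sum_value_sub_value_le [NeZero H] (hβ : run.IsExcessRadius β ω)
    (hR : IsRewardClass R) (h𝒬 : IsQClass 𝒬) (hopt : QRealizable M R 𝒬)
    (hcomp : BellmanComplete M R 𝒬) {ε d : ℝ} (hgec : GECBound M R 𝒬 K ε d) {lam : ℝ}
    (hlam : 0 < lam) (π : Policy S A H) :
    ∑ k ∈ Finset.Icc 1 K, (M.value π (run.r k ω) -
        M.value (run.greedy k ω).toPolicy (run.r k ω)) ≤
      K * (run.qOptError lam ω / lam) + 2 * K * (H * β) / lam + d * lam / 2 +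
        Real.sqrt (d * H * K) + ε * H * K := by
  have hoptimism := Finset.sum_le_sum fun k hk => hβ.value_le hR h𝒬 hopt hlam π hk
  have hregret := hβ.sum_greedy_sub_value_le h𝒬 hcomp hgec hlam
  simp only [Finset.sum_add_distrib, Finset.sum_sub_distrib, ← Finset.sum_div, Finset.sum_const,
    Nat.card_Icc, Nat.add_sub_cancel, nsmul_eq_mul] at hoptimism hregret ⊢
  rw [sub_div, add_div] at hoptimism
  rw [add_div] at hregret
  have hdouble : 2 * K * (H * β) / lam = K * (H * β) / lam + K * (H * β) / lam := by ring
  have hscale : K * run.qOptError lam ω / lam = K * (run.qOptError lam ω / lam) :=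
    mul_div_assoc _ _ _
  linarith

end Optimism

section ImitationGap

variable {H : ℕ} {R 𝒬 : Fin H → Set (S × A → ℝ)}
variable {Ω : Type*} [mΩ : MeasurableSpace Ω] {μ : Measure Ω} {M : MDP S A H}
  {πE π₀ : Policy S A H} {N K : ℕ} (run : Run μ M R 𝒬 πE π₀ N K)

theorem MDP.mixValue_eq (M : MDP S A H) (K : ℕ) (π : ℕ → Policy S A H) {r : Fin H → S × A → ℝ}
    (hr : IsUnitReward r) :
    M.mixValue K π r = 1 / (K : ℝ) * ∑ k ∈ Finset.Icc 1 K, M.value (π k) r := by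
  rw [MDP.mixValue, integral_smul_measure,
    integral_finsetSum_measure fun k _ => integrable_pathReward hr _]
  simp [MDP.value]

theorem Run.loss_sub_loss_le (ω : Ω) (k : ℕ) {r r' : Fin H → S × A → ℝ} {ρ : ℝ} (hρ : 0 ≤ ρ)
    (hclose : ∀ h x, |r h x - r' h x| ≤ ρ) :
    run.loss ω k r - run.loss ω k r' ≤ 2 * (H * ρ) := by
  have hpath := (abs_le.1 (abs_pathReward_sub_le hclose (run.τ k ω))).2
  have hexpert := (abs_le.1 (run.abs_expertValue_sub_le ω hρ hclose)).1
  simp only [Run.loss]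
  linarith

theorem Run.sum_loss_sub_loss_le (hR : IsRewardClass R) {r : Fin H → S × A → ℝ}
    (hr : ∀ h, r h ∈ R h) (ω : Ω) :
    1 / (K : ℝ) * ∑ k ∈ Finset.Icc 1 K, (run.loss ω k (run.r k ω) - run.loss ω k r) ≤
      run.rewardOptError ω := by
  refine mul_le_mul_of_nonneg_left ?_ (by positivity)
  refine le_ciSup (f := fun r : {r : Fin H → S × A → ℝ // ∀ h, r h ∈ R h} =>
    ∑ k ∈ Finset.Icc 1 K, (run.loss ω k (run.r k ω) - run.loss ω k r.1)) ?_ ⟨r, hr⟩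
  refine ⟨∑ _k ∈ Finset.Icc 1 K, (2 * (H * 1) : ℝ), Set.forall_mem_range.2 fun r' =>
    Finset.sum_le_sum fun k hk => run.loss_sub_loss_le ω k zero_le_one fun h x => ?_⟩
  have hunit := (run.isUnitReward_r hR hk ω h).2 x
  have hunit' := (hR.isUnitReward r'.2 h).2 x
  exact abs_sub_le_of_nonneg_of_le hunit.1 hunit.2 hunit'.1 hunit'.2

theorem Run.imitationGap_eq (hK : 0 < K) (ω : Ω) :
    run.imitationGap ω = 1 / (K : ℝ) * ∑ k ∈ Finset.Icc 1 K,
      (M.value πE M.reward - M.value (run.greedy k ω).toPolicy M.reward) := by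
  have hvalue : M.value πE M.reward = 1 / (K : ℝ) * ∑ _k ∈ Finset.Icc 1 K,
      M.value πE M.reward := by
    simp [hK.ne']
  rw [Run.imitationGap, M.mixValue_eq K _ M.isUnitReward_reward, Finset.sum_sub_distrib, mul_sub,
    ← hvalue]

theorem Run.imitationGap_le (hR : IsRewardClass R) (hreal : RewardRealizable M R) (hK : 0 < K)
    (ω : Ω) :
    run.imitationGap ω ≤ run.rewardOptError ω + 1 / (K : ℝ) * ∑ k ∈ Finset.Icc 1 K,
      ((run.expertError ω (run.r k ω) - run.expertError ω M.reward) +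
        (run.rewardGap k (ω, run.τ k ω) - ∫ t, run.rewardGap k (ω, t) ∂(run.law k ω)) +
        (M.value πE (run.r k ω) - M.value (run.greedy k ω).toPolicy (run.r k ω))) := by
  rw [run.imitationGap_eq hK]
  refine le_trans (le_of_eq ?_) (add_le_add_left (run.sum_loss_sub_loss_le hR hreal ω) _)
  rw [← mul_add, ← Finset.sum_add_distrib]
  congr 1
  refine Finset.sum_congr rfl fun k hk => ?_
  rw [run.integral_rewardGap hR hk]
  simp only [Run.loss, Run.expertError, Run.rewardGap]
  ring

end ImitationGap

section SampleSize

variable {H : ℕ} {d n δ ε K p : ℝ}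

theorem two_le_mul_div (hd : 1 ≤ d) (hδ : 0 < δ) (hδ1 : δ ≤ 1) (hε : 0 < ε) (hε1 : ε ≤ 1)
    (hHn : 2 ≤ H * n) : 2 ≤ H * d * n / (δ * ε) := by
  have hδε : δ * ε ≤ 1 := mul_le_one₀ hδ1 hε.le hε1
  have hHdn : H * n ≤ H * n * d := le_mul_of_one_le_right (by linarith) hd
  rw [le_div_iff₀ (by positivity)]
  linarith

theorem two_pow_mul_mul_div_le_pow (hH : 1 ≤ H) (hd : 1 ≤ d) (hn : 1 ≤ n) (hδ : 0 < δ) (hδ1 : δ ≤ 1)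
    (hε : 0 < ε) (hε1 : ε ≤ 1) (hHn : 2 ≤ H * n) (hp0 : 0 ≤ p) (hp : p ≤ n ^ H) :
    2 ^ 22 * p * (H ^ 5 * d / (δ * ε ^ 2)) ≤ (H * d * n / (δ * ε)) ^ (28 * H) := by
  have hH' : (1 : ℝ) ≤ H := by exact_mod_cast hH
  have hX2 : 2 ≤ H * d * n / (δ * ε) := two_le_mul_div hd hδ hδ1 hε hε1 hHn
  set X := H * d * n / (δ * ε) with hX
  have hpX : p ≤ X ^ H := hp.trans <| by
    gcongr
    rw [hX, le_div_iff₀ (by positivity)]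
    calc n * (δ * ε) ≤ n := mul_le_of_le_one_right (by positivity) (mul_le_one₀ hδ1 hε.le hε1)
      _ ≤ H * d * n :=
        le_mul_of_one_le_left (by positivity) (one_le_mul_of_one_le_of_one_le hH' hd)
  have hfrac : H ^ 5 * d / (δ * ε ^ 2) ≤ X ^ 5 := by
    rw [hX, div_pow, mul_pow, mul_pow, mul_pow]
    have hdn : d ≤ d ^ 5 * n ^ 5 := (le_self_pow₀ hd (by norm_num)).trans
      (le_mul_of_one_le_right (by positivity) (one_le_pow₀ hn))
    have hδ5 : δ ^ 5 ≤ δ := pow_le_of_le_one hδ.le hδ1 (by norm_num)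
    have hε5 : ε ^ 5 ≤ ε ^ 2 := pow_le_pow_of_le_one hε.le hε1 (by norm_num)
    rw [mul_assoc ((H : ℝ) ^ 5)]
    gcongr
  calc 2 ^ 22 * p * (H ^ 5 * d / (δ * ε ^ 2)) ≤ X ^ 22 * X ^ H * X ^ 5 := by gcongr
    _ = X ^ (27 + H) := by ring
    _ ≤ X ^ (28 * H) := pow_le_pow_right₀ (by linarith) (by omega)

/-- `log K` is absorbed by a small multiple of `K`, using `log x ≤ x`. -/
theorem log_iterations_le (hH : 1 ≤ H) (hd : 1 ≤ d) (hn : 1 ≤ n) (hδ : 0 < δ) (hδ1 : δ ≤ 1)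
    (hε : 0 < ε) (hε1 : ε ≤ 1) (hHn : 2 ≤ H * n) (hK : 0 < K) (hp0 : 0 < p) (hp : p ≤ n ^ H) :
    Real.log (4 * K * H * p / δ) ≤
      28 * H * Real.log (H * d * n / (δ * ε)) + K * ε ^ 2 / (2 ^ 20 * (H ^ 4 * d)) := by
  have hsplit : 4 * K * H * p / δ =
      2 ^ 22 * p * (H ^ 5 * d / (δ * ε ^ 2)) * (K * ε ^ 2 / (2 ^ 20 * (H ^ 4 * d))) := by
    field_simp
    norm_num
  rw [hsplit, Real.log_mul (by positivity) (by positivity)]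
  refine add_le_add ?_ (Real.log_le_self (by positivity))
  calc Real.log (2 ^ 22 * p * (H ^ 5 * d / (δ * ε ^ 2)))
      ≤ Real.log ((H * d * n / (δ * ε)) ^ (28 * H)) :=
        Real.log_le_log (by positivity)
          (two_pow_mul_mul_div_le_pow hH hd hn hδ hδ1 hε hε1 hHn hp0.le hp)
    _ = 28 * H * Real.log (H * d * n / (δ * ε)) := by rw [Real.log_pow]; push_cast; ring

theorem mul_log_iterations_le (hH : 1 ≤ H) (hd : 1 ≤ d) (hn : 1 ≤ n) (hδ : 0 < δ) (hδ1 : δ ≤ 1)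
    (hε : 0 < ε) (hε1 : ε ≤ 1) (hHn : 2 ≤ H * n) (hK : 0 < K) (hp0 : 0 < p) (hp : p ≤ n ^ H)
    (hKε : 10 ^ 7 * (H ^ 4 * d * Real.log (H * d * n / (δ * ε))) ≤ K * ε ^ 2) :
    d * H ^ 3 * Real.log (4 * K * H * p / δ) ≤ K * ε ^ 2 / 40000 := by
  have hH' : (1 : ℝ) ≤ H := by exact_mod_cast hH
  have hcancel : d * H ^ 3 * (K * ε ^ 2 / (2 ^ 20 * (H ^ 4 * d))) = K * ε ^ 2 / (2 ^ 20 * H) := by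
    field_simp
  have hlinear : K * ε ^ 2 / (2 ^ 20 * H) ≤ K * ε ^ 2 / 2 ^ 20 :=
    div_le_div_of_nonneg_left (by positivity) (by positivity) (by linarith)
  have hlog := mul_le_mul_of_nonneg_left
    (log_iterations_le hH hd hn hδ hδ1 hε hε1 hHn hK hp0 hp) (show 0 ≤ d * H ^ 3 by positivity)
  rw [mul_add, hcancel] at hlog
  have hpos : 0 ≤ K * ε ^ 2 := by positivity
  linarith

theorem mul_log_four_div_le {ℓ : ℝ} (hH : 1 ≤ H) (hd : 1 ≤ d) (hδ : 0 < δ) (hδ1 : δ ≤ 1)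
    (hℓ : Real.log 2 ≤ ℓ)
    (hK : 10 ^ 7 * (H ^ 4 * d * ℓ + H ^ 2 * Real.log (1 / δ)) ≤ K * ε ^ 2) :
    144 * H ^ 2 * Real.log (4 / δ) ≤ K * ε ^ 2 := by
  have hH' : (1 : ℝ) ≤ H := by exact_mod_cast hH
  have hlog : Real.log (4 / δ) = 2 * Real.log 2 + Real.log (1 / δ) := by
    rw [show 4 / δ = 2 ^ 2 * (1 / δ) by ring, Real.log_mul (by norm_num) (by positivity),
      Real.log_pow]
    norm_num
  have hδlog : 0 ≤ H ^ 2 * Real.log (1 / δ) :=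
    mul_nonneg (by positivity) (Real.log_nonneg (one_le_one_div hδ hδ1))
  have hHd : (H : ℝ) ^ 2 ≤ H ^ 4 * d :=
    (pow_le_pow_right₀ hH' (by norm_num)).trans (le_mul_of_one_le_right (by positivity) hd)
  have hlog2 : 0 ≤ H ^ 2 * Real.log 2 := by positivity
  have hℓ' : H ^ 2 * Real.log 2 ≤ H ^ 4 * d * ℓ := by gcongr
  rw [hlog]
  linarith

theorem mul_horizon_le {ℓ : ℝ} (hH : 1 ≤ H) (hd : 1 ≤ d) (hℓ : Real.log 2 ≤ ℓ)
    (hK : 10 ^ 7 * (H ^ 4 * d * ℓ) ≤ K * ε ^ 2) : 72 * d * H ≤ K * ε ^ 2 := by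
  have hH' : (1 : ℝ) ≤ H := by exact_mod_cast hH
  have hlog2 : 1 / 2 ≤ ℓ := by linarith [Real.log_two_gt_d9]
  have hHpow : (H : ℝ) ≤ H ^ 4 := le_self_pow₀ hH' (by norm_num)
  have hdH : H * d * (1 / 2) ≤ H ^ 4 * d * ℓ := by gcongr
  have hpos : 0 ≤ d * H := by positivity
  linarith

theorem le_four_mul_div {x y : ℝ} (hK : 1 ≤ K) (hH : 1 ≤ H) (hx : 0 ≤ x) (hy : 1 ≤ y)
    (hδ : 0 < δ) (hδ1 : δ ≤ 1) : x ≤ 4 * K * H * x * y / δ := by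
  have hH' : (1 : ℝ) ≤ H := by exact_mod_cast hH
  rw [le_div_iff₀ hδ]
  calc x * δ ≤ x * 1 := by gcongr
    _ ≤ x * (4 * K * H * y) := by
      gcongr
      exact one_le_mul_of_one_le_of_one_le
        (one_le_mul_of_one_le_of_one_le (by linarith) hH') hy
    _ = 4 * K * H * x * y := by ring

theorem log_mul_mul_div_le {x y : ℝ} (hK : 1 ≤ K) (hH : 1 ≤ H) (hx : 1 ≤ x) (hy : 1 ≤ y)
    (hδ : 0 < δ) (hδ1 : δ ≤ 1) :
    Real.log (K * H * (x * x * y) / (δ / 4)) ≤ 2 * Real.log (4 * K * H * x * y / δ) := by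
  have hxb : x ≤ 4 * K * H * x * y / δ := le_four_mul_div hK hH (by linarith) hy hδ hδ1
  set b := 4 * K * H * x * y / δ with hb
  have hprod : K * H * (x * x * y) / (δ / 4) = x * b := by rw [hb]; field_simp
  have : (0 : ℝ) < H := by exact_mod_cast hH
  calc Real.log (K * H * (x * x * y) / (δ / 4)) = Real.log (x * b) := by rw [hprod]
    _ ≤ Real.log (b ^ 2) := Real.log_le_log (by positivity) (by rw [sq]; gcongr)
    _ = 2 * Real.log b := by rw [Real.log_pow]; norm_num

theorem log_div_div_four_le (hn : 2 ≤ n) (hδ : 0 < δ) (hδ1 : δ ≤ 1) :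
    Real.log (n / (δ / 4)) ≤ 3 * Real.log (n / δ) := by
  have hnδ : n ≤ n / δ := by
    rw [le_div_iff₀ hδ]
    exact mul_le_of_le_one_right (by linarith) hδ1
  calc Real.log (n / (δ / 4)) = Real.log (2 ^ 2 * (n / δ)) := by congr 1; field_simp; norm_num
    _ ≤ Real.log ((n / δ) ^ 2 * (n / δ)) := Real.log_le_log (by positivity) (by gcongr; linarith)
    _ = 3 * Real.log (n / δ) := by rw [← pow_succ, Real.log_pow]; norm_num

theorem iterations_pos (hH : 1 ≤ H) (hd : 1 ≤ d) (hn : 1 ≤ n) (hδ : 0 < δ) (hδ1 : δ < 1)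
    (hε : 0 < ε) (hε1 : ε ≤ 1)
    (hK : 10 ^ 7 * (H ^ 4 * d * Real.log (H * d * n / (δ * ε)) + H ^ 2 * Real.log (1 / δ)) ≤
      K * ε ^ 2) : 0 < K := by
  have hH' : (1 : ℝ) ≤ H := by exact_mod_cast hH
  have hδε : δ * ε ≤ 1 := mul_le_one₀ hδ1.le hε.le hε1
  have hHdn : 1 ≤ H * d * n :=
    one_le_mul_of_one_le_of_one_le (one_le_mul_of_one_le_of_one_le hH' hd) hn
  have hlog : 0 ≤ Real.log (H * d * n / (δ * ε)) :=
    Real.log_nonneg ((one_le_div (by positivity)).2 (hδε.trans hHdn))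
  have hlogδ : 0 < Real.log (1 / δ) := Real.log_pos (one_lt_one_div hδ hδ1)
  exact pos_of_mul_pos_left (lt_of_lt_of_le (by positivity) hK) (sq_nonneg ε)

end SampleSize

section Tuning

variable {H d d' ε ρ K L β lam : ℝ}

theorem horizon_mul_radius_le (hH : 0 < H) (hd : 0 ≤ d) (hε : 0 < ε) (hε1 : ε ≤ 1) :
    H * (1 / 40000 * ε ^ 2 / (H ^ 3 * d + H)) ≤ ε / 40000 := by
  rw [← mul_div_assoc, div_le_iff₀ (by positivity)]
  have hsq : ε ^ 2 ≤ ε := pow_le_of_le_one hε.le hε1 two_ne_zero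
  have hpos : 0 ≤ ε * (H ^ 3 * d) := by positivity
  have hHε : H * ε ^ 2 ≤ H * ε := by gcongr
  linarith

theorem mul_radius_le (hH : 0 < H) (hd : 0 ≤ d) :
    d * H ^ 3 * (1 / 40000 * ε ^ 2 / (H ^ 3 * d + H)) ≤ ε ^ 2 / 40000 := by
  rw [← mul_div_assoc, div_le_iff₀ (by positivity)]
  have hpos : 0 ≤ ε ^ 2 * H := by positivity
  linarith

theorem mul_excessRadius_le (hH : 1 ≤ H) (hd : 0 < d) (hK : 0 < K) (hL : 0 ≤ L) (hρ : 0 ≤ ρ)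
    (hβ : β ≤ 36 * H ^ 2 * L + 19 * K * H * ρ)
    (hlam : lam = 6 * Real.sqrt ((K * H ^ 3 * L + K ^ 2 * H ^ 3 * ρ) / d)) :
    K * (H * β) ≤ d * lam ^ 2 := by
  have hHpow : H ^ 2 ≤ H ^ 3 := pow_le_pow_right₀ hH (by norm_num)
  have hcube : K ^ 2 * ρ * H ^ 2 ≤ K ^ 2 * ρ * H ^ 3 := by gcongr
  have hpos : 0 ≤ K ^ 2 * ρ * H ^ 3 := by positivity
  calc K * (H * β) ≤ K * (H * (36 * H ^ 2 * L + 19 * K * H * ρ)) := by gcongr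
    _ ≤ 36 * (K * H ^ 3 * L + K ^ 2 * H ^ 3 * ρ) := by linarith
    _ = d * lam ^ 2 := by
        rw [hlam, mul_pow, Real.sq_sqrt (by positivity)]
        field_simp
        ring

theorem mul_lam_le (hH : 0 < H) (hd : 0 < d) (hε : 0 < ε) (hK : 0 < K) (hL : 0 ≤ L) (hρ : 0 ≤ ρ)
    (hlam : lam = 6 * Real.sqrt ((K * H ^ 3 * L + K ^ 2 * H ^ 3 * ρ) / d))
    (hdL : d * H ^ 3 * L ≤ K * ε ^ 2 / 40000) (hdρ : d * H ^ 3 * ρ ≤ ε ^ 2 / 40000) :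
    d * lam ≤ K * ε / 18 := by
  refine le_of_sq_le_sq ?_ (by positivity)
  have hdlam : (d * lam) ^ 2 =
      36 * (K * (d * H ^ 3 * L) + K ^ 2 * (d * H ^ 3 * ρ)) := by
    rw [hlam, mul_pow, mul_pow, Real.sq_sqrt (by positivity)]
    field_simp
    ring
  have hKL := mul_le_mul_of_nonneg_left hdL hK.le
  have hKρ := mul_le_mul_of_nonneg_left hdρ (sq_nonneg K)
  have hpos : 0 ≤ K ^ 2 * ε ^ 2 := by positivity
  rw [hdlam]
  linarith

theorem sqrt_mul_le (hH : 0 ≤ H) (hε : 0 ≤ ε) (hK : 0 ≤ K) (hd' : d' ≤ 2 * d)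
    (hdH : 72 * d * H ≤ K * ε ^ 2) : Real.sqrt (d' * H * K) ≤ K * ε / 6 := by
  refine Real.sqrt_le_iff.2 ⟨by positivity, ?_⟩
  have hdd : d' * H * K ≤ 2 * d * H * K := by gcongr
  have hKdH := mul_le_mul_of_nonneg_left hdH hK
  linarith

/-- `lam` balances the first two terms. -/
theorem regret_terms_le (hH : 1 ≤ H) (hd : 0 < d) (hε : 0 < ε) (hK : 0 < K) (hL : 0 ≤ L)
    (hρ : 0 < ρ) (hβ : β ≤ 36 * H ^ 2 * L + 19 * K * H * ρ)
    (hlam : lam = 6 * Real.sqrt ((K * H ^ 3 * L + K ^ 2 * H ^ 3 * ρ) / d))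
    (hdL : d * H ^ 3 * L ≤ K * ε ^ 2 / 40000) (hdρ : d * H ^ 3 * ρ ≤ ε ^ 2 / 40000)
    (hdH : 72 * d * H ≤ K * ε ^ 2) (hd' : d' ≤ 2 * d) :
    2 * K * (H * β) / lam + d' * lam / 2 + Real.sqrt (d' * H * K) + ε / (6 * H) * H * K ≤
      K * (ε / 2) := by
  have hlam0 : 0 < lam := by rw [hlam]; positivity
  have hradius : 2 * K * (H * β) / lam ≤ 2 * (d * lam) := by
    rw [div_le_iff₀ hlam0]
    linarith [mul_excessRadius_le hH hd hK hL hρ.le hβ hlam]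
  have hd'lam : d' * lam ≤ 2 * d * lam := by gcongr
  have hdlam := mul_lam_le (by linarith) hd hε hK hL hρ.le hlam hdL hdρ
  have hsqrt := sqrt_mul_le (by linarith) hε.le hK.le hd' hdH
  have hbias : ε / (6 * H) * H * K = K * ε / 6 := by field_simp
  linarith

theorem regret_terms_le_of_iterations {H : ℕ} {n δ x y : ℝ} (hH : 1 ≤ H) (hd : 1 ≤ d)
    (hn : 1 ≤ n) (hδ : 0 < δ) (hδ1 : δ ≤ 1) (hε : 0 < ε) (hε1 : ε ≤ 1) (hHn : 2 ≤ H * n)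
    (hK : 1 ≤ K) (hx : 1 ≤ x) (hy : 1 ≤ y) (hxy : x * y ≤ n ^ H)
    (hKε : 10 ^ 7 * (H ^ 4 * d * Real.log (H * d * n / (δ * ε)) + H ^ 2 * Real.log (1 / δ)) ≤
      K * ε ^ 2)
    (hρ0 : 0 < ρ) (hdρ : d * H ^ 3 * ρ ≤ ε ^ 2 / 40000)
    (hlam : lam = 6 * Real.sqrt
      ((K * H ^ 3 * Real.log (4 * K * H * x * y / δ) + K ^ 2 * H ^ 3 * ρ) / d))
    (hd' : d' ≤ 2 * d) :
    2 * K * (H * (18 * H ^ 2 * Real.log (K * H * (x * x * y) / (δ / 4)) + 19 * K * H * ρ)) / lam +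
      d' * lam / 2 + Real.sqrt (d' * H * K) + ε / (6 * H) * H * K ≤ K * (ε / 2) := by
  have hH' : (1 : ℝ) ≤ H := by exact_mod_cast hH
  have hδlog : 0 ≤ H ^ 2 * Real.log (1 / δ) :=
    mul_nonneg (by positivity) (Real.log_nonneg (one_le_one_div hδ hδ1))
  have hlog2 : Real.log 2 ≤ Real.log (H * d * n / (δ * ε)) :=
    Real.log_le_log (by norm_num) (two_le_mul_div hd hδ hδ1 hε hε1 hHn)
  have hKd : 10 ^ 7 * (H ^ 4 * d * Real.log (H * d * n / (δ * ε))) ≤ K * ε ^ 2 := by linarith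
  have hL0 : 0 ≤ Real.log (4 * K * H * x * y / δ) :=
    Real.log_nonneg (hx.trans (le_four_mul_div hK hH (by linarith) hy hδ hδ1))
  have hdL := mul_log_iterations_le hH hd hn hδ hδ1 hε hε1 hHn (by linarith)
    (show 0 < x * y by positivity) hxy hKd
  rw [← mul_assoc] at hdL
  refine regret_terms_le hH' (by linarith) hε (by linarith) hL0 hρ0 ?_ hlam hdL hdρ
    (mul_horizon_le hH hd hlog2 hKd) hd'
  have hlog := mul_le_mul_of_nonneg_left (log_mul_mul_div_le hK hH hx hy hδ hδ1)
    (show 0 ≤ 18 * (H : ℝ) ^ 2 by positivity)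
  linarith

end Tuning

section Deviations

variable {H : ℕ} {R 𝒬 : Fin H → Set (S × A → ℝ)}
variable {Ω : Type*} [mΩ : MeasurableSpace Ω] {μ : Measure Ω} {M : MDP S A H}
  {πE π₀ : Policy S A H} {N K : ℕ} (run : Run μ M R 𝒬 πE π₀ N K)

theorem Run.expertError_sub_le (hR : IsRewardClass R) {r : Fin H → S × A → ℝ}
    (hr : ∀ h, r h ∈ R h) {ρ : ℝ} (hρ : 0 ≤ ρ) (hclose : ∀ h x, |r h x - M.reward h x| ≤ ρ)
    (ω : Ω) : run.expertError ω r - run.expertError ω M.reward ≤ 2 * (H * ρ) := by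
  have hexpert := (abs_le.1 (run.abs_expertValue_sub_le ω hρ hclose)).2
  have hvalue :=
    (abs_le.1 (M.abs_value_sub_le πE (hR.isUnitReward hr) M.isUnitReward_reward hclose)).1
  rw [Run.expertError, Run.expertError]
  linarith

theorem expert_radius_le [NeZero H] {n ε δ ρ N : ℝ} (hε : 0 < ε) (hδ : 0 < δ) (hδ1 : δ ≤ 1)
    (hHρ : H * ρ ≤ ε / 40000) (hn : 2 ≤ n) (hN0 : 0 < N)
    (hN : 1000 * (H ^ 2 * Real.log (n / δ) / ε ^ 2) ≤ N) :
    H * (ε / (24 * H)) + H * Real.log (n / (δ / 4)) / (ε / (24 * H) * N) + 2 * H * ρ ≤ ε / 6 := by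
  have hH : (0 : ℝ) < H := Nat.cast_pos.2 (NeZero.pos H)
  rw [← mul_div_assoc, div_le_iff₀ (by positivity)] at hN
  have hvariance : H * (ε / (24 * H)) = ε / 24 := by field_simp
  have hlog : H ^ 2 * Real.log (n / (δ / 4)) ≤ H ^ 2 * (3 * Real.log (n / δ)) := by
    gcongr
    exact log_div_div_four_le hn hδ hδ1
  have hcover : H * Real.log (n / (δ / 4)) / (ε / (24 * H) * N) ≤ ε / 12 := by
    rw [div_le_iff₀ (by positivity)]
    refine le_of_mul_le_mul_left ?_ hH
    calc H * (H * Real.log (n / (δ / 4))) = H ^ 2 * Real.log (n / (δ / 4)) := by ring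
      _ ≤ H * (ε / 12 * (ε / (24 * H) * N)) := by
        rw [show H * (ε / 12 * (ε / (24 * H) * N)) = N * ε ^ 2 / 288 by field_simp; norm_num]
        have hpos : 0 ≤ N * ε ^ 2 := by positivity
        linarith
  linarith

theorem Run.measure_lt_expertError_sub_le [NeZero H] [IsProbabilityMeasure μ]
    (hR : IsRewardClass R) (hreal : RewardRealizable M R) {ε δ ρ n : ℝ} (hε : 0 < ε)
    (hε1 : ε ≤ 1) (hδ : 0 < δ) (hδ1 : δ ≤ 1) (hρ : 0 ≤ ρ) (hHρ : H * ρ ≤ ε / 40000)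
    (hcov : ∀ h, coveringNumber ρ (R h) ≠ ⊤) (hn : ∀ h, covNum ρ (R h) ≤ n)
    (hN : 1000 * (H ^ 2 * Real.log (n / δ) / ε ^ 2) ≤ N) :
    μ {ω | ∃ r : Fin H → S × A → ℝ, (∀ h, r h ∈ R h) ∧
      ε / 6 < run.expertError ω r - run.expertError ω M.reward} ≤ ENNReal.ofReal (δ / 4) := by
  have hH : (1 : ℝ) ≤ H := by exact_mod_cast NeZero.pos H
  rcases lt_or_ge n 2 with hn2 | hn2
  · refine (measure_mono_null (t := ∅) ?_ measure_empty).le.trans zero_le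
    rintro ω ⟨r, hr, hlt⟩
    have hclose : ∀ h x, |r h x - M.reward h x| ≤ 2 * ρ := fun h x =>
      abs_sub_le_of_covNum_lt_two (hcov h) ((hn h).trans_lt hn2) (hr h) (hreal h) x
    have := run.expertError_sub_le hR hr (by positivity) hclose ω
    linarith
  · have hN0 : (0 : ℝ) < N := by
      refine lt_of_lt_of_le ?_ hN
      have hlog : 0 < Real.log (n / δ) := Real.log_pos (by rw [lt_div_iff₀ hδ]; linarith)
      positivity
    have hs1 : ε / (24 * H) ≤ 1 := by
      rw [div_le_one (by positivity)]; linarith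
    refine (measure_mono ?_).trans (run.measure_expertError_deviation_le hR hreal
      (Nat.cast_pos.1 hN0) hρ hcov hn (s := ε / (24 * H)) (δ := δ / 4) (by positivity) hs1
      (by positivity))
    rintro ω ⟨r, hr, hlt⟩
    exact ⟨r, hr, (expert_radius_le hε hδ hδ1 hHρ hn2 hN0 hN).trans hlt.le⟩

theorem Run.measure_lt_sum_rewardGap_sub_le [NeZero H] [IsProbabilityMeasure μ]
    (hR : IsRewardClass R) {ε δ : ℝ} (hε : 0 < ε) (hε1 : ε ≤ 1) (hδ : 0 < δ)
    (hK : 144 * (H : ℝ) ^ 2 * Real.log (4 / δ) ≤ K * ε ^ 2) :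
    μ {ω | K * (ε / 6) < ∑ k ∈ Finset.Icc 1 K,
      (run.rewardGap k (ω, run.τ k ω) - ∫ t, run.rewardGap k (ω, t) ∂(run.law k ω))} ≤
      ENNReal.ofReal (δ / 4) := by
  have hH : (1 : ℝ) ≤ H := by exact_mod_cast NeZero.pos H
  have hsH : ε / (12 * H ^ 2) * H ≤ 1 := by
    rw [show ε / (12 * H ^ 2) * H = ε / (12 * H) by field_simp, div_le_one (by positivity)]
    linarith
  refine (measure_mono fun ω hω => ?_).trans (run.measure_rewardGap_deviation_le hR
    (s := ε / (12 * H ^ 2)) (δ := δ / 4) (by positivity) hsH (by positivity))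
  rw [Set.mem_ofPred_eq] at hω ⊢
  refine le_trans ?_ hω.le
  have hvariance : K * (ε / (12 * H ^ 2)) * (H : ℝ) ^ 2 = K * ε / 12 := by field_simp
  have hconfidence : Real.log (1 / (δ / 4)) / (ε / (12 * H ^ 2)) ≤ K * ε / 12 := by
    rw [one_div_div, div_le_iff₀ (by positivity),
      show K * ε / 12 * (ε / (12 * H ^ 2)) = K * ε ^ 2 / (144 * H ^ 2) by field_simp; norm_num,
      le_div_iff₀ (by positivity)]
    linarith
  linarith

end Deviations

section ShortHorizon

variable {M : MDP S A 1}
  {R 𝒬 : Fin 1 → Set (S × A → ℝ)}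

theorem value_toPolicy_eq_reward (π : DetPolicy S A 1) :
    M.value π.toPolicy M.reward = M.reward 0 (M.s₁, π.act 0 M.s₁) := by
  rw [M.value_eq_integral_qValue _ M.isUnitReward_reward]
  simp only [M.qValue_eq, M.nextValue_of_not_lt _ _ (0 : Fin 1) (lt_irrefl _), integral_zero,
    add_zero]
  exact integral_dirac' (fun a => M.reward 0 (M.s₁, a)) _
    ((M.isUnitReward_reward 0).1.comp measurable_prodMk_left).stronglyMeasurable

theorem optQ_reward_eq_reward (h𝒬 : IsQClass 𝒬) (hopt : ∀ h, M.optQ M.reward h ∈ 𝒬 h) :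
    M.optQ M.reward 0 = M.reward 0 := by
  rw [h𝒬.optQ_eq_bellman M M.isUnitReward_reward hopt]
  funext x
  simp [M.bellman_eq, nextV_of_not_lt]

theorem value_sub_value_greedy_le (h𝒬 : IsQClass 𝒬) (hopt : ∀ h, M.optQ M.reward h ∈ 𝒬 h)
    {Q : Fin 1 → S × A → ℝ} {ρ : ℝ} (hQ : ∀ h, Q h ∈ 𝒬 h)
    (hclose : ∀ x, |Q 0 x - M.optQ M.reward 0 x| ≤ ρ) {π : DetPolicy S A 1}
    (hπ : IsGreedy Q π) (π' : Policy S A 1) :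
    M.value π' M.reward - M.value π.toPolicy M.reward ≤ 2 * ρ := by
  have hmax := (abs_le.1 (h𝒬.abs_iSup_sub_le (hQ 0) (hopt 0) hclose M.s₁)).1
  rw [iSup_eq_of_forall_le (hπ 0 M.s₁)] at hmax
  have hopt_ge := h𝒬.value_le_iSup_optQ M M.isUnitReward_reward hopt π'
  have hact := (abs_le.1 (hclose (M.s₁, π.act 0 M.s₁))).2
  rw [optQ_reward_eq_reward h𝒬 hopt] at hmax hopt_ge hact
  rw [value_toPolicy_eq_reward]
  linarith

end ShortHorizon

section Guarantee

variable {H : ℕ} {R 𝒬 : Fin H → Set (S × A → ℝ)}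
variable {Ω : Type*} [mΩ : MeasurableSpace Ω] {μ : Measure Ω} {M : MDP S A H}
  {πE π₀ : Policy S A H} {N K : ℕ} {run : Run μ M R 𝒬 πE π₀ N K}

theorem Run.imitationGap_le_of_forall_abs_sub_le {M : MDP S A 1} {R 𝒬 : Fin 1 → Set (S × A → ℝ)}
    {πE π₀ : Policy S A 1} (run : Run μ M R 𝒬 πE π₀ N K) (hR : IsRewardClass R)
    (h𝒬 : IsQClass 𝒬) (hreal : RewardRealizable M R) (hopt : QRealizable M R 𝒬) (hK : 0 < K)
    {ρ : ℝ} (hρ : 0 ≤ ρ) (hRρ : ∀ h, ∀ f ∈ R h, ∀ g ∈ R h, ∀ x, |f x - g x| ≤ ρ)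
    (h𝒬ρ : ∀ h, ∀ f ∈ 𝒬 h, ∀ g ∈ 𝒬 h, ∀ x, |f x - g x| ≤ ρ) (ω : Ω) :
    run.imitationGap ω ≤ run.rewardOptError ω + 4 * ρ := by
  have hsuboptimal : ∀ k ∈ Finset.Icc 1 K,
      M.value πE M.reward - M.value (run.greedy k ω).toPolicy M.reward ≤ 2 * ρ := fun k hk =>
    value_sub_value_greedy_le h𝒬 (hopt _ hreal) (run.Q_mem k hk ω)
      (h𝒬ρ 0 _ (run.Q_mem k hk ω 0) _ (hopt _ hreal 0)) (run.isGreedy k hk ω) πE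
  have hloss : ∀ k ∈ Finset.Icc 1 K,
      run.loss ω k M.reward - run.loss ω k (run.r k ω) ≤ 2 * ρ := fun k hk => by
    simpa only [Nat.cast_one, one_mul] using run.loss_sub_loss_le ω k hρ fun h =>
      hRρ h _ (hreal h) _ (run.r_mem k hk ω h)
  refine le_trans ?_ (add_le_add_left (run.sum_loss_sub_loss_le hR hreal ω) _)
  rw [run.imitationGap_eq hK, ← sub_le_iff_le_add', ← mul_sub, ← Finset.sum_sub_distrib,
    div_mul_eq_mul_div, one_mul, div_le_iff₀ (by exact_mod_cast hK)]
  refine (Finset.sum_le_sum (g := fun _ => 4 * ρ) fun k hk => ?_).trans (by simp [mul_comm])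
  linarith [hsuboptimal k hk, hloss k hk]

theorem Run.IsExcessRadius.imitationGap_le [NeZero H] {β : ℝ} {ω : Ω}
    (hβ : run.IsExcessRadius β ω) (hR : IsRewardClass R) (h𝒬 : IsQClass 𝒬)
    (hreal : RewardRealizable M R) (hopt : QRealizable M R 𝒬) (hcomp : BellmanComplete M R 𝒬)
    {ε d : ℝ} (hgec : GECBound M R 𝒬 K ε d) (hK : 0 < K) {lam : ℝ} (hlam : 0 < lam) {a b c : ℝ}
    (hexpert : ∀ r : Fin H → S × A → ℝ, (∀ h, r h ∈ R h) →
      run.expertError ω r - run.expertError ω M.reward ≤ a)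
    (hgap : ∑ k ∈ Finset.Icc 1 K, (run.rewardGap k (ω, run.τ k ω) -
      ∫ t, run.rewardGap k (ω, t) ∂(run.law k ω)) ≤ K * b)
    (hregret : 2 * K * (H * β) / lam + d * lam / 2 + Real.sqrt (d * H * K) + ε * H * K ≤ K * c) :
    run.imitationGap ω ≤ a + b + c + run.rewardOptError ω + run.qOptError lam ω / lam := by
  have hK0 : (0 : ℝ) < K := by exact_mod_cast hK
  have hexpert_sum : ∑ k ∈ Finset.Icc 1 K,
      (run.expertError ω (run.r k ω) - run.expertError ω M.reward) ≤ K * a :=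
    (Finset.sum_le_sum fun k hk => hexpert _ (run.r_mem k hk ω)).trans (by simp)
  have hvalue := hβ.sum_value_sub_value_le hR h𝒬 hopt hcomp hgec hlam πE
  refine (run.imitationGap_le hR hreal hK ω).trans ?_
  rw [Finset.sum_add_distrib, Finset.sum_add_distrib, ← le_sub_iff_add_le', div_mul_eq_mul_div,
    one_mul, div_le_iff₀ hK0]
  linarith

theorem measure_union_union_le_ofReal {E₁ E₂ E₃ : Set Ω} {δ : ℝ} (hδ : 0 ≤ δ)
    (h₁ : μ E₁ ≤ ENNReal.ofReal (δ / 4)) (h₂ : μ E₂ ≤ ENNReal.ofReal (δ / 4))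
    (h₃ : μ E₃ ≤ ENNReal.ofReal (δ / 4)) : μ (E₁ ∪ E₂ ∪ E₃) ≤ ENNReal.ofReal δ :=
  calc μ (E₁ ∪ E₂ ∪ E₃) ≤ μ E₁ + μ E₂ + μ E₃ :=
        (measure_union_le _ _).trans (add_le_add_left (measure_union_le _ _) _)
    _ ≤ ENNReal.ofReal (δ / 4) + ENNReal.ofReal (δ / 4) + ENNReal.ofReal (δ / 4) := by gcongr
    _ = ENNReal.ofReal (δ / 4 + δ / 4 + δ / 4) := by
        rw [← ENNReal.ofReal_add (by positivity) (by positivity),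
          ← ENNReal.ofReal_add (by positivity) (by positivity)]
    _ ≤ ENNReal.ofReal δ := ENNReal.ofReal_le_ofReal (by linarith)

variable (run) {ε δ d ρ lam n : ℝ}

theorem Run.measure_imitationGap_le_of_two_le [NeZero H] [IsProbabilityMeasure μ]
    (hR : IsRewardClass R) (h𝒬 : IsQClass 𝒬) (hreal : RewardRealizable M R)
    (hopt : QRealizable M R 𝒬) (hcomp : BellmanComplete M R 𝒬) (hε : 0 < ε) (hε1 : ε ≤ 1)
    (hδ : 0 < δ) (hδ1 : δ ≤ 1) (hd : 1 ≤ d) (hdG : dGEC M R 𝒬 K (ε / (6 * H)) ≤ d)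
    (hρ0 : 0 < ρ) (hHρ : H * ρ ≤ ε / 40000) (hdρ : d * H ^ 3 * ρ ≤ ε ^ 2 / 40000)
    (hcR : ∀ h, coveringNumber ρ (R h) ≠ ⊤) (hcQ : ∀ h, coveringNumber ρ (𝒬 h) ≠ ⊤)
    (hlam : lam = 6 * Real.sqrt
      ((K * H ^ 3 * Real.log (4 * K * H * covNum ρ (prodClass 𝒬) *
          covNum ρ (prodClass R) / δ) + K ^ 2 * H ^ 3 * ρ) / d))
    (hN : 1000 * (H ^ 2 * Real.log ((⨆ h, covNum ρ (R h)) / δ) / ε ^ 2) ≤ N)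
    (hn : ∀ h, covNum ρ (𝒬 h) * covNum ρ (R h) ≤ n) (hn1 : 1 ≤ n) (hHn : 2 ≤ H * n)
    (hK : 0 < K)
    (hKε : 10 ^ 7 * (H ^ 4 * d * Real.log (H * d * n / (δ * ε)) + H ^ 2 * Real.log (1 / δ)) ≤
      K * ε ^ 2) :
    μ {ω | ¬ (run.imitationGap ω ≤
        ε + run.rewardOptError ω + run.qOptError lam ω / lam)} ≤ ENNReal.ofReal δ := by
  have hH : 1 ≤ H := NeZero.pos H
  have hK1 : (1 : ℝ) ≤ K := by exact_mod_cast hK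
  have hNQ : 1 ≤ covNum ρ (prodClass 𝒬) := one_le_covNum (coveringNumber_prodClass_ne_top hcQ)
    ⟨fun p => M.optQ M.reward p.1 p.2, hopt _ hreal⟩
  have hNR : 1 ≤ covNum ρ (prodClass R) := one_le_covNum (coveringNumber_prodClass_ne_top hcR)
    ⟨fun p => M.reward p.1 p.2, hreal⟩
  have hlam0 : 0 < lam := by
    have hL0 := Real.log_nonneg
      (hNQ.trans (le_four_mul_div hK1 hH (by linarith) hNR hδ hδ1))
    have : (0 : ℝ) < H := by exact_mod_cast hH
    rw [hlam]
    positivity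
  obtain ⟨d', hd', hgec⟩ := exists_gecBound hR h𝒬 (by positivity)
    (show dGEC M R 𝒬 K (ε / (6 * H)) < 2 * d by linarith)
  have hregret := regret_terms_le_of_iterations hH hd hn1 hδ hδ1 hε hε1 hHn hK1 hNQ hNR
    (covNum_prodClass_mul_le_pow hcQ hcR hn) hKε hρ0 hdρ hlam hd'
  have hlog2 : Real.log 2 ≤ Real.log (H * d * n / (δ * ε)) :=
    Real.log_le_log (by norm_num) (two_le_mul_div hd hδ hδ1 hε hε1 hHn)
  refine (measure_mono fun ω hω => ?_).trans (measure_union_union_le_ofReal hδ.le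
    (run.measure_lt_expertError_sub_le hR hreal hε hε1 hδ hδ1 hρ0.le hHρ hcR
      (le_ciSup (Set.finite_range _).bddAbove) hN)
    (run.measure_lt_sum_rewardGap_sub_le hR hε hε1 hδ (mul_log_four_div_le hH hd hδ hδ1 hlog2 hKε))
    (run.measure_not_isExcessRadius_le h𝒬 hcomp hρ0.le (div_pos hδ four_pos) hcR hcQ))
  by_contra hgood
  simp only [Set.mem_union, Set.mem_ofPred_eq, not_or, not_exists, not_and, not_lt,
    not_not] at hgood
  obtain ⟨⟨hexpert, hgap⟩, hβ⟩ := hgood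
  refine hω ?_
  linarith [hβ.imitationGap_le hR h𝒬 hreal hopt hcomp hgec hK hlam0 hexpert hgap hregret]

theorem Run.imitationGap_le_of_lt_two [NeZero H] (hR : IsRewardClass R) (h𝒬 : IsQClass 𝒬)
    (hreal : RewardRealizable M R) (hopt : QRealizable M R 𝒬) (hρ0 : 0 < ρ)
    (hHρ : H * ρ ≤ ε / 40000) (hcR : ∀ h, coveringNumber ρ (R h) ≠ ⊤)
    (hcQ : ∀ h, coveringNumber ρ (𝒬 h) ≠ ⊤) (hlam : 0 ≤ lam)
    (hn : ∀ h, covNum ρ (𝒬 h) * covNum ρ (R h) ≤ n) (hn1 : 1 ≤ n) (hHn : H * n < 2)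
    (hK : 0 < K) (ω : Ω) :
    run.imitationGap ω ≤ ε + run.rewardOptError ω + run.qOptError lam ω / lam := by
  have hH_lt : H < 2 := by
    exact_mod_cast (le_mul_of_one_le_right (Nat.cast_nonneg H) hn1).trans_lt hHn
  obtain rfl : H = 1 := by have := NeZero.pos H; omega
  rw [Nat.cast_one, one_mul] at hHn hHρ
  have hcovR : ∀ h, covNum ρ (R h) < 2 := fun h =>
    (le_mul_of_one_le_left (covNum_nonneg _ _)
      (one_le_covNum (hcQ h) ⟨_, hopt _ hreal h⟩)).trans_lt ((hn h).trans_lt hHn)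
  have hcovQ : ∀ h, covNum ρ (𝒬 h) < 2 := fun h =>
    (le_mul_of_one_le_right (covNum_nonneg _ _)
      (one_le_covNum (hcR h) ⟨_, hreal h⟩)).trans_lt ((hn h).trans_lt hHn)
  have hgap := run.imitationGap_le_of_forall_abs_sub_le hR h𝒬 hreal hopt hK
    (mul_nonneg zero_le_two hρ0.le)
    (fun h _ hf _ hg => abs_sub_le_of_covNum_lt_two (hcR h) (hcovR h) hf hg)
    (fun h _ hf _ hg => abs_sub_le_of_covNum_lt_two (hcQ h) (hcovQ h) hf hg) ω
  have hopt_nonneg := div_nonneg (run.qOptError_nonneg h𝒬 hK hlam ω) hlam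
  linarith

theorem Run.measure_imitationGap_le [NeZero H] [IsProbabilityMeasure μ]
    (hR : IsRewardClass R) (h𝒬 : IsQClass 𝒬) (hreal : RewardRealizable M R)
    (hopt : QRealizable M R 𝒬) (hcomp : BellmanComplete M R 𝒬) (hε : 0 < ε) (hε1 : ε ≤ 1)
    (hδ : 0 < δ) (hδ1 : δ < 1) (hd : 1 ≤ d) (hdG : dGEC M R 𝒬 K (ε / (6 * H)) ≤ d)
    (hρ0 : 0 < ρ) (hHρ : H * ρ ≤ ε / 40000) (hdρ : d * H ^ 3 * ρ ≤ ε ^ 2 / 40000)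
    (hcR : ∀ h, coveringNumber ρ (R h) ≠ ⊤) (hcQ : ∀ h, coveringNumber ρ (𝒬 h) ≠ ⊤)
    (hlam : lam = 6 * Real.sqrt
      ((K * H ^ 3 * Real.log (4 * K * H * covNum ρ (prodClass 𝒬) *
          covNum ρ (prodClass R) / δ) + K ^ 2 * H ^ 3 * ρ) / d))
    (hN : 1000 * (H ^ 2 * Real.log ((⨆ h, covNum ρ (R h)) / δ) / ε ^ 2) ≤ N)
    (hKε : 10 ^ 7 * (H ^ 4 * d * Real.log
        (H * d * (⨆ h, covNum ρ (𝒬 h) * covNum ρ (R h)) / (δ * ε)) +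
      H ^ 2 * Real.log (1 / δ)) ≤ K * ε ^ 2) :
    μ {ω | ¬ (run.imitationGap ω ≤
        ε + run.rewardOptError ω + run.qOptError lam ω / lam)} ≤ ENNReal.ofReal δ := by
  have hn := le_ciSup (Set.finite_range fun h => covNum ρ (𝒬 h) * covNum ρ (R h)).bddAbove
  set n := ⨆ h, covNum ρ (𝒬 h) * covNum ρ (R h)
  have hn1 : 1 ≤ n := le_trans (one_le_mul_of_one_le_of_one_le
    (one_le_covNum (hcQ 0) ⟨_, hopt _ hreal 0⟩) (one_le_covNum (hcR 0) ⟨_, hreal 0⟩)) (hn 0)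
  have hK := iterations_pos (NeZero.pos H) hd hn1 hδ hδ1 hε hε1 hKε
  rcases le_or_gt 2 (H * n) with hHn | hHn
  · exact run.measure_imitationGap_le_of_two_le hR h𝒬 hreal hopt hcomp hε hε1 hδ hδ1.le hd hdG
      hρ0 hHρ hdρ hcR hcQ hlam hN hn hn1 hHn (Nat.cast_pos.1 hK) hKε
  · refine (measure_mono_null (t := ∅) ?_ measure_empty).le.trans zero_le
    exact fun ω hω => hω <| run.imitationGap_le_of_lt_two hR h𝒬 hreal hopt hρ0 hHρ hcR hcQ
      (hlam ▸ by positivity) hn hn1 hHn (Nat.cast_pos.1 hK) ω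

end Guarantee

end OptAil

theorem theorem1 :
    ∃ c₁ c₂ cN cK : ℝ, 0 < c₁ ∧ 0 < c₂ ∧ 0 < cN ∧ 0 < cK ∧
      ∀ {S A Ω : Type*} [MeasurableSpace S] [MeasurableSpace A] [MeasurableSpace Ω]
        (H : ℕ) [NeZero H] (M : OptAil.MDP S A H)
        (R 𝒬 : Fin H → Set (S × A → ℝ)),
        OptAil.IsRewardClass R → OptAil.IsQClass 𝒬 →
        OptAil.RewardRealizable M R → OptAil.QRealizable M R 𝒬 → OptAil.BellmanComplete M R 𝒬 →
      ∀ (πE π₀ : OptAil.Policy S A H) (N K : ℕ)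
        (μ : MeasureTheory.Measure Ω) [MeasureTheory.IsProbabilityMeasure μ]
        (run : OptAil.Run μ M R 𝒬 πE π₀ N K)
        (ε δ d ρ lam : ℝ), 0 < ε → ε ≤ 1 → 0 < δ → δ ≤ 1 →
        1 ≤ d → OptAil.dGEC M R 𝒬 K (ε / (6 * H)) ≤ d →
        ρ = c₂ * ε ^ 2 / (H ^ 3 * d + H) →
        (∀ h, OptAil.coveringNumber ρ (R h) ≠ ⊤) →
        (∀ h, OptAil.coveringNumber ρ (𝒬 h) ≠ ⊤) →
        lam = c₁ * Real.sqrt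
          ((K * H ^ 3 * Real.log (4 * K * H * OptAil.covNum ρ (OptAil.prodClass 𝒬) *
              OptAil.covNum ρ (OptAil.prodClass R) / δ) + K ^ 2 * H ^ 3 * ρ) / d) →
        cN * (H ^ 2 * Real.log ((⨆ h, OptAil.covNum ρ (R h)) / δ) / ε ^ 2) ≤ N →
        cK * ((H ^ 4 * d * Real.log
              (H * d * (⨆ h, OptAil.covNum ρ (𝒬 h) * OptAil.covNum ρ (R h)) / (δ * ε)) +
            H ^ 2 * Real.log (1 / δ)) / ε ^ 2) ≤ K →
        μ {ω | ¬ (run.imitationGap ω ≤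
            ε + run.rewardOptError ω + run.qOptError lam ω / lam)} ≤ ENNReal.ofReal δ := by
  refine ⟨6, 1 / 40000, 1000, 10 ^ 7, by norm_num, by norm_num, by norm_num, by norm_num, ?_⟩
  intro S A Ω _ _ _ H _ M R 𝒬 hR h𝒬 hreal hopt hcomp πE π₀ N K μ _ run ε δ d ρ lam hε hε1 hδ hδ1
    hd hdG hρ hcR hcQ hlam hN hK
  rcases hδ1.eq_or_lt with rfl | hδ1
  · exact prob_le_one.trans_eq ENNReal.ofReal_one.symm
  have hH : (0 : ℝ) < H := Nat.cast_pos.2 (NeZero.pos H)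
  have hd0 : 0 ≤ d := zero_le_one.trans hd
  rw [← mul_div_assoc, div_le_iff₀ (by positivity)] at hK
  exact run.measure_imitationGap_le hR h𝒬 hreal hopt hcomp hε hε1 hδ hδ1 hd hdG
    (hρ ▸ by positivity) (hρ ▸ OptAil.horizon_mul_radius_le hH hd0 hε hε1)
    (hρ ▸ OptAil.mul_radius_le hH hd0) hcR hcQ hlam hN hK
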